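/- Let $K$ be a field. $\mathbf{LREL}$ is the category of finite-dimensional $K$-vector spaces in which the morphisms $X\leftarrow Y$ are the linear subspaces of $X\times Y$, composed as relations. $\mathbf{ILREL}$ (resp. $\mathbf{CLREL}$) is the category of finite-dimensional symplectic $K$-vector spaces in which the morphisms $X\leftarrow Y$ are the isotropic (resp. coisotropic) subspaces of $X\times\overline{Y}$, where $\overline Y$ is $Y$ with the opposite symplectic form. Let $\mathbf C$ be one of these categories and $\mathbf 1$ its unit object, the zero space. A composable pair $X\xleftarrow{f}Y\xleftarrow{g}Z$ is *strongly transversal* if it is monic ($(x,y),(x,y')\in f$ and $(y,z),(y',z)\in g$ imply $y=y'$) and transversal ($f\times g+X\times\Delta_Y\times Z=X\times Y\times Y\times Z$). The Wehrheim–Woodward category $WW(\mathbf C)$ has the objects of $\mathbf C$; its morphisms are the classes $[f_1,\dots,f_r]$ of composable sequences, composed by concatenation, for the equivalence relation generated by replacing a strongly transversal pair of adjacent entries by its composition and by removing an identity entry. The *shadow* of $[f_1,\dots,f_r]$ is $f_1\cdots f_r$. For a sequence $f_j: X_{j-1}\leftarrow X_j$, put $V=X_0\times X_1\times X_1\times\cdots\times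 X_{r-1}\times X_{r-1}\times X_r$; the *defect* $\mathcal D(f_1,\dots,f_r)$ is the codimension of $(f_1\times\cdots\times f_r)+(X_0\times\Delta_{X_1}\times\cdots\times\Delta_{X_{r-1}}\times X_r)$ in $V$, and the *excess* $\mathcal E(f_1,\dots,f_r)$ is the dimension of $(f_1\times\cdots\times f_r)\cap(0_{X_0}\times\Delta_{X_1}\times\cdots\times\Delta_{X_{r-1}}\times 0_{X_r})$. Let $A\subseteq\mathbb Z_+\times\mathbb Z_+$ be the additive submonoid of all pairs $(d,e)$ if $\mathbf C=\mathbf{LREL}$, of the pairs with $e\le d$ if $\mathbf C=\mathbf{ILREL}$, and of the pairs with $d\le e$ if $\mathbf C=\mathbf{CLREL}$. **Theorem.** For $\mathbf C=\mathbf{LREL}$, $\mathbf{ILREL}$ and $\mathbf{CLREL}$: 1. Defect and excess depend only on the class of a composable sequence, and a morphism of $WW(\mathbf C)$ is determined by its shadow, its defect and its excess. 2. For all objects $X,Y$, each morphism $f:X\leftarrow Y$ of $\mathbf C$ and all $d,e\in\mathbb Z_+$, there is a morphism $X\leftarrow Y$ in $WW(\mathbf C)$ with shadow $f$, defect $d$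 and excess $e$ if and only if $(d,e)\in A$. 3. $(\mathcal D,\mathcal E)$ is an isomorphism of monoids from the endomorphisms of $\mathbf 1$ in $WW(\mathbf C)$ (under composition) onto $A$. 4. $WW(\mathbf C)$ is the central extension of $\mathbf C$ by the endomorphisms of $\mathbf 1$ with cocycle $(\mathcal D,\mathcal E)$. That is: $(f,g)\mapsto(\mathcal D(f,g),\mathcal E(f,g))$ is a normalized $A$-valued 2-cocycle on $\mathbf C$; the map $w\mapsto(\mathrm{shadow}(w),(\mathcal D(w),\mathcal E(w)))$ is an isomorphism, over $\mathbf C$, from $WW(\mathbf C)$ onto the category with the objects of $\mathbf C$, whose morphisms are the pairs $(f,a)$ of a morphism $f$ of $\mathbf C$ and an element $a\in A$, with composition $(f,a)(g,b)=(fg,\;a+b+(\mathcal D(f,g),\mathcal E(f,g)))$; and the tensor product $a\otimes w$ with an endomorphism $a$ of $\mathbf 1$ has the same shadow as $w$ and $(\mathcal D,\mathcal E)(a\otimes w)=(\mathcal D,\mathcal E)(a)+(\mathcal D,\mathcal E)(w)$. -/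

import Mathlib

open CategoryTheory

universe u

namespace WWRel

/-! ### Operations on linear relations between modules -/

section Relations

variable {K : Type u} [Field K]
variable {X Y Z W : Type u} [AddCommGroup X] [Module K X] [AddCommGroup Y] [Module K Y]
  [AddCommGroup Z] [Module K Z] [AddCommGroup W] [Module K W]

/-- The diagonal of `X × X`. -/
def idRel (K : Type u) [Field K] (X : Type u) [AddCommGroup X] [Module K X] :
    Submodule K (X × X) where
  carrier := {p | p.1 = p.2}
  add_mem' := by
    intro a b ha hb
    simp only [Set.mem_ofPred_eq, Prod.fst_add, Prod.snd_add] at *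
    rw [ha, hb]
  zero_mem' := rfl
  smul_mem' := by
    intro c a ha
    simp only [Set.mem_ofPred_eq, Prod.smul_fst, Prod.smul_snd] at *
    rw [ha]

/-- The composed relation `f g ⊆ X × Z` of `f ⊆ X × Y` and `g ⊆ Y × Z`. -/
def compRel (f : Submodule K (X × Y)) (g : Submodule K (Y × Z)) : Submodule K (X × Z) where
  carrier := {p | ∃ y, (p.1, y) ∈ f ∧ (y, p.2) ∈ g}
  add_mem' := by
    rintro a b ⟨y, h1, h2⟩ ⟨y', h1', h2'⟩
    exact ⟨y + y', f.add_mem h1 h1', g.add_mem h2 h2'⟩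
  zero_mem' := ⟨0, f.zero_mem, g.zero_mem⟩
  smul_mem' := by
    rintro c a ⟨y, h1, h2⟩
    exact ⟨c • y, f.smul_mem c h1, g.smul_mem c h2⟩

/-- The product `f × Δ_W`, as a relation from `Y × W` to `X × W`. -/
def tensorRel (f : Submodule K (X × Y)) (W : Type u) [AddCommGroup W] [Module K W] :
    Submodule K ((X × W) × (Y × W)) where
  carrier := {p | (p.1.1, p.2.1) ∈ f ∧ p.1.2 = p.2.2}
  add_mem' := by
    rintro a b ⟨h1, h2⟩ ⟨h1', h2'⟩
    refine ⟨f.add_mem h1 h1', ?_⟩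
    simp only [Prod.fst_add, Prod.snd_add, h2, h2']
  zero_mem' := ⟨f.zero_mem, rfl⟩
  smul_mem' := by
    rintro c a ⟨h1, h2⟩
    refine ⟨f.smul_mem c h1, ?_⟩
    simp only [Prod.smul_fst, Prod.smul_snd, h2]

/-- The transposed relation. -/
def transposeRel (f : Submodule K (X × Y)) : Submodule K (Y × X) where
  carrier := {p | (p.2, p.1) ∈ f}
  add_mem' := fun ha hb => f.add_mem ha hb
  zero_mem' := f.zero_mem
  smul_mem' := fun c _ ha => f.smul_mem c ha

/-- The graph of the canonical isomorphism `X ← 0 × X`. -/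
def unitorRel (K : Type u) [Field K] (X : Type u) [AddCommGroup X] [Module K X] :
    Submodule K (X × (PUnit.{u + 1} × X)) where
  carrier := {p | p.1 = p.2.2}
  add_mem' := by
    intro a b ha hb
    simp only [Set.mem_ofPred_eq, Prod.fst_add, Prod.snd_add] at *
    rw [ha, hb]
  zero_mem' := rfl
  smul_mem' := by
    intro c a ha
    simp only [Set.mem_ofPred_eq, Prod.smul_fst, Prod.smul_snd] at *
    rw [ha]

/-- The subspace `X × Δ_Y × Z` of `X × Y × Y × Z`. -/
def middleDiagonal (K : Type u) [Field K] (X Y Z : Type u) [AddCommGroup X] [Module K X]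
    [AddCommGroup Y] [Module K Y] [AddCommGroup Z] [Module K Z] :
    Submodule K ((X × Y) × (Y × Z)) where
  carrier := {t | t.1.2 = t.2.1}
  add_mem' := by
    intro a b ha hb
    simp only [Set.mem_ofPred_eq, Prod.fst_add, Prod.snd_add] at *
    rw [ha, hb]
  zero_mem' := rfl
  smul_mem' := by
    intro c a ha
    simp only [Set.mem_ofPred_eq, Prod.smul_fst, Prod.smul_snd] at *
    rw [ha]

/-- A composable pair is monic if each element of the composed relation arises through exactly
one element of the intermediate space. -/
def Monic (f : Submodule K (X × Y)) (g : Submodule K (Y × Z)) : Prop :=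
  ∀ (x : X) (y y' : Y) (z : Z), (x, y) ∈ f → (x, y') ∈ f → (y, z) ∈ g → (y', z) ∈ g → y = y'

/-- A composable pair is transversal if `f × g + X × Δ_Y × Z` is all of `X × Y × Y × Z`. -/
def Transversal (f : Submodule K (X × Y)) (g : Submodule K (Y × Z)) : Prop :=
  f.prod g ⊔ middleDiagonal K X Y Z = ⊤

/-- Strong transversality: monic and transversal. -/
def StronglyTransversal (f : Submodule K (X × Y)) (g : Submodule K (Y × Z)) : Prop :=
  Monic f g ∧ Transversal f g

theorem transversal_iff (f : Submodule K (X × Y)) (g : Submodule K (Y × Z)) :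
    Transversal f g ↔ ∀ y : Y, ∃ x a b z, (x, a) ∈ f ∧ (b, z) ∈ g ∧ y = a - b := by
  unfold Transversal
  constructor
  · intro h y
    have hy : (((0, y), (0, 0)) : (X × Y) × (Y × Z)) ∈ f.prod g ⊔ middleDiagonal K X Y Z := by
      rw [h]; trivial
    obtain ⟨p, hp, q, hq, hpq⟩ := Submodule.mem_sup.1 hy
    obtain ⟨⟨x, a⟩, ⟨b, z⟩⟩ := p
    obtain ⟨⟨x', a'⟩, ⟨b', z'⟩⟩ := q
    have hq' : a' = b' := hq
    simp only [Prod.mk_add_mk, Prod.mk.injEq] at hpq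
    obtain ⟨⟨-, h1⟩, h2, -⟩ := hpq
    refine ⟨x, a, b, z, hp.1, hp.2, ?_⟩
    have h3 : b = - b' := eq_neg_of_add_eq_zero_left h2
    rw [← h1, hq', h3, sub_neg_eq_add]
  · intro h
    rw [eq_top_iff]
    rintro ⟨⟨x0, y1⟩, ⟨y2, z0⟩⟩ -
    obtain ⟨x, a, b, z, h1, h2, h3⟩ := h (y1 - y2)
    refine Submodule.mem_sup.2 ⟨((x, a), (b, z)), ⟨h1, h2⟩,
      ((x0 - x, y1 - a), (y2 - b, z0 - z)), ?_, ?_⟩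
    · change y1 - a = y2 - b
      rw [sub_eq_sub_iff_sub_eq_sub, h3]
    · simp

theorem StronglyTransversal.tensorRel {f : Submodule K (X × Y)} {g : Submodule K (Y × Z)}
    (h : StronglyTransversal f g) :
    StronglyTransversal (tensorRel f W) (tensorRel g W) := by
  refine ⟨?_, ?_⟩
  · rintro ⟨x, w⟩ ⟨y, w1⟩ ⟨y', w2⟩ ⟨z, w'⟩ ⟨h1, e1⟩ ⟨h2, e2⟩ ⟨h3, e3⟩ ⟨h4, e4⟩
    have := h.1 x y y' z h1 h2 h3 h4
    simp only at e1 e2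
    rw [this, ← e1, ← e2]
  · have h2 := (transversal_iff f g).1 h.2
    rw [transversal_iff]
    rintro ⟨y, w⟩
    obtain ⟨x, a, b, z, hf, hg, e⟩ := h2 y
    exact ⟨(x, w), (a, w), (b, 0), (z, 0), ⟨hf, rfl⟩, ⟨hg, rfl⟩, by simp [e]⟩

theorem id_compRel (f : Submodule K (X × Y)) : compRel (idRel K X) f = f := by
  ext ⟨x, y⟩
  constructor
  · rintro ⟨x', h, h'⟩
    have h : x = x' := h
    rw [h]; exact h'
  · intro h
    exact ⟨x, rfl, h⟩

theorem compRel_id (f : Submodule K (X × Y)) : compRel f (idRel K Y) = f := by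
  ext ⟨x, y⟩
  constructor
  · rintro ⟨y', h, h'⟩
    have h' : y' = y := h'
    rw [← h']; exact h
  · intro h
    exact ⟨y, h, rfl⟩

theorem compRel_assoc (f : Submodule K (X × Y)) (g : Submodule K (Y × Z))
    (h : Submodule K (Z × W)) : compRel (compRel f g) h = compRel f (compRel g h) := by
  ext ⟨x, w⟩
  constructor
  · rintro ⟨z, ⟨y, h1, h2⟩, h3⟩
    exact ⟨y, h1, z, h2, h3⟩
  · rintro ⟨y, h1, z, h2, h3⟩
    exact ⟨z, ⟨y, h1, h2⟩, h3⟩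

theorem tensorRel_id : tensorRel (idRel K X) W = idRel K (X × W) := by
  ext ⟨⟨x, w⟩, ⟨x', w'⟩⟩
  constructor
  · rintro ⟨h1, h2⟩
    exact Prod.ext h1 h2
  · intro h
    have h : (x, w) = (x', w') := h
    exact ⟨congrArg Prod.fst h, congrArg Prod.snd h⟩

theorem tensorRel_comp (f : Submodule K (X × Y)) (g : Submodule K (Y × Z)) :
    tensorRel (compRel f g) W = compRel (tensorRel f W) (tensorRel g W) := by
  ext ⟨⟨x, w⟩, ⟨z, w'⟩⟩
  constructor
  · rintro ⟨⟨y, h1, h2⟩, e⟩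
    exact ⟨(y, w), ⟨h1, rfl⟩, ⟨h2, e⟩⟩
  · rintro ⟨⟨y, w''⟩, ⟨h1, e1⟩, ⟨h2, e2⟩⟩
    exact ⟨⟨y, h1, h2⟩, e1.trans e2⟩

theorem unitor_comp_transpose :
    compRel (unitorRel K X) (transposeRel (unitorRel K X)) = idRel K X := by
  ext ⟨x, x'⟩
  constructor
  · rintro ⟨⟨_, y⟩, h1, h2⟩
    have h1 : x = y := h1
    have h2 : x' = y := h2
    exact h1.trans h2.symm
  · intro h
    have h : x = x' := h
    exact ⟨(PUnit.unit, x), rfl, h.symm⟩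

theorem transpose_comp_unitor :
    compRel (transposeRel (unitorRel K X)) (unitorRel K X) = idRel K (PUnit.{u + 1} × X) := by
  ext ⟨⟨a, x⟩, ⟨b, x'⟩⟩
  constructor
  · rintro ⟨y, h1, h2⟩
    have h1 : y = x := h1
    have h2 : y = x' := h2
    exact Prod.ext rfl (h1.symm.trans h2)
  · intro h
    exact ⟨x, rfl, congrArg Prod.snd h⟩

end Relations

/-! ### The category of linear relations -/

/-- Objects of `LREL`: finite-dimensional vector spaces over `K`. -/
structure LREL (K : Type u) [Field K] : Type (u + 1) where
  carrier : Type u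
  [addCommGroup : AddCommGroup carrier]
  [module : Module K carrier]
  [finiteDimensional : FiniteDimensional K carrier]

attribute [instance] LREL.addCommGroup LREL.module LREL.finiteDimensional

section LREL

variable {K : Type u} [Field K]

/-- A linear relation to `X` from `Y`. -/
@[ext]
structure LinRel (X Y : LREL K) : Type u where
  rel : Submodule K (X.carrier × Y.carrier)

/-- A categorical arrow `Y ⟶ X` is a linear relation to `X` from `Y`, i.e. a subspace of `X × Y`,
and `g ≫ f` is the composed relation `f g`. -/
instance : Category.{u} (LREL K) where
  Hom Y X := LinRel X Y
  id X := ⟨idRel K X.carrier⟩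
  comp g f := ⟨compRel f.rel g.rel⟩
  id_comp f := LinRel.ext (compRel_id f.rel)
  comp_id f := LinRel.ext (id_compRel f.rel)
  assoc h g f := LinRel.ext (compRel_assoc f.rel g.rel h.rel).symm

/-- The subspace of `X × Y` underlying an arrow `Y ⟶ X`. -/
def LREL.rel {Y X : LREL K} (f : Y ⟶ X) : Submodule K (X.carrier × Y.carrier) :=
  LinRel.rel f

/-- The zero space, the unit object. -/
def LREL.one (K : Type u) [Field K] : LREL K := ⟨PUnit.{u + 1}⟩

/-- The Cartesian product of vector spaces, the monoidal product of `LREL`. -/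
def LREL.prod (X Y : LREL K) : LREL K := ⟨X.carrier × Y.carrier⟩

/-! ### Excess and defect of composable sequences

A composable sequence `(f₁, …, f_r)`, `f_j : X_{j-1} ← X_j`, is a path from `X_r` to `X₀` in the
quiver of the category; `f₁` is its last arrow. -/

/-- The space `X₀ × X₁ × X₁ × X₂ × ⋯ × X_{r-1} × X_{r-1} × X_r` of a composable sequence. -/
def ambient {Y : LREL K} : {X : LREL K} → Quiver.Path Y X → LREL K
  | _, .nil => LREL.one K
  | _, @Quiver.Path.cons _ _ _ Z X p _ => (X.prod Z).prod (ambient p)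

/-- The subspace `f₁ × ⋯ × f_r` of the ambient space. -/
def productRel {Y : LREL K} : {X : LREL K} → (p : Quiver.Path Y X) →
    Submodule K (ambient p).carrier
  | _, .nil => ⊤
  | _, .cons p f => (LREL.rel f).prod (productRel p)

/-- The triples `(x₀, t, x_r)` such that `t = ((x₀, x₁), (x₁, x₂), …, (x_{r-1}, x_r))` is a chain
that starts at `x₀` and ends at `x_r` (so `x₀ = x_r` for the empty sequence). -/
def chains {Y : LREL K} : {X : LREL K} → (p : Quiver.Path Y X) →
    Submodule K (X.carrier × (ambient p).carrier × Y.carrier)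
  | _, .nil =>
    { carrier := {s | s.1 = s.2.2}
      add_mem' := by
        intro a b ha hb
        simp only [Set.mem_ofPred_eq, Prod.fst_add, Prod.snd_add] at *
        rw [ha, hb]
      zero_mem' := rfl
      smul_mem' := by
        intro c a ha
        simp only [Set.mem_ofPred_eq, Prod.smul_fst, Prod.smul_snd] at *
        rw [ha] }
  | X, @Quiver.Path.cons _ _ _ Z _ p _ =>
    { carrier := {s : X.carrier × ((X.carrier × Z.carrier) × (ambient p).carrier) × Y.carrier |
          s.1 = s.2.1.1.1 ∧ (s.2.1.1.2, s.2.1.2, s.2.2) ∈ chains p}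
      add_mem' := by
        rintro a b ⟨h1, h2⟩ ⟨h1', h2'⟩
        exact ⟨congrArg₂ (· + ·) h1 h1', (chains p).add_mem h2 h2'⟩
      zero_mem' := ⟨rfl, (chains p).zero_mem⟩
      smul_mem' := by
        rintro c a ⟨h1, h2⟩
        exact ⟨congrArg (c • ·) h1, (chains p).smul_mem c h2⟩ }

/-- The subspace `X₀ × Δ_{X₁} × ⋯ × Δ_{X_{r-1}} × X_r` of the ambient space. -/
def freeDiagonal {Y X : LREL K} (p : Quiver.Path Y X) : Submodule K (ambient p).carrier where
  carrier := {t | ∃ x y, (x, t, y) ∈ chains p}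
  add_mem' := by
    rintro a b ⟨x, y, h⟩ ⟨x', y', h'⟩
    exact ⟨x + x', y + y', (chains p).add_mem h h'⟩
  zero_mem' := ⟨0, 0, (chains p).zero_mem⟩
  smul_mem' := by
    rintro c a ⟨x, y, h⟩
    exact ⟨c • x, c • y, (chains p).smul_mem c h⟩

/-- The subspace `0_{X₀} × Δ_{X₁} × ⋯ × Δ_{X_{r-1}} × 0_{X_r}` of the ambient space. -/
def zeroDiagonal {Y X : LREL K} (p : Quiver.Path Y X) : Submodule K (ambient p).carrier where
  carrier := {t | (0, t, 0) ∈ chains p}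
  add_mem' := by
    intro a b h h'
    simpa using (chains p).add_mem h h'
  zero_mem' := (chains p).zero_mem
  smul_mem' := by
    intro c a h
    simpa using (chains p).smul_mem c h

/-- The excess of a composable sequence: the dimension of
`(f₁ × ⋯ × f_r) ∩ (0 × Δ_{X₁} × ⋯ × Δ_{X_{r-1}} × 0)`. -/
noncomputable def excess {Y X : LREL K} (p : Quiver.Path Y X) : ℕ :=
  Module.finrank K (productRel p ⊓ zeroDiagonal p : Submodule K (ambient p).carrier)

/-- The defect of a composable sequence: the codimension of
`(f₁ × ⋯ × f_r) + (X₀ × Δ_{X₁} × ⋯ × Δ_{X_{r-1}} × X_r)`. -/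
noncomputable def defect {Y X : LREL K} (p : Quiver.Path Y X) : ℕ :=
  Module.finrank K ((ambient p).carrier ⧸ (productRel p ⊔ freeDiagonal p))

end LREL

/-! ### Symplectic vector spaces, isotropic and coisotropic relations -/

/-- A finite-dimensional symplectic vector space. -/
structure Symp (K : Type u) [Field K] : Type (u + 1) extends LREL K where
  form : LinearMap.BilinForm K carrier
  alt : form.IsAlt
  nondegenerate : form.Nondegenerate

section Symp

variable {K : Type u} [Field K]

/-- The form `ω_X - ω_Y` on `X × Ȳ`. -/
def diffForm (X Y : Symp K) : LinearMap.BilinForm K (X.carrier × Y.carrier) :=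
  X.form.compl₁₂ (LinearMap.fst K _ _) (LinearMap.fst K _ _) -
    Y.form.compl₁₂ (LinearMap.snd K _ _) (LinearMap.snd K _ _)

theorem diffForm_apply (X Y : Symp K) (p q : X.carrier × Y.carrier) :
    diffForm X Y p q = X.form p.1 q.1 - Y.form p.2 q.2 := rfl

/-- `f ⊆ X × Ȳ` is contained in its symplectic orthogonal. -/
def IsIsotropic (X Y : Symp K) (f : Submodule K (X.carrier × Y.carrier)) : Prop :=
  f ≤ (diffForm X Y).orthogonal f

/-- `f ⊆ X × Ȳ` contains its symplectic orthogonal. -/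
def IsCoisotropic (X Y : Symp K) (f : Submodule K (X.carrier × Y.carrier)) : Prop :=
  (diffForm X Y).orthogonal f ≤ f

theorem isIsotropic_iff {X Y : Symp K} {f : Submodule K (X.carrier × Y.carrier)} :
    IsIsotropic X Y f ↔ ∀ x y x' y', (x, y) ∈ f → (x', y') ∈ f → X.form x x' = Y.form y y' := by
  constructor
  · intro h x y x' y' h1 h2
    exact sub_eq_zero.1 (h h2 _ h1)
  · rintro h ⟨x', y'⟩ h2 ⟨x, y⟩ h1
    exact sub_eq_zero.2 (h x y x' y' h1 h2)

theorem isCoisotropic_iff {X Y : Symp K} {f : Submodule K (X.carrier × Y.carrier)} :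
    IsCoisotropic X Y f ↔
      ∀ x y, (∀ x' y', (x', y') ∈ f → X.form x' x = Y.form y' y) → (x, y) ∈ f := by
  constructor
  · intro h x y hxy
    refine h ?_
    rintro ⟨x', y'⟩ h1
    exact sub_eq_zero.2 (hxy x' y' h1)
  · rintro h ⟨x, y⟩ hxy
    exact h x y fun x' y' h1 => sub_eq_zero.1 (hxy _ h1)

/-- The zero space with its unique symplectic form. -/
def Symp.one (K : Type u) [Field K] : Symp K where
  toLREL := LREL.one K
  form := 0
  alt := fun _ => rfl
  nondegenerate := ⟨fun _ _ => rfl, fun _ _ => rfl⟩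

/-- The product of symplectic spaces, with the form `ω_X + ω_Y`. -/
def Symp.prod (X Y : Symp K) : Symp K where
  toLREL := X.toLREL.prod Y.toLREL
  form := (X.form.compl₁₂ (LinearMap.fst K X.carrier Y.carrier) (LinearMap.fst K _ _) +
    Y.form.compl₁₂ (LinearMap.snd K _ _) (LinearMap.snd K _ _) :
      LinearMap.BilinForm K (X.carrier × Y.carrier))
  alt := by
    rintro ⟨x, y⟩
    change X.form x x + Y.form y y = 0
    rw [X.alt x, Y.alt y, add_zero]
  nondegenerate := by
    refine ⟨?_, ?_⟩
    · rintro ⟨x, y⟩ h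
      refine Prod.ext (X.nondegenerate.1 x fun x' => ?_) (Y.nondegenerate.1 y fun y' => ?_)
      · have h' : X.form x x' + Y.form y 0 = 0 := h (x', 0)
        simpa using h'
      · have h' : X.form x 0 + Y.form y y' = 0 := h (0, y')
        simpa using h'
    · rintro ⟨x, y⟩ h
      refine Prod.ext (X.nondegenerate.2 x fun x' => ?_) (Y.nondegenerate.2 y fun y' => ?_)
      · have h' : X.form x' x + Y.form 0 y = 0 := h (x', 0)
        simpa using h'
      · have h' : X.form 0 x + Y.form y' y = 0 := h (0, y')
        simpa using h'

theorem Symp.prod_form (X Y : Symp K) (x x' : X.carrier) (y y' : Y.carrier) :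
    (X.prod Y).form (x, y) (x', y') = X.form x x' + Y.form y y' := rfl

theorem isIsotropic_id (X : Symp K) : IsIsotropic X X (idRel K X.carrier) := by
  rw [isIsotropic_iff]
  intro x y x' y' h h'
  have h : x = y := h
  have h' : x' = y' := h'
  rw [h, h']

theorem isIsotropic_comp {X Y Z : Symp K} {f : Submodule K (X.carrier × Y.carrier)}
    {g : Submodule K (Y.carrier × Z.carrier)} (hf : IsIsotropic X Y f) (hg : IsIsotropic Y Z g) :
    IsIsotropic X Z (compRel f g) := by
  rw [isIsotropic_iff] at *
  rintro x z x' z' ⟨y, h1, h2⟩ ⟨y', h1', h2'⟩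
  exact (hf _ _ _ _ h1 h1').trans (hg _ _ _ _ h2 h2')

theorem isIsotropic_tensor {X Y : Symp K} {f : Submodule K (X.carrier × Y.carrier)}
    (hf : IsIsotropic X Y f) (W : Symp K) :
    IsIsotropic (X.prod W) (Y.prod W) (tensorRel f W.carrier) := by
  rw [isIsotropic_iff] at hf
  refine isIsotropic_iff.2 ?_
  rintro ⟨x, w⟩ ⟨y, v⟩ ⟨x', w'⟩ ⟨y', v'⟩ ⟨h, e⟩ ⟨h', e'⟩
  have e : w = v := e
  have e' : w' = v' := e'
  rw [Symp.prod_form, Symp.prod_form, hf _ _ _ _ h h', e, e']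

theorem isIsotropic_unitor (X : Symp K) :
    IsIsotropic X ((Symp.one K).prod X) (unitorRel K X.carrier) := by
  refine isIsotropic_iff.2 ?_
  rintro x ⟨a, y⟩ x' ⟨a', y'⟩ h h'
  have h : x = y := h
  have h' : x' = y' := h'
  rw [Symp.prod_form, h, h']
  exact (zero_add _).symm

theorem isIsotropic_transpose {X Y : Symp K} {f : Submodule K (X.carrier × Y.carrier)}
    (hf : IsIsotropic X Y f) : IsIsotropic Y X (transposeRel f) := by
  rw [isIsotropic_iff] at *
  intro x y x' y' h h'
  exact (hf _ _ _ _ h h').symm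

theorem isCoisotropic_id (X : Symp K) : IsCoisotropic X X (idRel K X.carrier) := by
  rw [isCoisotropic_iff]
  intro x y h
  change x = y
  rw [← sub_eq_zero]
  refine X.nondegenerate.2 _ fun z => ?_
  rw [map_sub, sub_eq_zero]
  exact h z z rfl

theorem isCoisotropic_comp {X Y Z : Symp K} {f : Submodule K (X.carrier × Y.carrier)}
    {g : Submodule K (Y.carrier × Z.carrier)} (hf : IsCoisotropic X Y f)
    (hg : IsCoisotropic Y Z g) : IsCoisotropic X Z (compRel f g) := by
  rw [isCoisotropic_iff] at *
  intro x z h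
  let L : (f × g) →ₗ[K] Y.carrier :=
    (LinearMap.snd K _ _ ∘ₗ f.subtype) ∘ₗ LinearMap.fst K f g -
      (LinearMap.fst K _ _ ∘ₗ g.subtype) ∘ₗ LinearMap.snd K f g
  let l : Module.Dual K (f × g) :=
    ((X.form.flip x ∘ₗ LinearMap.fst K _ _) ∘ₗ f.subtype) ∘ₗ LinearMap.fst K f g -
      ((Z.form.flip z ∘ₗ LinearMap.snd K _ _) ∘ₗ g.subtype) ∘ₗ LinearMap.snd K f g
  have hl : l ∈ LinearMap.range L.dualMap := by
    rw [LinearMap.range_dualMap_eq_dualAnnihilator_ker, Submodule.mem_dualAnnihilator]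
    rintro ⟨⟨⟨a, b⟩, hab⟩, ⟨⟨c, d⟩, hcd⟩⟩ hk
    have hk : b - c = 0 := hk
    rw [sub_eq_zero] at hk
    subst hk
    exact sub_eq_zero.2 (h a d ⟨b, hab, hcd⟩)
  obtain ⟨φ, hφ⟩ := hl
  have hsurj : Function.Surjective Y.form.flip := by
    rw [← LinearMap.injective_iff_surjective_of_finrank_eq_finrank
      Subspace.dual_finrank_eq.symm]
    rw [injective_iff_map_eq_zero]
    intro y hy
    exact Y.nondegenerate.2 y fun y' => LinearMap.congr_fun hy y'
  obtain ⟨y, rfl⟩ := hsurj φ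
  refine ⟨y, hf x y fun x' y' h' => ?_, hg y z fun y' z' h' => ?_⟩
  · have h1 := LinearMap.congr_fun hφ (⟨(x', y'), h'⟩, 0)
    have h2 : Y.form (y' - 0) y = X.form x' x - Z.form 0 z := h1
    simpa using h2.symm
  · have h1 := LinearMap.congr_fun hφ (0, ⟨(y', z'), h'⟩)
    have h2 : Y.form (0 - y') y = X.form 0 x - Z.form z' z := h1
    simpa using h2

theorem isCoisotropic_tensor {X Y : Symp K} {f : Submodule K (X.carrier × Y.carrier)}
    (hf : IsCoisotropic X Y f) (W : Symp K) :
    IsCoisotropic (X.prod W) (Y.prod W) (tensorRel f W.carrier) := by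
  rw [isCoisotropic_iff] at hf
  refine isCoisotropic_iff.2 ?_
  rintro ⟨x, w⟩ ⟨y, v⟩ h
  refine ⟨hf x y fun x' y' h' => ?_, ?_⟩
  · have := h (x', 0) (y', 0) ⟨h', rfl⟩
    rw [Symp.prod_form, Symp.prod_form] at this
    simpa using this
  · change w = v
    rw [← sub_eq_zero]
    refine W.nondegenerate.2 _ fun z => ?_
    have := h (0, z) (0, z) ⟨f.zero_mem, rfl⟩
    rw [Symp.prod_form, Symp.prod_form] at this
    rw [map_sub, sub_eq_zero]
    simpa using this

theorem isCoisotropic_unitor (X : Symp K) :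
    IsCoisotropic X ((Symp.one K).prod X) (unitorRel K X.carrier) := by
  refine isCoisotropic_iff.2 ?_
  rintro x ⟨a, y⟩ h
  change x = y
  rw [← sub_eq_zero]
  refine X.nondegenerate.2 _ fun z => ?_
  rw [map_sub, sub_eq_zero, h z (PUnit.unit, z) rfl]
  exact zero_add (X.form z y)

theorem isCoisotropic_transpose {X Y : Symp K} {f : Submodule K (X.carrier × Y.carrier)}
    (hf : IsCoisotropic X Y f) : IsCoisotropic Y X (transposeRel f) := by
  rw [isCoisotropic_iff] at *
  intro y x h
  exact hf x y fun x' y' h' => (h y' x' h').symm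

/-- An isotropic relation to `X` from `Y`. -/
@[ext]
structure IsoRel (X Y : Symp K) : Type u where
  rel : Submodule K (X.carrier × Y.carrier)
  isotropic : IsIsotropic X Y rel

/-- A coisotropic relation to `X` from `Y`. -/
@[ext]
structure CoisoRel (X Y : Symp K) : Type u where
  rel : Submodule K (X.carrier × Y.carrier)
  coisotropic : IsCoisotropic X Y rel

end Symp

/-- Objects of `ILREL`: symplectic vector spaces. -/
structure ILREL (K : Type u) [Field K] : Type (u + 1) where
  space : Symp K

/-- Objects of `CLREL`: symplectic vector spaces. -/
structure CLREL (K : Type u) [Field K] : Type (u + 1) where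
  space : Symp K

section Categories

variable {K : Type u} [Field K]

/-- Arrows `Y ⟶ X` are the isotropic subspaces of `X × Ȳ`. -/
instance : Category.{u} (ILREL K) where
  Hom Y X := IsoRel X.space Y.space
  id X := ⟨idRel K X.space.carrier, isIsotropic_id X.space⟩
  comp g f := ⟨compRel f.rel g.rel, isIsotropic_comp f.isotropic g.isotropic⟩
  id_comp f := IsoRel.ext (compRel_id f.rel)
  comp_id f := IsoRel.ext (id_compRel f.rel)
  assoc h g f := IsoRel.ext (compRel_assoc f.rel g.rel h.rel).symm

/-- Arrows `Y ⟶ X` are the coisotropic subspaces of `X × Ȳ`. -/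
instance : Category.{u} (CLREL K) where
  Hom Y X := CoisoRel X.space Y.space
  id X := ⟨idRel K X.space.carrier, isCoisotropic_id X.space⟩
  comp g f := ⟨compRel f.rel g.rel, isCoisotropic_comp f.coisotropic g.coisotropic⟩
  id_comp f := CoisoRel.ext (compRel_id f.rel)
  comp_id f := CoisoRel.ext (id_compRel f.rel)
  assoc h g f := CoisoRel.ext (compRel_assoc f.rel g.rel h.rel).symm

end Categories

/-! ### The Wehrheim–Woodward category -/

/-- The data common to `LREL`, `ILREL` and `CLREL` out of which the Wehrheim–Woodward category and
the tensor action of the endomorphisms of its unit object are built. There are exactly three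
instances, given below. -/
class RelCategory (K : outParam (Type u)) [Field K] (C : Type (u + 1)) [Category.{u} C] where
  /-- The functor that forgets the symplectic structures. -/
  toLREL : C ⥤ LREL K
  /-- The unit object. -/
  one : C
  /-- The functor `Q ↦ Q × X`, `f ↦ f × Δ_X`. -/
  tensorRight (X : C) : C ⥤ C
  tensorRight_stronglyTransversal (W : C) {X Y Z : C} (g : Z ⟶ Y) (f : Y ⟶ X) :
    StronglyTransversal (LREL.rel (toLREL.map f)) (LREL.rel (toLREL.map g)) →
    StronglyTransversal (LREL.rel (toLREL.map ((tensorRight W).map f)))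
      (LREL.rel (toLREL.map ((tensorRight W).map g)))
  /-- The isomorphism between `1 × X` and `X`. -/
  leftUnitor (X : C) : (tensorRight X).obj one ≅ X

section Instances

variable {K : Type u} [Field K]

instance : RelCategory K (LREL K) where
  toLREL := 𝟭 _
  one := LREL.one K
  tensorRight X :=
    { obj := fun Q => Q.prod X
      map := fun f => (⟨tensorRel (LREL.rel f) X.carrier⟩ : LinRel _ _)
      map_id := fun _ => LinRel.ext tensorRel_id
      map_comp := fun g f => LinRel.ext (tensorRel_comp (LREL.rel f) (LREL.rel g)) }
  tensorRight_stronglyTransversal _ _ _ _ _ _ h := h.tensorRel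
  leftUnitor X :=
    { hom := (⟨unitorRel K X.carrier⟩ : LinRel X ((LREL.one K).prod X))
      inv := (⟨transposeRel (unitorRel K X.carrier)⟩ : LinRel ((LREL.one K).prod X) X)
      hom_inv_id := LinRel.ext transpose_comp_unitor
      inv_hom_id := LinRel.ext unitor_comp_transpose }

instance : RelCategory K (ILREL K) where
  toLREL :=
    { obj := fun X => X.space.toLREL
      map := fun f => (⟨IsoRel.rel f⟩ : LinRel _ _)
      map_id := fun _ => rfl
      map_comp := fun _ _ => rfl }
  one := ⟨Symp.one K⟩
  tensorRight X :=
    { obj := fun Q => ⟨Q.space.prod X.space⟩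
      map := fun f => (⟨tensorRel (IsoRel.rel f) X.space.carrier,
        isIsotropic_tensor (IsoRel.isotropic f) X.space⟩ : IsoRel _ _)
      map_id := fun _ => IsoRel.ext tensorRel_id
      map_comp := fun g f => IsoRel.ext (tensorRel_comp (IsoRel.rel f) (IsoRel.rel g)) }
  tensorRight_stronglyTransversal _ _ _ _ _ _ h := h.tensorRel
  leftUnitor X :=
    { hom := (⟨unitorRel K X.space.carrier, isIsotropic_unitor X.space⟩ :
        IsoRel X.space ((Symp.one K).prod X.space))
      inv := (⟨transposeRel (unitorRel K X.space.carrier),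
        isIsotropic_transpose (isIsotropic_unitor X.space)⟩ :
        IsoRel ((Symp.one K).prod X.space) X.space)
      hom_inv_id := IsoRel.ext transpose_comp_unitor
      inv_hom_id := IsoRel.ext unitor_comp_transpose }

instance : RelCategory K (CLREL K) where
  toLREL :=
    { obj := fun X => X.space.toLREL
      map := fun f => (⟨CoisoRel.rel f⟩ : LinRel _ _)
      map_id := fun _ => rfl
      map_comp := fun _ _ => rfl }
  one := ⟨Symp.one K⟩
  tensorRight X :=
    { obj := fun Q => ⟨Q.space.prod X.space⟩
      map := fun f => (⟨tensorRel (CoisoRel.rel f) X.space.carrier,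
        isCoisotropic_tensor (CoisoRel.coisotropic f) X.space⟩ : CoisoRel _ _)
      map_id := fun _ => CoisoRel.ext tensorRel_id
      map_comp := fun g f => CoisoRel.ext (tensorRel_comp (CoisoRel.rel f) (CoisoRel.rel g)) }
  tensorRight_stronglyTransversal _ _ _ _ _ _ h := h.tensorRel
  leftUnitor X :=
    { hom := (⟨unitorRel K X.space.carrier, isCoisotropic_unitor X.space⟩ :
        CoisoRel X.space ((Symp.one K).prod X.space))
      inv := (⟨transposeRel (unitorRel K X.space.carrier),
        isCoisotropic_transpose (isCoisotropic_unitor X.space)⟩ :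
        CoisoRel ((Symp.one K).prod X.space) X.space)
      hom_inv_id := CoisoRel.ext transpose_comp_unitor
      inv_hom_id := CoisoRel.ext unitor_comp_transpose }

end Instances

section WW

variable {K : Type u} [Field K] (C : Type (u + 1)) [Category.{u} C] [RelCategory K C]

/-- The elementary moves on composable sequences of arrows of `C`: an identity arrow may be
removed or inserted, and a congenial (i.e. strongly transversal) pair of adjacent entries may be
replaced by its composition, and vice versa. All arrows of `C` are suave. -/
inductive Move : ∀ {Y X : C}, Quiver.Path Y X → Quiver.Path Y X → Prop
  | id (X : C) : Move (Quiver.Path.nil : Quiver.Path X X) (𝟙 X : X ⟶ X).toPath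
  | comp {X Y Z : C} (g : Z ⟶ Y) (f : Y ⟶ X) :
      StronglyTransversal (LREL.rel ((RelCategory.toLREL (C := C)).map f))
        (LREL.rel ((RelCategory.toLREL (C := C)).map g)) →
      Move (g.toPath.comp f.toPath) (g ≫ f).toPath

/-- The elementary moves as a relation on the arrows of the path category. -/
def moveRel : HomRel (Paths C) := fun Y X p q => Move C (Y := Y) (X := X) p q

/-- The Wehrheim–Woodward category: composable sequences in `C` modulo the equivalence relation
generated by the elementary moves inside a sequence. -/
abbrev WW : Type (u + 1) := CategoryTheory.Quotient (moveRel C)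

variable {C}

/-- The object of `WW C` given by an object of `C`. -/
def WW.ob (X : C) : WW C := ⟨X⟩

/-- The class `[f₁, …, f_r]` of a composable sequence. -/
def WW.mk {Y X : C} (p : Quiver.Path Y X) : WW.ob Y ⟶ WW.ob X :=
  (CategoryTheory.Quotient.functor (moveRel C)).map (X := (Y : Paths C)) (Y := (X : Paths C)) p

/-- The class `ι f = [f]` of a sequence with one entry. -/
def WW.single {Y X : C} (f : Y ⟶ X) : WW.ob Y ⟶ WW.ob X := WW.mk f.toPath

variable (C) in
/-- The shadow functor, `[f₁, …, f_r] ↦ f₁ ⋯ f_r`. -/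
def WW.shadow : WW C ⥤ C :=
  CategoryTheory.Quotient.lift (moveRel C) (pathComposition C) (by
    intro Y X p q h
    have key : ∀ {Y X : C} (p q : Quiver.Path Y X), Move C p q → composePath p = composePath q := by
      intro Y X p q h
      cases h with
      | id X => simp
      | comp g f h => simp
    exact key _ _ h)

theorem WW.mk_eq_of_move {Y X : C} {p q : Quiver.Path Y X} (h : Move C p q) :
    WW.mk p = WW.mk q :=
  CategoryTheory.Quotient.sound (moveRel C) h

theorem WW.single_id (X : C) : WW.single (𝟙 X) = 𝟙 (WW.ob X) :=
  (WW.mk_eq_of_move (Move.id X)).symm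

theorem WW.single_comp {X Y Z : C} (g : Z ⟶ Y) (f : Y ⟶ X)
    (h : StronglyTransversal (LREL.rel ((RelCategory.toLREL (C := C)).map f))
      (LREL.rel ((RelCategory.toLREL (C := C)).map g))) :
    WW.single g ≫ WW.single f = WW.single (g ≫ f) :=
  WW.mk_eq_of_move (Move.comp g f h)

/-- The functor `[f₁, …, f_r] ↦ [f₁ × Δ_X, …, f_r × Δ_X]` of tensor product with the identity
of `X`. -/
def WW.tensorRight (W : C) : WW C ⥤ WW C :=
  CategoryTheory.Quotient.lift (moveRel C)
    (Paths.lift (C := WW C)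
      { obj := fun Q : C => WW.ob ((RelCategory.tensorRight W).obj Q)
        map := fun f => WW.single ((RelCategory.tensorRight W).map f) }) (by
    intro Y X p q h
    have key : ∀ {Y X : C} (p q : Quiver.Path Y X), Move C p q →
        (Paths.lift (C := WW C)
          { obj := fun Q : C => WW.ob ((RelCategory.tensorRight W).obj Q)
            map := fun f => WW.single ((RelCategory.tensorRight W).map f) }).map
            (X := (Y : Paths C)) (Y := (X : Paths C)) p =
        (Paths.lift (C := WW C)
          { obj := fun Q : C => WW.ob ((RelCategory.tensorRight W).obj Q)
            map := fun f => WW.single ((RelCategory.tensorRight W).map f) }).map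
            (X := (Y : Paths C)) (Y := (X : Paths C)) q := by
      intro Y X p q h
      cases h with
      | id X =>
        refine Eq.trans ?_ (Category.id_comp _).symm
        refine Eq.trans ?_ (congrArg WW.single ((RelCategory.tensorRight W).map_id Y)).symm
        exact (WW.single_id _).symm
      | comp g f h =>
        refine Eq.trans ?_ (Category.id_comp _).symm
        refine Eq.trans ?_ (congrArg WW.single ((RelCategory.tensorRight W).map_comp g f)).symm
        refine Eq.trans ?_ (WW.single_comp _ _
          (RelCategory.tensorRight_stronglyTransversal W g f h))
        exact congrArg (· ≫ _) (Category.id_comp _)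
    exact key _ _ h)

/-- The unit object of `WW C`. -/
def WW.one (C : Type (u + 1)) [Category.{u} C] [RelCategory K C] : WW C :=
  WW.ob (RelCategory.one (C := C))

/-- The tensor product `a ⊗ w` of an endomorphism `a` of the unit object with an arrow
`w : Y ⟶ X`, regarded as an arrow `Y ⟶ X` through `1 × X ≅ X`: the composition of `w` with
`a ⊗ id_X`. -/
def WW.tensorUnitEnd (a : End (WW.one C)) {Y X : C} (w : WW.ob Y ⟶ WW.ob X) :
    WW.ob Y ⟶ WW.ob X :=
  w ≫ WW.single (RelCategory.leftUnitor X).inv ≫ (WW.tensorRight X).map a ≫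
    WW.single (RelCategory.leftUnitor X).hom

/-- The excess of a composable sequence in `C`. -/
noncomputable def seqExcess {Y X : C} (p : Quiver.Path Y X) : ℕ :=
  excess ((RelCategory.toLREL (C := C)).toPrefunctor.mapPath p)

/-- The defect of a composable sequence in `C`. -/
noncomputable def seqDefect {Y X : C} (p : Quiver.Path Y X) : ℕ :=
  defect ((RelCategory.toLREL (C := C)).toPrefunctor.mapPath p)

end WW

/-! ### Central extensions of categories -/

section CentralExtension

/-- A normalized 2-cocycle on a category with values in a commutative monoid. The value on the
composable pair `Z ⟶ Y ⟶ X` of arrows `g`, `f` (with composition `f g`) is `c.val f g`. -/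
structure Cocycle (C : Type (u + 1)) [Category.{u} C] (A : Type) [AddCommMonoid A] where
  val : ∀ {X Y Z : C}, (Y ⟶ X) → (Z ⟶ Y) → A
  assoc : ∀ {X Y Z W : C} (f : Y ⟶ X) (g : Z ⟶ Y) (h : W ⟶ Z),
    val f g + val (g ≫ f) h = val g h + val f (h ≫ g)
  id_left : ∀ {X Y : C} (f : Y ⟶ X), val (𝟙 X) f = 0
  id_right : ∀ {X Y : C} (f : Y ⟶ X), val f (𝟙 Y) = 0

variable {C : Type (u + 1)} [Category.{u} C] {A : Type} [AddCommMonoid A]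

/-- The objects of the central extension of `C` determined by the cocycle `c`: those of `C`. -/
structure CentralExtension (_c : Cocycle C A) : Type (u + 1) where
  base : C

/-- An arrow of a central extension: an arrow of `C` with an element of `A`. -/
@[ext]
structure CentralExtension.Arrow (Y X : C) (A : Type) : Type u where
  shadow : Y ⟶ X
  index : A

/-- The composition is `(f, a) (g, b) = (f g, a + b + c(f, g))`. -/
instance (c : Cocycle C A) : Category.{u} (CentralExtension c) where
  Hom Y X := CentralExtension.Arrow Y.base X.base A
  id X := ⟨𝟙 X.base, 0⟩
  comp g f := ⟨g.shadow ≫ f.shadow, f.index + g.index + c.val f.shadow g.shadow⟩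
  id_comp f := by
    apply CentralExtension.Arrow.ext
    · exact Category.id_comp f.shadow
    · change f.index + 0 + c.val f.shadow (𝟙 _) = f.index
      rw [c.id_right, add_zero, add_zero]
  comp_id f := by
    apply CentralExtension.Arrow.ext
    · exact Category.comp_id f.shadow
    · change 0 + f.index + c.val (𝟙 _) f.shadow = f.index
      rw [c.id_left, add_zero, zero_add]
  assoc h g f := by
    apply CentralExtension.Arrow.ext
    · exact Category.assoc h.shadow g.shadow f.shadow
    · change f.index + (g.index + h.index + c.val g.shadow h.shadow) +
          c.val f.shadow (h.shadow ≫ g.shadow) =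
        f.index + g.index + c.val f.shadow g.shadow + h.index +
          c.val (g.shadow ≫ f.shadow) h.shadow
      have e := c.assoc f.shadow g.shadow h.shadow
      calc _ = f.index + g.index + h.index +
            (c.val g.shadow h.shadow + c.val f.shadow (h.shadow ≫ g.shadow)) := by abel
        _ = _ := by rw [← e]; abel

/-- The projection of a central extension onto the extended category. -/
def CentralExtension.proj (c : Cocycle C A) : CentralExtension c ⥤ C where
  obj X := X.base
  map f := CentralExtension.Arrow.shadow f

end CentralExtension

/-! ### The conclusion for one of the three categories -/

/-- The pairs `(d, e)` with `e ≤ d`. -/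
def excessLeDefect : AddSubmonoid (ℕ × ℕ) where
  carrier := {p | p.2 ≤ p.1}
  add_mem' := fun ha hb => Nat.add_le_add ha hb
  zero_mem' := le_refl 0

/-- The pairs `(d, e)` with `d ≤ e`. -/
def defectLeExcess : AddSubmonoid (ℕ × ℕ) where
  carrier := {p | p.1 ≤ p.2}
  add_mem' := fun ha hb => Nat.add_le_add ha hb
  zero_mem' := le_refl 0

/-- Arrows of `WW C` are doubly indexed arrows of `C`, with indices (defect, excess) in `A`. -/
def IsDoublyIndexed {K : Type u} [Field K] (C : Type (u + 1)) [Category.{u} C] [RelCategory K C]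
    (A : AddSubmonoid (ℕ × ℕ)) : Prop :=
  -- the defect and the excess of a composable sequence depend only on its class
  ∃ D E : ∀ ⦃Y X : C⦄, (WW.ob Y ⟶ WW.ob X) → ℕ,
    (∀ {Y X : C} (p : Quiver.Path Y X), D (WW.mk p) = seqDefect p ∧ E (WW.mk p) = seqExcess p) ∧
    -- an arrow is determined by its shadow, its defect and its excess
    (∀ {Y X : C} (w w' : WW.ob Y ⟶ WW.ob X), (WW.shadow C).map w = (WW.shadow C).map w' →
      D w = D w' → E w = E w' → w = w') ∧
    -- which are independent, except that (defect, excess) lies in `A`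
    (∀ {Y X : C} (f : Y ⟶ X) (d e : ℕ),
      (∃ w : WW.ob Y ⟶ WW.ob X, (WW.shadow C).map w = f ∧ D w = d ∧ E w = e) ↔ (d, e) ∈ A) ∧
    -- (defect, excess) identifies the monoid of endomorphisms of the unit object with `A`
    ∃ φ : End (WW.one C) ≃* Multiplicative A,
      (∀ a, ((φ a).toAdd : ℕ × ℕ) = (D a, E a)) ∧
      -- (defect, excess) of composable pairs is a cocycle
      ∃ c : Cocycle C A,
        (∀ {X Y Z : C} (f : Y ⟶ X) (g : Z ⟶ Y), (c.val f g : ℕ × ℕ) =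
          (seqDefect (g.toPath.comp f.toPath), seqExcess (g.toPath.comp f.toPath))) ∧
        -- `WW C` is isomorphic, over `C`, to the central extension which it determines
        ∃ F : WW C ⥤ CentralExtension c,
          Function.Bijective F.obj ∧ F.Full ∧ F.Faithful ∧
          F ⋙ CentralExtension.proj c = WW.shadow C ∧
          (∀ {Y X : C} (w : WW.ob Y ⟶ WW.ob X),
            ((F.map w).index : ℕ × ℕ) = (D w, E w)) ∧
          -- the endomorphisms of the unit object act, through the tensor product, by translation
          ∀ (a : End (WW.one C)) {Y X : C} (w : WW.ob Y ⟶ WW.ob X),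
            (F.map (WW.tensorUnitEnd a w)).shadow = (F.map w).shadow ∧
            (F.map (WW.tensorUnitEnd a w)).index = (φ a).toAdd + (F.map w).index

end WWRel

/-! The index of a composable pair consists of the codimension of `domRel f ⊔ codRel g` and the
dimension of `kerRel f ⊓ indetRel g`. It is a cocycle (`pairIndex_cocycle`) and vanishes exactly on
strongly transversal pairs (`stronglyTransversal_iff_pairIndex`). Hence f ↦ (f, 0) respects the
elementary moves and extends to a functor from `WW C` to a central extension of `C`. By the
recursions `defect_cons` and `excess_cons` its second component is the defect and excess of a
sequence, so these are invariants of the class.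

That there are no further invariants is shown with shifts: natural endomorphisms of the objects of
`WW C` with trivial shadow and constant index. A subspace S of a plane K² gives one: enter X × K² by
adjoining the first axis, leave it by removing S. Only the plane contributes to the index, which is
the codimension of S + axis and the dimension of S ∩ axis; S = 0, the axis and K² give (1,0), (1,1)
and (0,1). Here 0 and the axis are isotropic, the axis and K² coisotropic. So ILREL has the first
two shifts, CLREL the last two, and LREL uses the first and the third; in each case the two indices
freely generate A.

It remains to write each arrow as [f] followed by powers of the two shifts (`WW.hasNormalForm`),
because shadow and index then recover f and both exponents. As shifts are natural, it suffices to
split a shift off each pair f, g of nonzero index. A vector w in ker f ∩ indet g, or a functional l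
that vanishes on dom f + cod g, or both, define a relation N on the middle space Y. On the one hand
N factors through Y × K² by a shear of the projection which f does not notice, so [f][N] is [f]
times the shift. On the other hand g = N g' is a strongly transversal composition, where g' arises
from g by cutting down along w, by adding a vector on which l does not vanish, or by both. So [f][g]
is the shift times [f][g'] (`Stabilization.reduce_left`). In the symplectic categories l = ω(w, ·),
and g' has to stay isotropic or coisotropic; sometimes f must be modified instead of g
(`Stabilization.reduce_right`). -/

namespace WWRel

/-! ### Indices of composable pairs of linear relations -/

section PairIndex

variable {K : Type u} [Field K]

/-- Dimensions of a subspace along a three-term exact sequence. -/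
theorem finrank_map_add_finrank_comap {V M N : Type*} [AddCommGroup V] [Module K V]
    [AddCommGroup M] [Module K M] [AddCommGroup N] [Module K N] [FiniteDimensional K M]
    (ι : V →ₗ[K] M) (π : M →ₗ[K] N) (hι : Function.Injective ι)
    (hex : LinearMap.range ι = LinearMap.ker π) (S : Submodule K M) :
    Module.finrank K (S.map π) + Module.finrank K (S.comap ι) = Module.finrank K S := by
  have h := LinearMap.finrank_range_add_finrank_ker (π.domRestrict S)
  rw [LinearMap.range_domRestrict] at h
  rw [← h]
  congr 1
  have e1 : Module.finrank K (S.comap ι) = Module.finrank K ((S.comap ι).map ι) :=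
    (Submodule.equivMapOfInjective ι hι _).finrank_eq
  rw [e1, Submodule.map_comap_eq, hex, LinearMap.ker_domRestrict,
    (Submodule.equivMapOfInjective S.subtype S.injective_subtype _).finrank_eq,
    Submodule.map_comap_subtype, inf_comm]

/-- Codimensions of a subspace along a short exact sequence. -/
theorem finrank_quotient_map_add_finrank_quotient_comap {V M N : Type*} [AddCommGroup V]
    [Module K V] [AddCommGroup M] [Module K M] [AddCommGroup N] [Module K N]
    [FiniteDimensional K V] [FiniteDimensional K M] [FiniteDimensional K N]
    (ι : V →ₗ[K] M) (π : M →ₗ[K] N) (hι : Function.Injective ι) (hπ : Function.Surjective π)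
    (hex : LinearMap.range ι = LinearMap.ker π) (S : Submodule K M) :
    Module.finrank K (N ⧸ S.map π) + Module.finrank K (V ⧸ S.comap ι) =
      Module.finrank K (M ⧸ S) := by
  have h1 := finrank_map_add_finrank_comap ι π hι hex S
  have h2 := finrank_map_add_finrank_comap ι π hι hex ⊤
  rw [Submodule.map_top, LinearMap.range_eq_top.2 hπ, Submodule.comap_top, finrank_top,
    finrank_top, finrank_top] at h2
  have h3 := Submodule.finrank_quotient_add_finrank S
  have h4 := Submodule.finrank_quotient_add_finrank (S.map π)
  have h5 := Submodule.finrank_quotient_add_finrank (S.comap ι)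
  omega

variable {X Y Z W : Type u} [AddCommGroup X] [Module K X] [AddCommGroup Y] [Module K Y]
  [AddCommGroup Z] [Module K Z] [AddCommGroup W] [Module K W]

/-- The projection of `f ⊆ X × Y` to `Y`. -/
def domRel (f : Submodule K (X × Y)) : Submodule K Y := f.map (LinearMap.snd K X Y)

/-- The projection of `g ⊆ Y × Z` to `Y`. -/
def codRel (g : Submodule K (Y × Z)) : Submodule K Y := g.map (LinearMap.fst K Y Z)

/-- The elements `y` with `(0, y) ∈ f`. -/
def kerRel (f : Submodule K (X × Y)) : Submodule K Y := f.comap (LinearMap.inr K X Y)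

/-- The elements `y` with `(y, 0) ∈ g`. -/
def indetRel (g : Submodule K (Y × Z)) : Submodule K Y := g.comap (LinearMap.inl K Y Z)

theorem mem_domRel {f : Submodule K (X × Y)} {y : Y} : y ∈ domRel f ↔ ∃ x, (x, y) ∈ f := by
  constructor
  · rintro ⟨⟨x, y'⟩, h, rfl⟩
    exact ⟨x, h⟩
  · rintro ⟨x, h⟩
    exact ⟨(x, y), h, rfl⟩

theorem mem_codRel {g : Submodule K (Y × Z)} {y : Y} : y ∈ codRel g ↔ ∃ z, (y, z) ∈ g := by
  constructor
  · rintro ⟨⟨y', z⟩, h, rfl⟩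
    exact ⟨z, h⟩
  · rintro ⟨z, h⟩
    exact ⟨(y, z), h, rfl⟩

theorem mem_kerRel {f : Submodule K (X × Y)} {y : Y} : y ∈ kerRel f ↔ (0, y) ∈ f := Iff.rfl

theorem mem_indetRel {g : Submodule K (Y × Z)} {y : Y} : y ∈ indetRel g ↔ (y, 0) ∈ g := Iff.rfl

/-- The pair of the defect and the excess of a composable pair of relations. -/
noncomputable def pairIndex (f : Submodule K (X × Y)) (g : Submodule K (Y × Z)) : ℕ × ℕ :=
  (Module.finrank K (Y ⧸ (domRel f ⊔ codRel g)),
    Module.finrank K (kerRel f ⊓ indetRel g : Submodule K Y))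

/-- If (a, c) + (b₁, b₂) has first component 0, then b₁ = -a lies in dom f, so b₂ lies in the domain
of f g. The subspace dom f × cod h + g of Y × Z is chosen so that its two slices and two projections
produce the four defects of the cocycle identity. -/
theorem domRel_compRel (f : Submodule K (X × Y)) (g : Submodule K (Y × Z))
    (h : Submodule K (Z × W)) :
    ((domRel f).prod (codRel h) ⊔ g).comap (LinearMap.inr K Y Z) =
      domRel (compRel f g) ⊔ codRel h := by
  ext z
  simp only [Submodule.mem_comap, Submodule.mem_sup, LinearMap.inr_apply]
  constructor
  · rintro ⟨⟨a, c⟩, ⟨ha, hc⟩, ⟨b1, b2⟩, hb, e⟩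
    simp only [Prod.mk_add_mk, Prod.mk.injEq] at e
    obtain ⟨e1, e2⟩ := e
    obtain ⟨x, hx⟩ := mem_domRel.1 ha
    refine ⟨b2, mem_domRel.2 ⟨-x, b1, ?_, hb⟩, c, hc, by rw [← e2, add_comm]⟩
    rw [eq_neg_of_add_eq_zero_right e1]
    exact f.neg_mem hx
  · rintro ⟨b, hb, c, hc, e⟩
    obtain ⟨x, y, hx, hy⟩ := mem_domRel.1 hb
    exact ⟨(-y, c), ⟨(domRel f).neg_mem (mem_domRel.2 ⟨x, hx⟩), hc⟩, (y, b), hy, by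
      simp [← e, add_comm]⟩

theorem codRel_compRel (f : Submodule K (X × Y)) (g : Submodule K (Y × Z))
    (h : Submodule K (Z × W)) :
    ((domRel f).prod (codRel h) ⊔ g).comap (LinearMap.inl K Y Z) =
      domRel f ⊔ codRel (compRel g h) := by
  ext y
  simp only [Submodule.mem_comap, Submodule.mem_sup, LinearMap.inl_apply]
  constructor
  · rintro ⟨⟨a, c⟩, ⟨ha, hc⟩, ⟨b1, b2⟩, hb, e⟩
    simp only [Prod.mk_add_mk, Prod.mk.injEq] at e
    obtain ⟨e1, e2⟩ := e
    obtain ⟨x, hx⟩ := mem_codRel.1 hc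
    refine ⟨a, ha, b1, mem_codRel.2 ⟨-x, b2, hb, ?_⟩, e1⟩
    rw [eq_neg_of_add_eq_zero_right e2]
    exact h.neg_mem hx
  · rintro ⟨a, ha, b, hb, e⟩
    obtain ⟨x, z, hx, hz⟩ := mem_codRel.1 hb
    exact ⟨(a, -z), ⟨ha, (codRel h).neg_mem (mem_codRel.2 ⟨x, hz⟩)⟩, (b, z), hx, by
      simp [← e]⟩

theorem map_fst_domRel_prod_codRel (f : Submodule K (X × Y)) (g : Submodule K (Y × Z))
    (h : Submodule K (Z × W)) :
    ((domRel f).prod (codRel h) ⊔ g).map (LinearMap.fst K Y Z) = domRel f ⊔ codRel g := by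
  rw [Submodule.map_sup, Submodule.prod_map_fst]
  rfl

theorem map_snd_domRel_prod_codRel (f : Submodule K (X × Y)) (g : Submodule K (Y × Z))
    (h : Submodule K (Z × W)) :
    ((domRel f).prod (codRel h) ⊔ g).map (LinearMap.snd K Y Z) = domRel g ⊔ codRel h := by
  rw [Submodule.map_sup, Submodule.prod_map_snd, sup_comm]
  rfl

/-- Both sides measure the same subspace of Y × Z, once sliced along Z and projected to Y, once the
other way round. For the defect it is the codimension of dom f × cod h + g, for the excess the
dimension of g ∩ (ker f × indet h). -/
theorem pairIndex_cocycle [FiniteDimensional K Y] [FiniteDimensional K Z]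
    (f : Submodule K (X × Y)) (g : Submodule K (Y × Z)) (h : Submodule K (Z × W)) :
    pairIndex f g + pairIndex (compRel f g) h = pairIndex g h + pairIndex f (compRel g h) := by
  refine Prod.ext ?_ ?_
  · have h1 := finrank_quotient_map_add_finrank_quotient_comap (LinearMap.inr K Y Z)
      (LinearMap.fst K Y Z) LinearMap.inr_injective LinearMap.fst_surjective
      (LinearMap.range_inr K Y Z) ((domRel f).prod (codRel h) ⊔ g)
    have h2 := finrank_quotient_map_add_finrank_quotient_comap (LinearMap.inl K Y Z)
      (LinearMap.snd K Y Z) LinearMap.inl_injective LinearMap.snd_surjective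
      (LinearMap.range_inl K Y Z) ((domRel f).prod (codRel h) ⊔ g)
    rw [map_fst_domRel_prod_codRel, domRel_compRel] at h1
    rw [map_snd_domRel_prod_codRel, codRel_compRel] at h2
    exact h1.trans h2.symm
  · have h1 := finrank_map_add_finrank_comap (LinearMap.inr K Y Z) (LinearMap.fst K Y Z)
      LinearMap.inr_injective (LinearMap.range_inr K Y Z) (g ⊓ (kerRel f).prod (indetRel h))
    have h2 := finrank_map_add_finrank_comap (LinearMap.inl K Y Z) (LinearMap.snd K Y Z)
      LinearMap.inl_injective (LinearMap.range_inl K Y Z) (g ⊓ (kerRel f).prod (indetRel h))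
    have e1 : (g ⊓ (kerRel f).prod (indetRel h)).map (LinearMap.fst K Y Z) =
        kerRel f ⊓ indetRel (compRel g h) := by
      ext y
      constructor
      · rintro ⟨⟨y, z⟩, ⟨h1, h2, h3⟩, rfl⟩
        exact ⟨h2, z, h1, h3⟩
      · rintro ⟨h1, z, h2, h3⟩
        exact ⟨(y, z), ⟨h2, h1, h3⟩, rfl⟩
    have e2 : (g ⊓ (kerRel f).prod (indetRel h)).map (LinearMap.snd K Y Z) =
        kerRel (compRel f g) ⊓ indetRel h := by
      ext z
      constructor
      · rintro ⟨⟨y, z⟩, ⟨h1, h2, h3⟩, rfl⟩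
        exact ⟨⟨y, h2, h1⟩, h3⟩
      · rintro ⟨⟨y, h1, h2⟩, h3⟩
        exact ⟨(y, z), ⟨h2, h1, h3⟩, rfl⟩
    have e3 : (g ⊓ (kerRel f).prod (indetRel h)).comap (LinearMap.inr K Y Z) =
        kerRel g ⊓ indetRel h := by
      ext z
      exact ⟨fun ⟨h1, _, h3⟩ => ⟨h1, h3⟩, fun ⟨h1, h3⟩ => ⟨h1, f.zero_mem, h3⟩⟩
    have e4 : (g ⊓ (kerRel f).prod (indetRel h)).comap (LinearMap.inl K Y Z) =
        kerRel f ⊓ indetRel g := by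
      ext z
      exact ⟨fun ⟨h1, h3, _⟩ => ⟨h3, h1⟩, fun ⟨h1, h3⟩ => ⟨h3, h1, h.zero_mem⟩⟩
    rw [e1, e3] at h1
    rw [e2, e4] at h2
    change Module.finrank K (kerRel f ⊓ indetRel g : Submodule K Y) +
        Module.finrank K (kerRel (compRel f g) ⊓ indetRel h : Submodule K Z) =
      Module.finrank K (kerRel g ⊓ indetRel h : Submodule K Z) +
        Module.finrank K (kerRel f ⊓ indetRel (compRel g h) : Submodule K Y)
    omega

theorem monic_iff (f : Submodule K (X × Y)) (g : Submodule K (Y × Z)) :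
    Monic f g ↔ kerRel f ⊓ indetRel g = ⊥ := by
  rw [Submodule.eq_bot_iff]
  constructor
  · rintro h y ⟨h1, h2⟩
    exact h 0 y 0 0 h1 f.zero_mem h2 g.zero_mem
  · intro h x y y' z h1 h2 h3 h4
    refine sub_eq_zero.1 (h _ ⟨?_, ?_⟩)
    · simpa [kerRel] using f.sub_mem h1 h2
    · simpa [indetRel] using g.sub_mem h3 h4

theorem transversal_iff_sup (f : Submodule K (X × Y)) (g : Submodule K (Y × Z)) :
    Transversal f g ↔ domRel f ⊔ codRel g = ⊤ := by
  rw [transversal_iff, eq_top_iff]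
  constructor
  · intro h y _
    obtain ⟨x, a, b, z, h1, h2, rfl⟩ := h y
    exact Submodule.sub_mem _ (Submodule.mem_sup_left (mem_domRel.2 ⟨x, h1⟩))
      (Submodule.mem_sup_right (mem_codRel.2 ⟨z, h2⟩))
  · intro h y
    obtain ⟨a, ha, b, hb, rfl⟩ := Submodule.mem_sup.1 (h (Submodule.mem_top (x := y)))
    obtain ⟨x, hx⟩ := mem_domRel.1 ha
    obtain ⟨z, hz⟩ := mem_codRel.1 hb
    exact ⟨x, a, -b, -z, hx, g.neg_mem hz, by simp⟩

/-- Excess zero is monicity and defect zero is transversality. This ties the elementary moves to the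
cocycle: they compose precisely the pairs on which it vanishes. -/
theorem stronglyTransversal_iff_pairIndex [FiniteDimensional K Y] (f : Submodule K (X × Y))
    (g : Submodule K (Y × Z)) : StronglyTransversal f g ↔ pairIndex f g = 0 := by
  unfold StronglyTransversal
  rw [monic_iff, transversal_iff_sup, pairIndex, Prod.mk_eq_zero, Submodule.finrank_eq_zero,
    Module.finrank_zero_iff, Submodule.Quotient.subsingleton_iff, and_comm]

theorem stronglyTransversal_id_left (g : Submodule K (Y × Z)) :
    StronglyTransversal (idRel K Y) g := by
  refine ⟨(monic_iff _ _).2 ((Submodule.eq_bot_iff _).2 fun y h => h.1.symm),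
    (transversal_iff_sup _ _).2 (eq_top_iff.2 fun y _ => ?_)⟩
  exact Submodule.mem_sup_left (mem_domRel.2 ⟨y, rfl⟩)

theorem stronglyTransversal_id_right (f : Submodule K (X × Y)) :
    StronglyTransversal f (idRel K Y) := by
  refine ⟨(monic_iff _ _).2 ((Submodule.eq_bot_iff _).2 fun y h => h.2),
    (transversal_iff_sup _ _).2 (eq_top_iff.2 fun y _ => ?_)⟩
  exact Submodule.mem_sup_right (mem_codRel.2 ⟨y, rfl⟩)

/-- The domain of f × Δ_W contains 0 × W, so W adds no codimension, and the W-component of a kernel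
element is 0, so W adds no dimension. -/
theorem pairIndex_tensorRel [FiniteDimensional K Y] [FiniteDimensional K W]
    (f : Submodule K (X × Y)) (g : Submodule K (Y × Z)) :
    pairIndex (tensorRel f W) (tensorRel g W) = pairIndex f g := by
  refine Prod.ext ?_ ?_
  · have h1 := finrank_quotient_map_add_finrank_quotient_comap (LinearMap.inr K Y W)
      (LinearMap.fst K Y W) LinearMap.inr_injective LinearMap.fst_surjective
      (LinearMap.range_inr K Y W) (domRel (tensorRel f W) ⊔ codRel (tensorRel g W))
    have e1 : (domRel (tensorRel f W) ⊔ codRel (tensorRel g W)).map (LinearMap.fst K Y W) =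
        domRel f ⊔ codRel g := by
      rw [Submodule.map_sup]
      congr 1
      · ext y
        rw [mem_domRel]
        constructor
        · rintro ⟨⟨y, w⟩, h, rfl⟩
          obtain ⟨⟨x, w'⟩, h⟩ := mem_domRel.1 h
          exact ⟨x, h.1⟩
        · rintro ⟨x, h⟩
          exact ⟨(y, 0), mem_domRel.2 ⟨(x, 0), h, rfl⟩, rfl⟩
      · ext y
        rw [mem_codRel]
        constructor
        · rintro ⟨⟨y, w⟩, h, rfl⟩
          obtain ⟨⟨x, w'⟩, h⟩ := mem_codRel.1 h
          exact ⟨x, h.1⟩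
        · rintro ⟨x, h⟩
          exact ⟨(y, 0), mem_codRel.2 ⟨(x, 0), h, rfl⟩, rfl⟩
    have e2 : (domRel (tensorRel f W) ⊔ codRel (tensorRel g W)).comap (LinearMap.inr K Y W) =
        ⊤ := by
      rw [eq_top_iff]
      intro w _
      exact Submodule.mem_sup_left (mem_domRel.2 ⟨(0, w), f.zero_mem, rfl⟩)
    have e3 : Module.finrank K
        (W ⧸ (domRel (tensorRel f W) ⊔ codRel (tensorRel g W)).comap (LinearMap.inr K Y W)) =
        0 := by
      rw [Module.finrank_zero_iff, Submodule.Quotient.subsingleton_iff]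
      exact e2
    rw [e1, e3] at h1
    exact h1.symm
  · have e : kerRel (tensorRel f W) ⊓ indetRel (tensorRel g W) =
        (kerRel f ⊓ indetRel g).map (LinearMap.inl K Y W) := by
      ext ⟨y, w⟩
      constructor
      · rintro ⟨⟨h1, h2⟩, h3, -⟩
        have h2 : 0 = w := h2
        exact ⟨y, ⟨h1, h3⟩, Prod.ext rfl h2⟩
      · rintro ⟨y, ⟨h1, h3⟩, h⟩
        obtain ⟨rfl, rfl⟩ := Prod.ext_iff.1 h
        exact ⟨⟨h1, rfl⟩, h3, rfl⟩
    change Module.finrank K (kerRel (tensorRel f W) ⊓ indetRel (tensorRel g W) : Submodule K _) = _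
    rw [e]
    exact ((Submodule.equivMapOfInjective (LinearMap.inl K Y W)
      LinearMap.inl_injective _).finrank_eq).symm

end PairIndex

/-! ### Indices of composable sequences -/

section SequenceIndex

variable {K : Type u} [Field K]

/-- Links the simultaneous description of a sequence by chains with its successive composition; the
recursions for defect and excess rest on it. -/
theorem mem_rel_composePath {Y X : LREL K} (p : Quiver.Path Y X) (x : X.carrier)
    (y : Y.carrier) :
    (x, y) ∈ LREL.rel (composePath p) ↔ ∃ t ∈ productRel p, (x, t, y) ∈ chains p := by
  induction p with
  | nil => exact ⟨fun h => ⟨0, trivial, h⟩, fun ⟨t, _, h⟩ => h⟩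
  | @cons Z X p f ih =>
    constructor
    · rintro ⟨z, h1, h2⟩
      obtain ⟨t, h3, h4⟩ := (ih z).1 h2
      exact ⟨((x, z), t), ⟨h1, h3⟩, rfl, h4⟩
    · rintro ⟨⟨⟨x', z⟩, t⟩, ⟨h1, h3⟩, h2, h4⟩
      have h2 : x = x' := h2
      subst h2
      exact ⟨z, h1, (ih z).2 ⟨t, h3, h4⟩⟩

/-- The ambient space is (X × Z) × A, with A the ambient space of `p`. The projection to A sees the
defect of `p`; the slice over 0 ∈ A sees only how dom f and the codomain of the composition of `p`
lie in Z. -/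
theorem defect_cons {Y Z X : LREL K} (p : Quiver.Path Y Z) (f : Z ⟶ X) :
    defect (p.cons f) =
      defect p + (pairIndex (LREL.rel f) (LREL.rel (composePath p))).1 := by
  let XZ := X.carrier × Z.carrier
  let A := (ambient p).carrier
  let S : Submodule K (XZ × A) := productRel (p.cons f) ⊔ freeDiagonal (p.cons f)
  let U := domRel (LREL.rel f) ⊔ codRel (LREL.rel (composePath p))
  have h1 := finrank_quotient_map_add_finrank_quotient_comap (LinearMap.inl K XZ A)
      (LinearMap.snd K XZ A) LinearMap.inl_injective LinearMap.snd_surjective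
      (LinearMap.range_inl K XZ A) S
  have e1 : S.map (LinearMap.snd K XZ A) = productRel p ⊔ freeDiagonal p := by
    refine (Submodule.map_sup _ _ _).trans ?_
    congr 1
    · exact Submodule.prod_map_snd (p := LREL.rel f) (q := productRel p)
    · ext t
      constructor
      · rintro ⟨⟨⟨x, z⟩, t⟩, ⟨x', y, h1, h2⟩, rfl⟩
        exact ⟨z, y, h2⟩
      · rintro ⟨z, y, h⟩
        exact ⟨((0, z), t), ⟨0, y, rfl, h⟩, rfl⟩
  -- In the slice the A-components cancel, so the diagonal part t₂ = -t₁ also lies in the product of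
  -- the relations. It is thus a chain through them, and its starting point lies in the codomain of
  -- the composition.
  have e2 : S.comap (LinearMap.inl K XZ A) = U.comap (LinearMap.snd K X.carrier Z.carrier) := by
    ext ⟨x, z⟩
    constructor
    · intro h
      obtain ⟨⟨⟨x1, z1⟩, t1⟩, ⟨h1, h1'⟩, ⟨⟨x2, z2⟩, t2⟩, ⟨x3, y, h2, h3⟩, e⟩ :=
        Submodule.mem_sup.1 h
      have e1 : z1 + z2 = z := congrArg (fun q => q.1.2) e
      have e2 : t1 + t2 = 0 := congrArg (fun q => q.2) e
      change z ∈ U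
      rw [← e1]
      refine Submodule.add_mem_sup (mem_domRel.2 ⟨x1, h1⟩) (mem_codRel.2 ⟨y, ?_⟩)
      refine (mem_rel_composePath p _ _).2 ⟨t2, ?_, h3⟩
      rw [eq_neg_of_add_eq_zero_right e2]
      exact Submodule.neg_mem _ h1'
    · intro h
      obtain ⟨z1, h1, z2, h2, e⟩ := Submodule.mem_sup.1 h
      obtain ⟨x1, h1⟩ := mem_domRel.1 h1
      obtain ⟨y, h2⟩ := mem_codRel.1 h2
      obtain ⟨t, h3, h4⟩ := (mem_rel_composePath p _ _).1 h2
      refine Submodule.mem_sup.2 ⟨((x1, z1), -t), ⟨h1, Submodule.neg_mem _ h3⟩,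
        ((x - x1, z2), t), ⟨x - x1, y, rfl, h4⟩, ?_⟩
      have e : z1 + z2 = z := e
      refine Prod.ext (Prod.ext (add_sub_cancel _ _) e) (neg_add_cancel t)
  -- The preimage of U contains the whole X-direction, so it has the same codimension in X × Z as U
  -- has in Z.
  have h2 := finrank_quotient_map_add_finrank_quotient_comap
    (LinearMap.inl K X.carrier Z.carrier)
    (LinearMap.snd K X.carrier Z.carrier) LinearMap.inl_injective LinearMap.snd_surjective
    (LinearMap.range_inl K _ _) (U.comap (LinearMap.snd K X.carrier Z.carrier))
  have e3 : (U.comap (LinearMap.snd K X.carrier Z.carrier)).comap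
      (LinearMap.inl K X.carrier Z.carrier) = ⊤ := by
    rw [eq_top_iff]
    intro x _
    exact U.zero_mem
  have e4 : Module.finrank K (X.carrier ⧸ (U.comap (LinearMap.snd K X.carrier Z.carrier)).comap
      (LinearMap.inl K X.carrier Z.carrier)) = 0 := by
    rw [Module.finrank_zero_iff, Submodule.Quotient.subsingleton_iff]
    exact e3
  rw [Submodule.map_comap_eq_of_surjective LinearMap.snd_surjective, e4] at h2
  rw [e1, e2, ← h2] at h1
  exact h1.symm

/-- A closed chain is projected to its first link. The possible first links are (0, z) with z in the
kernel of f and in the indeterminacy of the composition of `p`; the chains with first link 0 are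
those counted by `excess p`. -/
theorem excess_cons {Y Z X : LREL K} (p : Quiver.Path Y Z) (f : Z ⟶ X) :
    excess (p.cons f) =
      excess p + (pairIndex (LREL.rel f) (LREL.rel (composePath p))).2 := by
  let XZ := X.carrier × Z.carrier
  let A := (ambient p).carrier
  let S : Submodule K (XZ × A) := productRel (p.cons f) ⊓ zeroDiagonal (p.cons f)
  have h1 := finrank_map_add_finrank_comap (LinearMap.inr K XZ A)
      (LinearMap.fst K XZ A) LinearMap.inr_injective (LinearMap.range_inr K XZ A) S
  have e1 : S.map (LinearMap.fst K XZ A) =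
      (kerRel (LREL.rel f) ⊓ indetRel (LREL.rel (composePath p))).map
        (LinearMap.inr K X.carrier Z.carrier) := by
    ext ⟨x, z⟩
    constructor
    · rintro ⟨⟨⟨x, z⟩, t⟩, ⟨⟨h1, h2⟩, h3, h4⟩, h⟩
      obtain ⟨rfl, rfl⟩ := Prod.ext_iff.1 h
      have h3 : 0 = x := h3
      subst h3
      exact ⟨z, ⟨h1, (mem_rel_composePath p _ _).2 ⟨t, h2, h4⟩⟩, rfl⟩
    · rintro ⟨z, ⟨h1, h2⟩, h⟩
      obtain ⟨rfl, rfl⟩ := Prod.ext_iff.1 h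
      obtain ⟨t, h3, h4⟩ := (mem_rel_composePath p _ _).1 h2
      exact ⟨((0, z), t), ⟨⟨h1, h3⟩, rfl, h4⟩, rfl⟩
  have e2 : S.comap (LinearMap.inr K XZ A) = productRel p ⊓ zeroDiagonal p := by
    ext t
    exact ⟨fun ⟨⟨_, h2⟩, _, h4⟩ => ⟨h2, h4⟩,
      fun ⟨h2, h4⟩ => ⟨⟨(LREL.rel f).zero_mem, h2⟩, rfl, h4⟩⟩
  rw [e1, e2, ← (Submodule.equivMapOfInjective (LinearMap.inr K X.carrier Z.carrier)
      LinearMap.inr_injective _).finrank_eq] at h1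
  exact h1.symm.trans (add_comm _ _)

theorem defect_nil (X : LREL K) : defect (Quiver.Path.nil : Quiver.Path X X) = 0 := by
  refine Module.finrank_zero_iff.2 ⟨fun a b => ?_⟩
  induction a using Submodule.Quotient.induction_on
  induction b using Submodule.Quotient.induction_on
  rfl

theorem excess_nil (X : LREL K) : excess (Quiver.Path.nil : Quiver.Path X X) = 0 :=
  Module.finrank_zero_iff.2 ⟨fun _ _ => Subtype.ext rfl⟩

end SequenceIndex

/-! ### Shadow and index of the arrows of the Wehrheim–Woodward category -/

section Index

variable {K : Type u} [Field K] {C : Type (u + 1)} [Category.{u} C] [RelCategory K C]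

/-- The vector space underlying an object of `C`. -/
abbrev Carrier (X : C) : Type u := ((RelCategory.toLREL (C := C)).obj X).carrier

/-- The linear relation underlying an arrow of `C`. -/
def homRel {Y X : C} (f : Y ⟶ X) : Submodule K (Carrier X × Carrier Y) :=
  LREL.rel ((RelCategory.toLREL (C := C)).map f)

theorem homRel_id (X : C) : homRel (𝟙 X) = idRel K (Carrier X) := by
  unfold homRel
  rw [CategoryTheory.Functor.map_id]
  rfl

theorem homRel_comp {X Y Z : C} (g : Z ⟶ Y) (f : Y ⟶ X) :
    homRel (g ≫ f) = compRel (homRel f) (homRel g) := by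
  unfold homRel
  rw [Functor.map_comp]
  rfl

theorem composePath_mapPath {Y X : C} (p : Quiver.Path Y X) :
    composePath ((RelCategory.toLREL (C := C)).toPrefunctor.mapPath p) =
      (RelCategory.toLREL (C := C)).map (composePath p) := by
  induction p with
  | nil => exact (CategoryTheory.Functor.map_id _ _).symm
  | cons p f ih =>
    rw [Prefunctor.mapPath_cons, composePath_cons, composePath_cons, ih, Functor.map_comp]
    rfl

/-- The pair of the defect and the excess of a composable sequence. -/
noncomputable def seqIndex {Y X : C} (p : Quiver.Path Y X) : ℕ × ℕ := (seqDefect p, seqExcess p)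

theorem seqIndex_nil (X : C) : seqIndex (Quiver.Path.nil : Quiver.Path X X) = 0 :=
  Prod.ext (defect_nil _) (excess_nil _)

theorem seqIndex_cons {Y Z X : C} (p : Quiver.Path Y Z) (f : Z ⟶ X) :
    seqIndex (p.cons f) = seqIndex p + pairIndex (homRel f) (homRel (composePath p)) := by
  have h1 := defect_cons ((RelCategory.toLREL (C := C)).toPrefunctor.mapPath p)
    ((RelCategory.toLREL (C := C)).map f)
  have h2 := excess_cons ((RelCategory.toLREL (C := C)).toPrefunctor.mapPath p)
    ((RelCategory.toLREL (C := C)).map f)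
  rw [composePath_mapPath] at h1 h2
  exact Prod.ext h1 h2

theorem pairIndex_id_left {Y X : C} (f : Y ⟶ X) : pairIndex (homRel (𝟙 X)) (homRel f) = 0 := by
  rw [← stronglyTransversal_iff_pairIndex, homRel_id]
  exact stronglyTransversal_id_left _

theorem pairIndex_id_right {Y X : C} (f : Y ⟶ X) : pairIndex (homRel f) (homRel (𝟙 Y)) = 0 := by
  rw [← stronglyTransversal_iff_pairIndex, homRel_id]
  exact stronglyTransversal_id_right _

theorem seqIndex_pair {X Y Z : C} (f : Y ⟶ X) (g : Z ⟶ Y) :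
    seqIndex (g.toPath.comp f.toPath) = pairIndex (homRel f) (homRel g) := by
  change seqIndex ((Quiver.Path.nil.cons g).cons f) = _
  rw [seqIndex_cons, seqIndex_cons, seqIndex_nil, composePath_nil, pairIndex_id_right, add_zero,
    zero_add, composePath_cons, composePath_nil, Category.id_comp]

variable (C) in
/-- The cocycle of defects and excesses of composable pairs. -/
noncomputable def indexCocycle : Cocycle C (ℕ × ℕ) where
  val f g := pairIndex (homRel f) (homRel g)
  assoc f g h := by
    rw [homRel_comp, homRel_comp]
    exact pairIndex_cocycle _ _ _
  id_left := pairIndex_id_left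
  id_right := pairIndex_id_right

namespace WW

variable (C) in
/-- Shadow and index, as a functor to the central extension with values in all pairs. -/
noncomputable def indexFunctor : WW C ⥤ CentralExtension (indexCocycle C) :=
  CategoryTheory.Quotient.lift (moveRel C)
    (Paths.lift (C := CentralExtension (indexCocycle C))
      { obj := fun Q : C => ⟨Q⟩
        -- A single arrow has index 0; all indices of sequences come from the cocycle.
        map := fun f => ⟨f, 0⟩ }) (by
    intro Y X p q h
    have key : ∀ {Y X : C} (p q : Quiver.Path Y X), Move C p q →
        (Paths.lift (C := CentralExtension (indexCocycle C))
          { obj := fun Q : C => ⟨Q⟩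
            map := fun f => ⟨f, 0⟩ }).map (X := (Y : Paths C)) (Y := (X : Paths C)) p =
        (Paths.lift (C := CentralExtension (indexCocycle C))
          { obj := fun Q : C => ⟨Q⟩
            map := fun f => ⟨f, 0⟩ }).map (X := (Y : Paths C)) (Y := (X : Paths C)) q := by
      intro Y X p q h
      cases h with
      | id X => exact (Category.id_comp (X := (⟨Y⟩ : CentralExtension (indexCocycle C))) _).symm
      | comp g f h =>
        refine (congrArg (· ≫ _) (Category.id_comp _)).trans
          (Eq.trans ?_ (Category.id_comp _).symm)
        refine CentralExtension.Arrow.ext rfl ?_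
        change 0 + 0 + pairIndex (homRel f) (homRel g) = 0
        rw [zero_add, zero_add]
        exact (stronglyTransversal_iff_pairIndex _ _).1 h
    exact key _ _ h)

/-- The pair of the defect and the excess of an arrow of `WW C`. -/
noncomputable def index {Y X : WW C} (w : Y ⟶ X) : ℕ × ℕ := ((indexFunctor C).map w).index

@[elab_as_elim]
theorem induction {Y : C} {motive : ∀ {X : C}, (WW.ob Y ⟶ WW.ob X) → Prop}
    (id : motive (𝟙 (WW.ob Y)))
    (comp_single : ∀ {Z X : C} (w : WW.ob Y ⟶ WW.ob Z) (f : Z ⟶ X), motive w →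
      motive (w ≫ WW.single f)) {X : C} (w : WW.ob Y ⟶ WW.ob X) : motive w := by
  obtain ⟨p, rfl⟩ : ∃ p : Quiver.Path Y X, WW.mk p = w := Quot.exists_rep w
  induction p with
  | nil => exact id
  | cons p f ih => exact comp_single (WW.mk p) f ih

/-- The shadow of an arrow between objects of `C`. -/
def sh {Y X : C} (w : WW.ob Y ⟶ WW.ob X) : Y ⟶ X := (WW.shadow C).map w

theorem sh_id (X : C) : sh (𝟙 (WW.ob X)) = 𝟙 X := rfl

theorem sh_comp {Z Y X : C} (v : WW.ob Z ⟶ WW.ob Y) (w : WW.ob Y ⟶ WW.ob X) :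
    sh (v ≫ w) = sh v ≫ sh w := (WW.shadow C).map_comp v w

theorem sh_single {Y X : C} (f : Y ⟶ X) : sh (WW.single f) = f := composePath_toPath f

theorem sh_mk {Y X : C} (p : Quiver.Path Y X) : sh (WW.mk p) = composePath p := rfl

theorem index_id (X : C) : index (𝟙 (WW.ob X)) = 0 := by
  unfold index
  rw [CategoryTheory.Functor.map_id]
  rfl

theorem indexFunctor_map_single {Y X : C} (f : Y ⟶ X) : (indexFunctor C).map (WW.single f) =
    (⟨f, 0⟩ : CentralExtension.Arrow Y X (ℕ × ℕ)) :=
  Category.id_comp (X := (⟨Y⟩ : CentralExtension (indexCocycle C)))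
    (Y := (⟨X⟩ : CentralExtension (indexCocycle C))) _

theorem indexFunctor_map_shadow {Y X : C} (w : WW.ob Y ⟶ WW.ob X) :
    ((indexFunctor C).map w).shadow = sh w := by
  induction w using WW.induction with
  | id => rfl
  | comp_single w f ih =>
    rw [sh_comp, sh_single, Functor.map_comp, ← ih, indexFunctor_map_single]
    rfl

theorem index_comp {Z Y X : C} (v : WW.ob Z ⟶ WW.ob Y) (w : WW.ob Y ⟶ WW.ob X) :
    index (v ≫ w) = index w + index v + pairIndex (homRel (sh w)) (homRel (sh v)) := by
  rw [← indexFunctor_map_shadow, ← indexFunctor_map_shadow]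
  unfold index
  rw [Functor.map_comp]
  rfl

theorem index_single {Y X : C} (f : Y ⟶ X) : index (WW.single f) = 0 := by
  unfold index
  rw [indexFunctor_map_single]

/-- Both sides satisfy the same recursion in the length of the sequence. As the left side is defined
on classes, this proves the invariance of defect and excess. -/
theorem index_mk {Y X : C} (p : Quiver.Path Y X) : index (WW.mk p) = seqIndex p := by
  induction p with
  | nil => exact (index_id _).trans (seqIndex_nil _).symm
  | cons p f ih =>
    refine (index_comp (WW.mk p) (WW.single f)).trans ?_
    rw [index_single, ih, sh_single, sh_mk, zero_add]
    exact (seqIndex_cons p f).symm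

theorem single_comp_single_of_index {X Y Z : C} (g : Z ⟶ Y) (f : Y ⟶ X)
    (h : pairIndex (homRel f) (homRel g) = 0) :
    WW.single g ≫ WW.single f = WW.single (g ≫ f) :=
  WW.single_comp g f ((stronglyTransversal_iff_pairIndex _ _).2 h)

/-! ### Natural endomorphisms that only change the index -/

/-- A natural family of endomorphisms of the objects of `WW C` with trivial shadows and constant
index `a`. -/
structure Shift (C : Type (u + 1)) [Category.{u} C] [RelCategory K C] (a : ℕ × ℕ) where
  app : ∀ X : C, WW.ob X ⟶ WW.ob X
  naturality_single : ∀ {Y X : C} (f : Y ⟶ X),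
    app Y ≫ WW.single f = WW.single f ≫ app X
  shadow : ∀ X, WW.sh (app X) = 𝟙 X
  index : ∀ X, WW.index (app X) = a

namespace Shift

/-- Naturality passes from single arrows to all of `WW C`, since these generate it. Shifts can
therefore be moved to the end of any sequence, and past each other. -/
theorem naturality {a : ℕ × ℕ} (σ : Shift C a) {Y X : C} (w : WW.ob Y ⟶ WW.ob X) :
    σ.app Y ≫ w = w ≫ σ.app X := by
  induction w using WW.induction with
  | id => rw [Category.id_comp, Category.comp_id]
  | comp_single w f ih =>
    rw [← Category.assoc, ih, Category.assoc, σ.naturality_single, Category.assoc]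

theorem shadow_comp {a : ℕ × ℕ} (σ : Shift C a) {Y X : C} (w : WW.ob Y ⟶ WW.ob X) :
    WW.sh (w ≫ σ.app X) = WW.sh w := by
  rw [WW.sh_comp, σ.shadow, Category.comp_id]

theorem index_comp {a : ℕ × ℕ} (σ : Shift C a) {Y X : C} (w : WW.ob Y ⟶ WW.ob X) :
    WW.index (w ≫ σ.app X) = a + WW.index w := by
  rw [WW.index_comp, σ.index, σ.shadow, pairIndex_id_left, add_zero]

/-- Composition of shifts. -/
def comp {a b : ℕ × ℕ} (σ : Shift C a) (τ : Shift C b) : Shift C (a + b) where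
  app X := σ.app X ≫ τ.app X
  naturality_single f := by
    rw [Category.assoc, τ.naturality_single, ← Category.assoc, σ.naturality_single,
      Category.assoc]
  shadow X := by rw [τ.shadow_comp, σ.shadow]
  index X := by rw [τ.index_comp, σ.index, add_comm]

/-- The trivial shift. -/
def zero : Shift C 0 where
  app X := 𝟙 _
  naturality_single f := by rw [Category.id_comp, Category.comp_id]
  shadow X := sh_id _
  index X := index_id _

/-- The powers of a shift. -/
def nsmul {a : ℕ × ℕ} (σ : Shift C a) : (n : ℕ) → Shift C (n • a)
  | 0 => zero_nsmul a ▸ zero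
  | n + 1 => succ_nsmul a n ▸ (σ.nsmul n).comp σ

/-- The index is part of the type of a shift, so the powers are defined by transport along
equalities of indices; the underlying arrows do not feel it. -/
theorem cast_app {a b : ℕ × ℕ} (h : a = b) (σ : Shift C a) (X : C) : (h ▸ σ).app X = σ.app X := by
  subst h
  rfl

theorem nsmul_zero_app {a : ℕ × ℕ} (σ : Shift C a) (X : C) : (σ.nsmul 0).app X = 𝟙 _ :=
  cast_app (zero_nsmul a).symm zero X

theorem nsmul_succ_app {a : ℕ × ℕ} (σ : Shift C a) (n : ℕ) (X : C) :
    (σ.nsmul (n + 1)).app X = (σ.nsmul n).app X ≫ σ.app X :=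
  cast_app (succ_nsmul a n).symm ((σ.nsmul n).comp σ) X

end Shift

/-! ### Normal forms -/

section NormalForm

variable {a₀ a₁ : ℕ × ℕ} (σ₀ : Shift C a₀) (σ₁ : Shift C a₁)

/-- An arrow is in normal form if it is obtained from an arrow of `C` by the powers of the two
shifts. -/
def HasNormalForm {Y X : C} (w : WW.ob Y ⟶ WW.ob X) : Prop :=
  ∃ (f : Y ⟶ X) (m n : ℕ), w = WW.single f ≫ ((σ₀.nsmul m).comp (σ₁.nsmul n)).app X

variable {σ₀ σ₁}

theorem HasNormalForm.single {Y X : C} (f : Y ⟶ X) : HasNormalForm σ₀ σ₁ (WW.single f) := by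
  refine ⟨f, 0, 0, ?_⟩
  change _ = _ ≫ _ ≫ _
  rw [Shift.nsmul_zero_app, Shift.nsmul_zero_app, Category.comp_id, Category.comp_id]

theorem HasNormalForm.comp_fst {Y X : C} {w : WW.ob Y ⟶ WW.ob X} (h : HasNormalForm σ₀ σ₁ w) :
    HasNormalForm σ₀ σ₁ (w ≫ σ₀.app X) := by
  obtain ⟨f, m, n, rfl⟩ := h
  refine ⟨f, m + 1, n, ?_⟩
  change (_ ≫ _ ≫ _) ≫ _ = _ ≫ _ ≫ _
  rw [Shift.nsmul_succ_app, Category.assoc, Category.assoc, Category.assoc,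
    (σ₁.nsmul n).naturality]

theorem HasNormalForm.comp_snd {Y X : C} {w : WW.ob Y ⟶ WW.ob X} (h : HasNormalForm σ₀ σ₁ w) :
    HasNormalForm σ₀ σ₁ (w ≫ σ₁.app X) := by
  obtain ⟨f, m, n, rfl⟩ := h
  refine ⟨f, m, n + 1, ?_⟩
  change (_ ≫ _ ≫ _) ≫ _ = _ ≫ _ ≫ _
  rw [Shift.nsmul_succ_app, Category.assoc, Category.assoc]

theorem HasNormalForm.comp_shift {Y X : C} {w : WW.ob Y ⟶ WW.ob X} (h : HasNormalForm σ₀ σ₁ w)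
    (m n : ℕ) : HasNormalForm σ₀ σ₁ (w ≫ ((σ₀.nsmul m).comp (σ₁.nsmul n)).app X) := by
  change HasNormalForm σ₀ σ₁ (w ≫ _ ≫ _)
  rw [← Category.assoc]
  have h₀ : HasNormalForm σ₀ σ₁ (w ≫ (σ₀.nsmul m).app X) := by
    induction m with
    | zero => rwa [Shift.nsmul_zero_app, Category.comp_id]
    | succ m ih =>
      rw [Shift.nsmul_succ_app, ← Category.assoc]
      exact ih.comp_fst
  induction n with
  | zero => rwa [Shift.nsmul_zero_app, Category.comp_id]
  | succ n ih =>
    rw [Shift.nsmul_succ_app, ← Category.assoc]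
    exact ih.comp_snd

variable (σ₀ σ₁) in
/-- From each composable pair of nonzero index one of the two shifts can be split off. -/
def Reducible : Prop :=
  ∀ {X Y Z : C} (f : Y ⟶ X) (g : Z ⟶ Y), pairIndex (homRel f) (homRel g) ≠ 0 →
    ∃ (f' : Y ⟶ X) (g' : Z ⟶ Y),
      WW.single g ≫ WW.single f = (WW.single g' ≫ WW.single f') ≫ σ₀.app X ∨
      WW.single g ≫ WW.single f = (WW.single g' ≫ WW.single f') ≫ σ₁.app X

/-- Strong induction on defect plus excess of the pair: each shift that is split off carries a
nonzero part of the index with it. At index zero the pair is strongly transversal and composes to a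
single arrow. -/
theorem HasNormalForm.pair (h : Reducible σ₀ σ₁) (h₀ : a₀ ≠ 0) (h₁ : a₁ ≠ 0) {X Y Z : C}
    (f : Y ⟶ X) (g : Z ⟶ Y) : HasNormalForm σ₀ σ₁ (WW.single g ≫ WW.single f) := by
  have hsum : ∀ a : ℕ × ℕ, a ≠ 0 → 0 < a.1 + a.2 := by
    rintro ⟨i, j⟩ ha
    rw [ne_eq, Prod.mk_eq_zero] at ha
    change 0 < i + j
    omega
  have hpair : ∀ (f : Y ⟶ X) (g : Z ⟶ Y),
      index (WW.single g ≫ WW.single f) = pairIndex (homRel f) (homRel g) := by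
    intro f g
    rw [index_comp, index_single, index_single, sh_single, sh_single, add_zero, zero_add]
  generalize hn : (pairIndex (homRel f) (homRel g)).1 + (pairIndex (homRel f) (homRel g)).2 = n
  induction n using Nat.strong_induction_on generalizing f g with
  | _ n ih =>
    by_cases hfg : pairIndex (homRel f) (homRel g) = 0
    · rw [single_comp_single_of_index g f hfg]
      exact HasNormalForm.single _
    · obtain ⟨f', g', e | e⟩ := h f g hfg
      · have hi := congrArg index e
        rw [σ₀.index_comp, hpair, hpair] at hi
        have hs := hsum a₀ h₀
        rw [hi, Prod.fst_add, Prod.snd_add] at hn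
        rw [e]
        exact (ih _ (by omega) f' g' rfl).comp_fst
      · have hi := congrArg index e
        rw [σ₁.index_comp, hpair, hpair] at hi
        have hs := hsum a₁ h₁
        rw [hi, Prod.fst_add, Prod.snd_add] at hn
        rw [e]
        exact (ih _ (by omega) f' g' rfl).comp_snd

/-- When an entry is appended to a normal form, naturality moves the shifts behind it, and only a
pair of arrows of `C` remains to be treated. -/
theorem hasNormalForm (h : Reducible σ₀ σ₁) (h₀ : a₀ ≠ 0) (h₁ : a₁ ≠ 0) {Y X : C}
    (w : WW.ob Y ⟶ WW.ob X) : HasNormalForm σ₀ σ₁ w := by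
  induction w using WW.induction with
  | id =>
    rw [← WW.single_id]
    exact HasNormalForm.single _
  | comp_single w f ih =>
    obtain ⟨g, m, n, e⟩ := ih
    rw [e, Category.assoc, Shift.naturality, ← Category.assoc]
    exact (HasNormalForm.pair h h₀ h₁ f g).comp_shift m n

theorem sh_normalForm {Y X : C} (f : Y ⟶ X) (m n : ℕ) :
    WW.sh (WW.single f ≫ ((σ₀.nsmul m).comp (σ₁.nsmul n)).app X) = f := by
  rw [Shift.shadow_comp, sh_single]

theorem index_normalForm {Y X : C} (f : Y ⟶ X) (m n : ℕ) :
    index (WW.single f ≫ ((σ₀.nsmul m).comp (σ₁.nsmul n)).app X) = m • a₀ + n • a₁ := by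
  rw [Shift.index_comp, index_single, add_zero]

end NormalForm

/-! ### The tensor action -/

/-- Tensoring with an identity does not change the index of a composable pair. -/
def TensorInvariant (C : Type (u + 1)) [Category.{u} C] [RelCategory K C] : Prop :=
  ∀ (W : C) {X Y Z : C} (f : Y ⟶ X) (g : Z ⟶ Y),
    pairIndex (homRel ((RelCategory.tensorRight W).map f))
      (homRel ((RelCategory.tensorRight W).map g)) = pairIndex (homRel f) (homRel g)

/-- The value of `WW.tensorRight` on an arrow between objects of `C`. -/
def tensorMap (W : C) {Y X : C} (w : WW.ob Y ⟶ WW.ob X) :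
    WW.ob ((RelCategory.tensorRight W).obj Y) ⟶ WW.ob ((RelCategory.tensorRight W).obj X) :=
  (WW.tensorRight W).map w

theorem tensorMap_id (W : C) (X : C) : tensorMap W (𝟙 (WW.ob X)) = 𝟙 _ := rfl

theorem tensorMap_comp_single (W : C) {Y Z X : C} (w : WW.ob Y ⟶ WW.ob Z) (f : Z ⟶ X) :
    tensorMap W (w ≫ WW.single f) =
      tensorMap W w ≫ WW.single ((RelCategory.tensorRight W).map f) := by
  refine ((WW.tensorRight W).map_comp w (WW.single f)).trans ?_
  exact congrArg (tensorMap W w ≫ ·) (Category.id_comp (X := WW.ob _) (Y := WW.ob _) _)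

theorem sh_tensorMap (W : C) {Y X : C} (w : WW.ob Y ⟶ WW.ob X) :
    sh (tensorMap W w) = (RelCategory.tensorRight W).map (sh w) := by
  induction w using WW.induction with
  | id => rw [tensorMap_id, sh_id, sh_id, CategoryTheory.Functor.map_id]
  | comp_single w f ih =>
    rw [tensorMap_comp_single, sh_comp, sh_comp, sh_single, sh_single, ih, Functor.map_comp]

theorem index_tensorMap (hC : TensorInvariant C) (W : C) {Y X : C} (w : WW.ob Y ⟶ WW.ob X) :
    index (tensorMap W w) = index w := by
  induction w using WW.induction with
  | id => rw [tensorMap_id, index_id, index_id]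
  | comp_single w f ih =>
    rw [tensorMap_comp_single, index_comp, index_comp, ih, index_single, index_single, sh_single,
      sh_single, sh_tensorMap, hC]

/-- The composition of `i.hom` with its inverse is the diagonal of Y, which forces the kernel of
`i.hom` to be 0 and its domain to be all of Y. -/
theorem pairIndex_hom_left {X Y Z : C} (i : Y ≅ X) (g : Z ⟶ Y) :
    pairIndex (homRel i.hom) (homRel g) = 0 := by
  have h : compRel (homRel i.inv) (homRel i.hom) = idRel K (Carrier Y) := by
    rw [← homRel_comp, i.hom_inv_id, homRel_id]
  rw [← stronglyTransversal_iff_pairIndex, StronglyTransversal, monic_iff, transversal_iff_sup]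
  refine ⟨(Submodule.eq_bot_iff _).2 fun y hy => ?_, eq_top_iff.2 fun y _ => ?_⟩
  · have h0 : (0, y) ∈ compRel (homRel i.inv) (homRel i.hom) :=
      ⟨0, Submodule.zero_mem _, hy.1⟩
    rw [h] at h0
    exact h0.symm
  · have h0 : (y, y) ∈ compRel (homRel i.inv) (homRel i.hom) := by
      rw [h]
      rfl
    obtain ⟨x, -, hx⟩ := h0
    exact Submodule.mem_sup_left (mem_domRel.2 ⟨x, hx⟩)

theorem pairIndex_hom_right {X Y Z : C} (f : Y ⟶ X) (i : Z ≅ Y) :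
    pairIndex (homRel f) (homRel i.hom) = 0 := by
  have h : compRel (homRel i.hom) (homRel i.inv) = idRel K (Carrier Y) := by
    rw [← homRel_comp, i.inv_hom_id, homRel_id]
  rw [← stronglyTransversal_iff_pairIndex, StronglyTransversal, monic_iff, transversal_iff_sup]
  refine ⟨(Submodule.eq_bot_iff _).2 fun y hy => ?_, eq_top_iff.2 fun y _ => ?_⟩
  · have h0 : (y, 0) ∈ compRel (homRel i.hom) (homRel i.inv) :=
      ⟨0, hy.2, Submodule.zero_mem _⟩
    rw [h] at h0
    exact h0
  · have h0 : (y, y) ∈ compRel (homRel i.hom) (homRel i.inv) := by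
      rw [h]
      rfl
    obtain ⟨x, hx, -⟩ := h0
    exact Submodule.mem_sup_right (mem_codRel.2 ⟨x, hx⟩)

/-- The action of an endomorphism of the unit object on an object of `C`. -/
def unitAction (a : WW.ob (RelCategory.one (C := C)) ⟶ WW.ob RelCategory.one) (X : C) :
    WW.ob X ⟶ WW.ob X :=
  WW.single (RelCategory.leftUnitor X).inv ≫ tensorMap X a ≫
    WW.single (RelCategory.leftUnitor X).hom

theorem sh_unitAction (a : WW.ob (RelCategory.one (C := C)) ⟶ WW.ob RelCategory.one)
    (ha : sh a = 𝟙 _) (X : C) : sh (unitAction a X) = 𝟙 X := by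
  unfold unitAction
  rw [sh_comp, sh_comp, sh_single, sh_single, sh_tensorMap, ha, CategoryTheory.Functor.map_id,
    Category.id_comp, Iso.inv_hom_id]

/-- The unitors are isomorphisms and so add nothing to the index of the tensored sequence. -/
theorem index_unitAction (hC : TensorInvariant C)
    (a : WW.ob (RelCategory.one (C := C)) ⟶ WW.ob RelCategory.one) (X : C) :
    index (unitAction a X) = index a := by
  unfold unitAction
  rw [index_comp, index_comp, index_single, index_single, index_tensorMap hC, sh_single,
    sh_single, pairIndex_hom_left, show pairIndex _ (homRel (RelCategory.leftUnitor X).inv) = 0 from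
      pairIndex_hom_right _ (RelCategory.leftUnitor X).symm]
  simp only [zero_add, add_zero]

end WW

end Index

/-! ### From normal forms to the structure of the Wehrheim–Woodward category -/

section DoublyIndexed

variable {K : Type u} [Field K] {C : Type (u + 1)} [Category.{u} C] [RelCategory K C]

theorem pairIndex_eq_zero_of_subsingleton {X Y Z : Type u} [AddCommGroup X] [Module K X]
    [AddCommGroup Y] [Module K Y] [AddCommGroup Z] [Module K Z] [Subsingleton Y]
    (f : Submodule K (X × Y)) (g : Submodule K (Y × Z)) : pairIndex f g = 0 := by
  rw [← stronglyTransversal_iff_pairIndex]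
  exact ⟨fun _ _ _ _ _ _ _ _ => Subsingleton.elim _ _,
    (transversal_iff_sup _ _).2 (Subsingleton.elim _ _)⟩

/-- The cocycle of indices, with values in a submonoid that contains all of them. -/
noncomputable def indexCocycleIn (A : AddSubmonoid (ℕ × ℕ))
    (hA : ∀ {X Y Z : C} (f : Y ⟶ X) (g : Z ⟶ Y), pairIndex (homRel f) (homRel g) ∈ A) :
    Cocycle C A where
  val f g := ⟨pairIndex (homRel f) (homRel g), hA f g⟩
  assoc f g h := Subtype.ext ((indexCocycle C).assoc f g h)
  id_left f := Subtype.ext (pairIndex_id_left f)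
  id_right f := Subtype.ext (pairIndex_id_right f)

/-- The object of `C` given by an object of `WW C`. -/
def WW.base (X : WW C) : C := X.as

/-- Shadow and index, as a functor to the central extension by a submonoid that contains all
indices. -/
noncomputable def WW.indexFunctorIn (A : AddSubmonoid (ℕ × ℕ))
    (hA : ∀ {X Y Z : C} (f : Y ⟶ X) (g : Z ⟶ Y), pairIndex (homRel f) (homRel g) ∈ A)
    (hW : ∀ {Y X : C} (w : WW.ob Y ⟶ WW.ob X), WW.index w ∈ A) :
    WW C ⥤ CentralExtension (indexCocycleIn A hA) where
  obj X := ⟨WW.base X⟩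
  map {Y X} w := ⟨WW.sh (Y := WW.base Y) (X := WW.base X) w,
    ⟨WW.index w, hW (Y := WW.base Y) (X := WW.base X) w⟩⟩
  map_id X := CentralExtension.Arrow.ext (WW.sh_id (WW.base X))
    (Subtype.ext (WW.index_id (WW.base X)))
  map_comp {Z Y X} v w := CentralExtension.Arrow.ext
    (WW.sh_comp (Z := WW.base Z) (Y := WW.base Y) (X := WW.base X) v w)
    (Subtype.ext (WW.index_comp (Z := WW.base Z) (Y := WW.base Y) (X := WW.base X) v w))

/-- The submonoid A is free on a₀ and a₁, by `hA` and `hinj`. The triple (f, m, n) of a normal form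
is therefore equivalent to the shadow f with the index m a₀ + n a₁ ∈ A, and this equivalence yields
all the assertions. -/
theorem isDoublyIndexed_of_reducible (A : AddSubmonoid (ℕ × ℕ)) {a₀ a₁ : ℕ × ℕ}
    (σ₀ : WW.Shift C a₀) (σ₁ : WW.Shift C a₁) (hσ : WW.Reducible σ₀ σ₁)
    (hA : ∀ a, a ∈ A ↔ ∃ m n : ℕ, m • a₀ + n • a₁ = a)
    (hinj : ∀ m n m' n' : ℕ, m • a₀ + n • a₁ = m' • a₀ + n' • a₁ → m = m' ∧ n = n')
    (hone : Subsingleton (RelCategory.one (C := C) ⟶ RelCategory.one))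
    (hcarrier : Subsingleton (Carrier (RelCategory.one (C := C))))
    (htensor : WW.TensorInvariant C) : IsDoublyIndexed C A := by
  have h₀ : a₀ ≠ 0 := by
    rintro rfl
    exact one_ne_zero (hinj 1 0 0 0 (by simp)).1
  have h₁ : a₁ ≠ 0 := by
    rintro rfl
    exact one_ne_zero (hinj 0 1 0 0 (by simp)).2
  have hnf : ∀ {Y X : C} (w : WW.ob Y ⟶ WW.ob X), WW.HasNormalForm σ₀ σ₁ w :=
    fun w => WW.hasNormalForm hσ h₀ h₁ w
  have hW : ∀ {Y X : C} (w : WW.ob Y ⟶ WW.ob X), WW.index w ∈ A := by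
    intro Y X w
    obtain ⟨f, m, n, rfl⟩ := hnf w
    exact (hA _).2 ⟨m, n, (WW.index_normalForm f m n).symm⟩
  have hpair : ∀ {X Y Z : C} (f : Y ⟶ X) (g : Z ⟶ Y), pairIndex (homRel f) (homRel g) ∈ A := by
    intro X Y Z f g
    have h := hW (WW.single g ≫ WW.single f)
    rwa [WW.index_comp, WW.index_single, WW.index_single, WW.sh_single, WW.sh_single, add_zero,
      zero_add] at h
  have hdet : ∀ {Y X : C} (w w' : WW.ob Y ⟶ WW.ob X), WW.sh w = WW.sh w' →
      WW.index w = WW.index w' → w = w' := by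
    intro Y X w w' h h'
    obtain ⟨f, m, n, rfl⟩ := hnf w
    obtain ⟨f', m', n', rfl⟩ := hnf w'
    rw [WW.sh_normalForm, WW.sh_normalForm] at h
    rw [WW.index_normalForm, WW.index_normalForm] at h'
    obtain ⟨rfl, rfl⟩ := hinj _ _ _ _ h'
    rw [h]
  have hex : ∀ {Y X : C} (f : Y ⟶ X) (a : ℕ × ℕ), a ∈ A →
      ∃ w : WW.ob Y ⟶ WW.ob X, WW.sh w = f ∧ WW.index w = a := by
    intro Y X f a ha
    obtain ⟨m, n, rfl⟩ := (hA a).1 ha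
    exact ⟨_, WW.sh_normalForm (σ₀ := σ₀) (σ₁ := σ₁) f m n, WW.index_normalForm f m n⟩
  let φ : End (WW.one C) →* Multiplicative A :=
    { toFun := fun a => Multiplicative.ofAdd ⟨WW.index a, hW (Y := RelCategory.one (C := C))
        (X := RelCategory.one) a⟩
      map_one' := congrArg Multiplicative.ofAdd
        (Subtype.ext (WW.index_id (RelCategory.one (C := C))))
      map_mul' := by
        intro a b
        refine congrArg Multiplicative.ofAdd (Subtype.ext ?_)
        refine (WW.index_comp (Z := RelCategory.one (C := C)) (Y := RelCategory.one (C := C))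
          (X := RelCategory.one) b a).trans ?_
        -- The middle space is zero, so the cocycle vanishes on endomorphisms of the unit and the
        -- index is additive on them.
        rw [pairIndex_eq_zero_of_subsingleton]
        rfl }
  have hφ : Function.Bijective φ := by
    constructor
    · intro a b h
      -- The unit has only one endomorphism in `C`, so the shadows agree automatically.
      exact hdet (Y := RelCategory.one (C := C)) (X := RelCategory.one) a b (Subsingleton.elim _ _)
        (congrArg (fun x => ((Multiplicative.toAdd x : A) : ℕ × ℕ)) h)
    · intro x
      obtain ⟨w, -, hw⟩ := hex (𝟙 (RelCategory.one (C := C))) (Multiplicative.toAdd x : A)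
        (Multiplicative.toAdd x).2
      exact ⟨w, congrArg Multiplicative.ofAdd (Subtype.ext hw)⟩
  refine ⟨fun Y X w => (WW.index w).1, fun Y X w => (WW.index w).2, ?_, ?_, ?_,
    MulEquiv.ofBijective φ hφ, fun a => rfl, indexCocycleIn A hpair, ?_,
    WW.indexFunctorIn A hpair hW, ⟨?_, ?_⟩, ⟨?_⟩, ⟨?_⟩, ?_, fun w => rfl, ?_⟩
  · intro Y X p
    exact ⟨congrArg Prod.fst (WW.index_mk p), congrArg Prod.snd (WW.index_mk p)⟩
  · intro Y X w w' h hd he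
    exact hdet w w' h (Prod.ext hd he)
  · intro Y X f d e
    constructor
    · rintro ⟨w, -, rfl, rfl⟩
      exact hW w
    · intro h
      obtain ⟨w, h1, h2⟩ := hex f (d, e) h
      exact ⟨w, h1, congrArg Prod.fst h2, congrArg Prod.snd h2⟩
  · intro X Y Z f g
    exact (seqIndex_pair f g).symm
  · intro X Y h
    have h' : WW.base X = WW.base Y := congrArg CentralExtension.base h
    exact congrArg WW.ob h'
  · intro X
    exact ⟨WW.ob X.base, rfl⟩
  · intro Y X f
    obtain ⟨w, h1, h2⟩ := hex (Y := WW.base Y) (X := WW.base X) f.shadow f.index f.index.2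
    exact ⟨w, CentralExtension.Arrow.ext h1 (Subtype.ext h2)⟩
  · intro Y X w w' h
    exact hdet (Y := WW.base Y) (X := WW.base X) w w' (congrArg CentralExtension.Arrow.shadow h)
      (congrArg Subtype.val (congrArg CentralExtension.Arrow.index h :
        ((WW.indexFunctorIn A hpair hW).map w).index =
          ((WW.indexFunctorIn A hpair hW).map w').index))
  · rfl
  · intro a Y X w
    constructor
    · change WW.sh (w ≫ WW.unitAction a X) = WW.sh w
      rw [WW.sh_comp, WW.sh_unitAction a (Subsingleton.elim _ _), Category.comp_id]
    · refine Subtype.ext ?_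
      change WW.index (w ≫ WW.unitAction a X) = WW.index a + WW.index w
      rw [WW.index_comp, WW.sh_unitAction a (Subsingleton.elim _ _), pairIndex_id_left,
        add_zero]
      exact congrArg (· + WW.index w) (WW.index_unitAction htensor a X)

end DoublyIndexed

/-! ### Stabilization of relations by a plane -/

section Transpose

variable {K : Type u} [Field K]
variable {X Y Z : Type u} [AddCommGroup X] [Module K X] [AddCommGroup Y] [Module K Y]
  [AddCommGroup Z] [Module K Z]

@[simp]
theorem mk_zero_zero_mem {V W : Type*} [AddCommGroup V] [Module K V] [AddCommGroup W] [Module K W]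
    (f : Submodule K (V × W)) : ((0 : V), (0 : W)) ∈ f := f.zero_mem

theorem transposeRel_compRel (f : Submodule K (X × Y)) (g : Submodule K (Y × Z)) :
    transposeRel (compRel f g) = compRel (transposeRel g) (transposeRel f) := by
  ext ⟨z, x⟩
  exact ⟨fun ⟨y, h1, h2⟩ => ⟨y, h2, h1⟩, fun ⟨y, h1, h2⟩ => ⟨y, h2, h1⟩⟩

/-- Transposition exchanges domains with codomains. It turns every statement on projections into one
on inclusions. -/
theorem StronglyTransversal.transpose {f : Submodule K (X × Y)} {g : Submodule K (Y × Z)}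
    (h : StronglyTransversal f g) :
    StronglyTransversal (transposeRel g) (transposeRel f) := by
  refine ⟨fun z y y' x h1 h2 h3 h4 => h.1 x y y' z h3 h4 h1 h2, ?_⟩
  have h' := h.2
  rw [transversal_iff_sup] at h' ⊢
  have e1 : domRel (transposeRel g) = codRel g := by
    ext y
    rw [mem_domRel, mem_codRel]
    rfl
  have e2 : codRel (transposeRel f) = domRel f := by
    ext y
    rw [mem_domRel, mem_codRel]
    rfl
  rw [e1, e2, sup_comm, h']

theorem stronglyTransversal_of_forall {f : Submodule K (X × Y)} {g : Submodule K (Y × Z)}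
    (h1 : ∀ y, (0, y) ∈ f → (y, 0) ∈ g → y = 0)
    (h2 : ∀ y, ∃ a b x z, (x, a) ∈ f ∧ (b, z) ∈ g ∧ a + b = y) : StronglyTransversal f g := by
  refine ⟨(monic_iff _ _).2 ((Submodule.eq_bot_iff _).2 fun y h => h1 y h.1 h.2),
    (transversal_iff_sup _ _).2 (eq_top_iff.2 fun y _ => ?_)⟩
  obtain ⟨a, b, x, z, hf, hg, rfl⟩ := h2 y
  exact Submodule.add_mem_sup (mem_domRel.2 ⟨x, hf⟩) (mem_codRel.2 ⟨z, hg⟩)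

end Transpose

section Stabilize

variable {K : Type u} [Field K]
variable {X Y Z E E' : Type u} [AddCommGroup X] [Module K X] [AddCommGroup Y] [Module K Y]
  [AddCommGroup Z] [Module K Z] [AddCommGroup E] [Module K E] [AddCommGroup E'] [Module K E']

/-- The first coordinate axis of the plane. -/
def axis (K : Type u) [Field K] : Submodule K (K × K) := LinearMap.ker (LinearMap.snd K K K)

theorem mem_axis {s t : K} : (s, t) ∈ axis K ↔ t = 0 := Iff.rfl

/-- The relation `Y × T ← Y`. -/
def inclRel (τ : E ≃ₗ[K] Y × (K × K)) (T : Submodule K (K × K)) : Submodule K (E × Y) where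
  carrier := {p | (τ p.1).1 = p.2 ∧ (τ p.1).2 ∈ T}
  add_mem' := by
    rintro a b ⟨h1, h2⟩ ⟨h1', h2'⟩
    simp only [Set.mem_ofPred_eq, Prod.fst_add, Prod.snd_add, map_add]
    exact ⟨by rw [h1, h1'], T.add_mem h2 h2'⟩
  zero_mem' := by simp
  smul_mem' := by
    rintro c a ⟨h1, h2⟩
    simp only [Set.mem_ofPred_eq, Prod.smul_fst, Prod.smul_snd, map_smul]
    exact ⟨by rw [h1], T.smul_mem c h2⟩

/-- The relation `Y ← Y × T`. -/
def projRel (τ : E ≃ₗ[K] Y × (K × K)) (T : Submodule K (K × K)) : Submodule K (Y × E) :=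
  transposeRel (inclRel τ T)

/-- The product of a relation with the diagonal of the plane. -/
def extRel (τ : E ≃ₗ[K] X × (K × K)) (τ' : E' ≃ₗ[K] Y × (K × K)) (f : Submodule K (X × Y)) :
    Submodule K (E × E') where
  carrier := {p | (τ p.1).2 = (τ' p.2).2 ∧ ((τ p.1).1, (τ' p.2).1) ∈ f}
  add_mem' := by
    rintro a b ⟨h1, h2⟩ ⟨h1', h2'⟩
    simp only [Set.mem_ofPred_eq, Prod.fst_add, Prod.snd_add, map_add]
    exact ⟨by rw [h1, h1'], f.add_mem h2 h2'⟩
  zero_mem' := by simp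
  smul_mem' := by
    rintro c a ⟨h1, h2⟩
    simp only [Set.mem_ofPred_eq, Prod.smul_fst, Prod.smul_snd, map_smul]
    exact ⟨by rw [h1], f.smul_mem c h2⟩

/-- The relation on `Y × K²` that exchanges the axis and `S`. -/
def swapRel (τ : E ≃ₗ[K] Y × (K × K)) (S : Submodule K (K × K)) : Submodule K (E × E) where
  carrier := {p | (τ p.1).1 = (τ p.2).1 ∧ (τ p.1).2.1 = (τ p.2).2.1 ∧
    ((τ p.1).2.1, (τ p.1).2.2 - (τ p.2).2.2) ∈ S}
  add_mem' := by
    rintro a b ⟨h1, h2, h3⟩ ⟨h1', h2', h3'⟩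
    simp only [Set.mem_ofPred_eq, Prod.fst_add, Prod.snd_add, map_add]
    refine ⟨by rw [h1, h1'], by rw [h2, h2'], ?_⟩
    rw [add_sub_add_comm]
    exact S.add_mem h3 h3'
  zero_mem' := by simp
  smul_mem' := by
    rintro c a ⟨h1, h2, h3⟩
    simp only [Set.mem_ofPred_eq, Prod.smul_fst, Prod.smul_snd, map_smul]
    refine ⟨by rw [h1], by rw [h2], ?_⟩
    rw [← smul_sub]
    exact S.smul_mem c h3

/-- The sheared relation `Y ← Y × S`, which consists of all `(y + s w, (y, (s, t + l y)))` with
`(s, t) ∈ S`. -/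
def shearRel (τ : E ≃ₗ[K] Y × (K × K)) (S : Submodule K (K × K)) (w : Y) (l : Module.Dual K Y) :
    Submodule K (Y × E) where
  carrier := {p | p.1 = (τ p.2).1 + (τ p.2).2.1 • w ∧
    ((τ p.2).2.1, (τ p.2).2.2 - l (τ p.2).1) ∈ S}
  add_mem' := by
    rintro a b ⟨h1, h2⟩ ⟨h1', h2'⟩
    simp only [Set.mem_ofPred_eq, Prod.fst_add, Prod.snd_add, map_add]
    refine ⟨by rw [h1, h1', add_smul, add_add_add_comm], ?_⟩
    rw [add_sub_add_comm]
    exact S.add_mem h2 h2'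
  zero_mem' := by simp
  smul_mem' := by
    rintro c a ⟨h1, h2⟩
    simp only [Set.mem_ofPred_eq, Prod.smul_fst, Prod.smul_snd, map_smul]
    refine ⟨by rw [h1, smul_add, smul_assoc], ?_⟩
    rw [← smul_sub]
    exact S.smul_mem c h2

/-- The relation of all `(y + s w, y)` with `(s, -l y) ∈ S`. -/
def stepRel (S : Submodule K (K × K)) (w : Y) (l : Module.Dual K Y) : Submodule K (Y × Y) where
  carrier := {p | ∃ s : K, p.1 = p.2 + s • w ∧ (s, -l p.2) ∈ S}
  add_mem' := by
    rintro a b ⟨s, h1, h2⟩ ⟨s', h1', h2'⟩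
    refine ⟨s + s', ?_, ?_⟩
    · rw [Prod.fst_add, Prod.snd_add, h1, h1', add_smul, add_add_add_comm]
    · rw [Prod.snd_add, map_add, neg_add]
      exact S.add_mem h2 h2'
  zero_mem' := ⟨0, by simp⟩
  smul_mem' := by
    rintro c a ⟨s, h1, h2⟩
    refine ⟨c • s, ?_, ?_⟩
    · rw [Prod.smul_fst, Prod.smul_snd, h1, smul_add, smul_assoc]
    · rw [Prod.smul_snd, map_smul, ← smul_neg]
      exact S.smul_mem c h2

variable (τ : E ≃ₗ[K] Y × (K × K)) (τ' : E' ≃ₗ[K] X × (K × K)) (S T : Submodule K (K × K))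

theorem mem_projRel {y : Y} {t : E} : (y, t) ∈ projRel τ T ↔ (τ t).1 = y ∧ (τ t).2 ∈ T := Iff.rfl

theorem mem_inclRel {y : Y} {t : E} : (t, y) ∈ inclRel τ T ↔ (τ t).1 = y ∧ (τ t).2 ∈ T := Iff.rfl

/-- A projection is onto Y and single-valued, so it is strongly transversal to any relation applied
after it. -/
theorem stronglyTransversal_projRel (f : Submodule K (X × Y)) :
    StronglyTransversal f (projRel τ T) := by
  refine stronglyTransversal_of_forall ?_ fun y => ⟨0, y, 0, τ.symm (y, 0), f.zero_mem, ?_, ?_⟩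
  · rintro y - ⟨h, -⟩
    simpa using h.symm
  · simp [mem_projRel]
  · simp

/-- The projection supplies the X-coordinate of a point of E' and the diagonal of the plane supplies
the other two. With the next identity this moves f past a projection, one half of the naturality of
the shifts. -/
theorem stronglyTransversal_projRel_extRel (f : Submodule K (X × Y)) :
    StronglyTransversal (projRel τ' T) (extRel τ' τ f) := by
  refine stronglyTransversal_of_forall ?_ fun t =>
    ⟨τ'.symm ((τ' t).1, 0), τ'.symm (0, (τ' t).2), (τ' t).1, τ.symm (0, (τ' t).2), ?_, ?_, ?_⟩
  · rintro t ⟨h1, -⟩ ⟨h2, -⟩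
    refine τ'.injective (Prod.ext ?_ ?_)
    · rw [h1, map_zero]; rfl
    · rw [h2]; simp
  · simp [mem_projRel]
  · exact ⟨by simp, by simp⟩
  · rw [← map_add]; simp

theorem compRel_projRel_extRel (f : Submodule K (X × Y)) :
    compRel (projRel τ' T) (extRel τ' τ f) = compRel f (projRel τ T) := by
  ext ⟨x, t⟩
  constructor
  · rintro ⟨t', ⟨h1, h2⟩, h3, h4⟩
    have h1 : (τ' t').1 = x := h1
    have h3 : (τ' t').2 = (τ t).2 := h3
    refine ⟨(τ t).1, ?_, rfl, ?_⟩
    · rw [← h1]; exact h4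
    · rw [← h3]; exact h2
  · rintro ⟨y, h1, h2, h3⟩
    have h2 : (τ t).1 = y := h2
    subst h2
    refine ⟨τ'.symm (x, (τ t).2), ⟨by simp, by simpa using h3⟩, by simp, by simpa using h1⟩

theorem transposeRel_extRel (f : Submodule K (X × Y)) :
    transposeRel (extRel τ' τ f) = extRel τ τ' (transposeRel f) := by
  ext ⟨t, t'⟩
  exact ⟨fun ⟨h1, h2⟩ => ⟨h1.symm, h2⟩, fun ⟨h1, h2⟩ => ⟨h1.symm, h2⟩⟩

theorem stronglyTransversal_inclRel (f : Submodule K (Y × X)) :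
    StronglyTransversal (inclRel τ T) f :=
  (stronglyTransversal_projRel τ T (transposeRel f)).transpose

theorem stronglyTransversal_extRel_inclRel (f : Submodule K (X × Y)) :
    StronglyTransversal (extRel τ' τ f) (inclRel τ T) := by
  have h := (stronglyTransversal_projRel_extRel τ' τ T (transposeRel f)).transpose
  rwa [transposeRel_extRel] at h

theorem compRel_extRel_inclRel (f : Submodule K (X × Y)) :
    compRel (extRel τ' τ f) (inclRel τ T) = compRel (inclRel τ' T) f := by
  have h := congrArg transposeRel (compRel_projRel_extRel τ' τ T (transposeRel f))
  rw [transposeRel_compRel, transposeRel_compRel, transposeRel_extRel] at h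
  exact h

theorem compRel_projRel_inclRel (S T : Submodule K (K × K)) :
    compRel (projRel τ S) (inclRel τ T) = idRel K Y := by
  ext ⟨y, y'⟩
  constructor
  · rintro ⟨t, ⟨h1, -⟩, h2, -⟩
    exact h1.symm.trans h2
  · intro h
    have h : y = y' := h
    subst h
    exact ⟨τ.symm (y, 0), by simp [mem_projRel], by simp [mem_inclRel]⟩

/-- Domain and codomain both project onto Y, and kernel elements have Y-coordinate 0. Along K² → E →
Y only the subspaces S and T of the plane are left. -/
theorem pairIndex_projRel_inclRel [FiniteDimensional K Y] [FiniteDimensional K E]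
    (S T : Submodule K (K × K)) :
    pairIndex (projRel τ S) (inclRel τ T) =
      (Module.finrank K ((K × K) ⧸ (S ⊔ T)), Module.finrank K (S ⊓ T : Submodule K (K × K))) := by
  let ι : K × K →ₗ[K] E := τ.symm.toLinearMap ∘ₗ LinearMap.inr K Y (K × K)
  let π : E →ₗ[K] Y := LinearMap.fst K Y (K × K) ∘ₗ τ.toLinearMap
  have hι : Function.Injective ι := τ.symm.injective.comp LinearMap.inr_injective
  have hπ : Function.Surjective π :=
    (LinearMap.fst_surjective (R := K) (M := Y) (M₂ := K × K)).comp τ.surjective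
  have hex : LinearMap.range ι = LinearMap.ker π := by
    ext t
    constructor
    · rintro ⟨v, rfl⟩
      simp [ι, π]
    · intro h
      refine ⟨(τ t).2, τ.injective ?_⟩
      have h : (τ t).1 = 0 := h
      simp only [ι, LinearMap.comp_apply, LinearEquiv.coe_coe, LinearEquiv.apply_symm_apply,
        LinearMap.inr_apply]
      rw [← h]
  refine Prod.ext ?_ ?_
  · have h := finrank_quotient_map_add_finrank_quotient_comap ι π hι hπ hex
      (domRel (projRel τ S) ⊔ codRel (inclRel τ T))
    have e1 : (domRel (projRel τ S) ⊔ codRel (inclRel τ T)).map π = ⊤ := by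
      rw [eq_top_iff]
      intro y _
      refine ⟨τ.symm (y, 0), Submodule.mem_sup_left (mem_domRel.2 ⟨y, ?_⟩), by simp [π]⟩
      simp [mem_projRel]
    have e2 : (domRel (projRel τ S) ⊔ codRel (inclRel τ T)).comap ι = S ⊔ T := by
      ext v
      rw [Submodule.mem_comap, Submodule.mem_sup, Submodule.mem_sup]
      constructor
      · rintro ⟨a, ha, b, hb, e⟩
        obtain ⟨x, -, ha⟩ := mem_domRel.1 ha
        obtain ⟨z, -, hb⟩ := mem_codRel.1 hb
        refine ⟨_, ha, _, hb, ?_⟩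
        have e' := congrArg (fun q => (τ q).2) e
        simpa [ι] using e'
      · rintro ⟨a, ha, b, hb, rfl⟩
        refine ⟨ι a, mem_domRel.2 ⟨0, ?_⟩, ι b, mem_codRel.2 ⟨0, ?_⟩, (map_add ι a b).symm⟩
        · simpa [ι, mem_projRel] using ha
        · simpa [ι, mem_inclRel] using hb
    have e3 : Module.finrank K
        (Y ⧸ (domRel (projRel τ S) ⊔ codRel (inclRel τ T)).map π) = 0 := by
      rw [Module.finrank_zero_iff, Submodule.Quotient.subsingleton_iff]
      exact e1
    rw [e3, e2, zero_add] at h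
    exact h.symm
  · have e : kerRel (projRel τ S) ⊓ indetRel (inclRel τ T) = (S ⊓ T).map ι := by
      ext t
      constructor
      · rintro ⟨⟨h1, h2⟩, -, h3⟩
        have h1 : (τ t).1 = 0 := h1
        refine ⟨(τ t).2, ⟨h2, h3⟩, τ.injective ?_⟩
        simp only [ι, LinearMap.comp_apply, LinearEquiv.coe_coe, LinearEquiv.apply_symm_apply,
          LinearMap.inr_apply]
        rw [← h1]
      · rintro ⟨v, ⟨h1, h2⟩, rfl⟩
        exact ⟨by simpa [ι, mem_kerRel, mem_projRel] using h1,
          by simpa [ι, mem_indetRel, mem_inclRel] using h2⟩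
    change Module.finrank K (kerRel (projRel τ S) ⊓ indetRel (inclRel τ T) : Submodule K E) = _
    rw [e]
    exact ((Submodule.equivMapOfInjective ι hι _).finrank_eq).symm

variable {S}

/-- The projection that removes the axis lacks only the second plane coordinate, and the codomain of
the swap contains that direction. On a common kernel element the projection kills all but the first
plane coordinate, and the swap kills this one. -/
theorem stronglyTransversal_projRel_swapRel :
    StronglyTransversal (projRel τ (axis K)) (swapRel τ S) := by
  refine stronglyTransversal_of_forall ?_ fun t =>
    ⟨τ.symm ((τ t).1, ((τ t).2.1, 0)), τ.symm (0, (0, (τ t).2.2)), (τ t).1,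
      τ.symm (0, (0, (τ t).2.2)), ?_, ?_, ?_⟩
  · rintro t ⟨h1, h1'⟩ ⟨-, h2, -⟩
    have h1' : (τ t).2.2 = 0 := h1'
    refine τ.injective (Prod.ext ?_ (Prod.ext ?_ ?_))
    · rw [h1, map_zero]; rfl
    · rw [h2, map_zero]
    · rw [h1']; simp
  · simp [mem_projRel, mem_axis]
  · exact ⟨by simp, by simp, by simp⟩
  · rw [← map_add]; simp

/-- On the axis the swap condition reads (s, 0 - t) ∈ S; the sign symmetry of S turns it into (s, t)
∈ S. -/
theorem compRel_projRel_swapRel (hS : ∀ s t, (s, t) ∈ S → (s, -t) ∈ S) :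
    compRel (projRel τ (axis K)) (swapRel τ S) = projRel τ S := by
  ext ⟨x, t⟩
  constructor
  · rintro ⟨t', ⟨h1, h1'⟩, h2, h3, h4⟩
    have h1 : (τ t').1 = x := h1
    have h1' : (τ t').2.2 = 0 := h1'
    have h2 : (τ t').1 = (τ t).1 := h2
    have h3 : (τ t').2.1 = (τ t).2.1 := h3
    have h4 : ((τ t').2.1, (τ t').2.2 - (τ t).2.2) ∈ S := h4
    refine ⟨h2.symm.trans h1, ?_⟩
    rw [h3, h1', zero_sub] at h4
    simpa using hS _ _ h4
  · rintro ⟨h1, h2⟩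
    have h1 : (τ t).1 = x := h1
    refine ⟨τ.symm (x, ((τ t).2.1, 0)), by simp [mem_projRel, mem_axis], ?_, ?_, ?_⟩
    · simp [h1]
    · simp
    · simpa using hS _ _ h2

theorem transposeRel_swapRel (hS : ∀ s t, (s, t) ∈ S → (s, -t) ∈ S) :
    transposeRel (swapRel τ S) = swapRel τ S := by
  have key : ∀ t t', (t, t') ∈ swapRel τ S → (t', t) ∈ swapRel τ S := by
    rintro t t' ⟨h1, h2, h3⟩
    have h2 : (τ t).2.1 = (τ t').2.1 := h2
    refine ⟨h1.symm, h2.symm, ?_⟩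
    have h4 := hS _ _ h3
    rw [neg_sub] at h4
    change ((τ t').2.1, (τ t').2.2 - (τ t).2.2) ∈ S
    rw [← h2]
    exact h4
  ext ⟨t, t'⟩
  exact ⟨fun h => key _ _ h, fun h => key _ _ h⟩

theorem stronglyTransversal_swapRel_inclRel (hS : ∀ s t, (s, t) ∈ S → (s, -t) ∈ S) :
    StronglyTransversal (swapRel τ S) (inclRel τ (axis K)) := by
  have h := (stronglyTransversal_projRel_swapRel τ (S := S)).transpose
  rwa [transposeRel_swapRel τ hS] at h

theorem compRel_swapRel_inclRel (hS : ∀ s t, (s, t) ∈ S → (s, -t) ∈ S) :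
    compRel (swapRel τ S) (inclRel τ (axis K)) = inclRel τ S := by
  have h := congrArg transposeRel (compRel_projRel_swapRel τ hS)
  rw [transposeRel_compRel, transposeRel_swapRel τ hS] at h
  exact h

variable {w : Y} {l : Module.Dual K Y}

/-- Like the projection, its sheared version is single-valued and onto: y is the image of (y, (0, l
y)), whose second plane coordinate becomes 0 when l y is subtracted. -/
theorem stronglyTransversal_shearRel (f : Submodule K (X × Y)) :
    StronglyTransversal f (shearRel τ S w l) := by
  refine stronglyTransversal_of_forall ?_ fun y =>
    ⟨0, y, 0, τ.symm (y, (0, l y)), f.zero_mem, ?_, ?_⟩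
  · rintro y - ⟨h, -⟩
    simpa using h
  · exact ⟨by simp, by simp⟩
  · simp

/-- The relation `f` does not distinguish the sheared projection from the projection. -/
def ShearInvariant (S : Submodule K (K × K)) (w : Y) (l : Module.Dual K Y)
    (f : Submodule K (X × Y)) : Prop :=
  ∀ x y s t, (x, y + s • w) ∈ f ∧ (s, t - l y) ∈ S ↔ (x, y) ∈ f ∧ (s, t) ∈ S

theorem ShearInvariant.compRel_shearRel {f : Submodule K (X × Y)} (h : ShearInvariant S w l f) :
    compRel f (shearRel τ S w l) = compRel f (projRel τ S) := by
  ext ⟨x, t⟩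
  have h' := h x (τ t).1 (τ t).2.1 (τ t).2.2
  constructor
  · rintro ⟨y, h1, h2, h3⟩
    have h2 : y = (τ t).1 + (τ t).2.1 • w := h2
    subst h2
    obtain ⟨h4, h5⟩ := h'.1 ⟨h1, h3⟩
    exact ⟨_, h4, rfl, h5⟩
  · rintro ⟨y, h1, h2, h3⟩
    have h2 : (τ t).1 = y := h2
    subst h2
    obtain ⟨h4, h5⟩ := h'.2 ⟨h1, h3⟩
    exact ⟨_, h4, rfl, h5⟩

/-- The inclusion of the axis misses only the second plane coordinate, which `hT` finds in the
domain of the shear. A common kernel element is (0, (s, 0)) with s w = 0 and (s, 0) ∈ S, which `hM`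
excludes unless s = 0. -/
theorem stronglyTransversal_shearRel_inclRel (hT : ∀ t, ∃ y s, (s, t - l y) ∈ S)
    (hM : ∀ s : K, s • w = 0 → (s, (0 : K)) ∈ S → s = 0) :
    StronglyTransversal (shearRel τ S w l) (inclRel τ (axis K)) := by
  refine stronglyTransversal_of_forall ?_ fun t => ?_
  · rintro t ⟨h1, h2⟩ ⟨h3, h4⟩
    have h1 : 0 = (τ t).1 + (τ t).2.1 • w := h1
    have h2 : ((τ t).2.1, (τ t).2.2 - l (τ t).1) ∈ S := h2
    have h3 : (τ t).1 = 0 := h3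
    have h4 : (τ t).2.2 = 0 := h4
    rw [h3, zero_add] at h1
    rw [h3, h4, map_zero, sub_zero] at h2
    refine τ.injective (Prod.ext ?_ (Prod.ext ?_ ?_))
    · rw [h3]; simp
    · rw [hM _ h1.symm h2]; simp
    · rw [h4]; simp
  · obtain ⟨y, s, h⟩ := hT (τ t).2.2
    refine ⟨τ.symm (y, (s, (τ t).2.2)), τ.symm ((τ t).1 - y, ((τ t).2.1 - s, 0)), y + s • w,
      (τ t).1 - y, ⟨by simp, by simpa using h⟩, by simp [mem_inclRel, mem_axis], ?_⟩
    rw [← map_add]; simp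

theorem compRel_shearRel_inclRel :
    compRel (shearRel τ S w l) (inclRel τ (axis K)) = stepRel S w l := by
  ext ⟨y', y⟩
  constructor
  · rintro ⟨t, ⟨h1, h2⟩, h3, h4⟩
    have h2 : ((τ t).2.1, (τ t).2.2 - l (τ t).1) ∈ S := h2
    have h3 : (τ t).1 = y := h3
    have h4 : (τ t).2.2 = 0 := h4
    refine ⟨(τ t).2.1, ?_, ?_⟩
    · rw [← h3]; exact h1
    · rw [h4, h3, zero_sub] at h2
      exact h2
  · rintro ⟨s, h1, h2⟩
    exact ⟨τ.symm (y, (s, 0)), ⟨by simpa using h1, by simpa using h2⟩,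
      by simp [mem_inclRel, mem_axis]⟩

end Stabilize

/-! ### Splitting off relations of codimension or dimension one -/

section Steps

variable {K : Type u} [Field K]
variable {X Y Z : Type u} [AddCommGroup X] [Module K X] [AddCommGroup Y] [Module K Y]
  [AddCommGroup Z] [Module K Z]

/-- For S = 0 the coordinate s is 0 and w plays no role, so l need only vanish on dom f. For S = K²
the condition on l is void, and w ∈ ker f suffices. The axis needs both. -/
theorem shearInvariant_bot {f : Submodule K (X × Y)} (w : Y) {l : Module.Dual K Y}
    (hl : ∀ x y, (x, y) ∈ f → l y = 0) : ShearInvariant ⊥ w l f := by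
  intro x y s t
  simp only [Submodule.mem_bot, Prod.mk_eq_zero]
  constructor
  · rintro ⟨h, rfl, h'⟩
    rw [zero_smul, add_zero] at h
    rw [hl _ _ h, sub_zero] at h'
    exact ⟨h, rfl, h'⟩
  · rintro ⟨h, rfl, rfl⟩
    rw [zero_smul, add_zero, hl _ _ h, sub_zero]
    exact ⟨h, rfl, rfl⟩

theorem mem_add_smul_iff {f : Submodule K (X × Y)} {w : Y} (hw : (0, w) ∈ f) (x : X) (y : Y)
    (s : K) : (x, y + s • w) ∈ f ↔ (x, y) ∈ f := by
  have e : (x, y + s • w) = (x, y) + s • ((0 : X), w) := by simp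
  rw [e, Submodule.add_mem_iff_left _ (f.smul_mem s hw)]

theorem shearInvariant_top {f : Submodule K (X × Y)} {w : Y} (hw : (0, w) ∈ f)
    (l : Module.Dual K Y) : ShearInvariant ⊤ w l f := by
  intro x y s t
  rw [mem_add_smul_iff hw]
  simp

theorem shearInvariant_axis {f : Submodule K (X × Y)} {w : Y} (hw : (0, w) ∈ f)
    {l : Module.Dual K Y} (hl : ∀ x y, (x, y) ∈ f → l y = 0) : ShearInvariant (axis K) w l f := by
  intro x y s t
  rw [mem_add_smul_iff hw, mem_axis, mem_axis]
  constructor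
  · rintro ⟨h, h'⟩
    exact ⟨h, by rw [← h', hl _ _ h, sub_zero]⟩
  · rintro ⟨h, h'⟩
    exact ⟨h, by rw [h', hl _ _ h, sub_zero]⟩

theorem exists_smul_add_eq {l : Module.Dual K Y} {y₀ : Y} (h : l y₀ ≠ 0) (y : Y) :
    ∃ (a : Y) (c : K), l a = 0 ∧ a + c • y₀ = y := by
  refine ⟨y - (l y / l y₀) • y₀, l y / l y₀, ?_, sub_add_cancel _ _⟩
  rw [map_sub, map_smul, smul_eq_mul, div_mul_cancel₀ _ h, sub_self]

/-- For S = 0 the step is the diagonal of ker l. Adding p to g makes the codomain transversal to ker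
l, and restriction to ker l removes p again. -/
theorem stepRel_bot_comp {g : Submodule K (Y × Z)} (w : Y) {l : Module.Dual K Y}
    (hl : ∀ y z, (y, z) ∈ g → l y = 0) {p : Y × Z} (hp : l p.1 ≠ 0) :
    StronglyTransversal (stepRel ⊥ w l) (g ⊔ Submodule.span K {p}) ∧
      compRel (stepRel ⊥ w l) (g ⊔ Submodule.span K {p}) = g := by
  constructor
  · refine stronglyTransversal_of_forall ?_ fun y => ?_
    · rintro y ⟨s, h1, h2⟩ -
      obtain ⟨rfl, -⟩ := Prod.mk_eq_zero.1 h2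
      simpa using h1.symm
    · obtain ⟨a, c, ha, rfl⟩ := exists_smul_add_eq hp y
      refine ⟨a, c • p.1, a, c • p.2, ⟨0, by simp, by simp [ha]⟩, ?_, rfl⟩
      exact Submodule.mem_sup_right (Submodule.smul_mem _ c (Submodule.mem_span_singleton_self p))
  · ext ⟨y', z⟩
    constructor
    · rintro ⟨y, ⟨s, h1, h2⟩, h3⟩
      obtain ⟨rfl, h4⟩ := Prod.mk_eq_zero.1 h2
      have h1 : y' = y + (0 : K) • w := h1
      have h2 : -l y = 0 := h4
      rw [zero_smul, add_zero] at h1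
      subst h1
      obtain ⟨q, hq, r, hr, e⟩ := Submodule.mem_sup.1 h3
      obtain ⟨c, rfl⟩ := Submodule.mem_span_singleton.1 hr
      have e1 : q.1 + c • p.1 = y' := congrArg Prod.fst e
      have hc : c * l p.1 = 0 := by
        rw [← e1, map_add, hl q.1 q.2 hq, zero_add, map_smul, neg_eq_zero] at h2
        exact h2
      rw [(mul_eq_zero.1 hc).resolve_right hp, zero_smul, add_zero] at e
      exact e ▸ hq
    · intro h
      refine ⟨y', ⟨0, by simp, by simp [hl _ _ h]⟩, Submodule.mem_sup_left h⟩

/-- For S = K² the step adds arbitrary multiples of w. Cutting g by ψ leaves a complement of the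
line of (w, 0) in g, and the step restores this line. -/
theorem stepRel_top_comp {g : Submodule K (Y × Z)} {w : Y} (l : Module.Dual K Y)
    (hw : (w, 0) ∈ g) {ψ : Module.Dual K (Y × Z)} (hψ : ψ (w, 0) ≠ 0) :
    StronglyTransversal (stepRel ⊤ w l) (g ⊓ LinearMap.ker ψ) ∧
      compRel (stepRel ⊤ w l) (g ⊓ LinearMap.ker ψ) = g := by
  constructor
  · refine stronglyTransversal_of_forall ?_ fun y =>
      ⟨y, 0, y, 0, ⟨0, by simp, trivial⟩, Submodule.zero_mem _, add_zero y⟩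
    rintro y ⟨s, h1, -⟩ ⟨-, h2⟩
    have h1 : 0 = y + s • w := h1
    have e : y = (-s) • w := by rw [neg_smul]; exact eq_neg_of_add_eq_zero_left h1.symm
    have h2 : ψ (y, 0) = 0 := h2
    have e' : ((y, 0) : Y × Z) = (-s) • (w, 0) := by rw [e]; simp
    rw [e', map_smul, smul_eq_mul] at h2
    rw [e, (mul_eq_zero.1 h2).resolve_right hψ, zero_smul]
  · ext ⟨y', z⟩
    constructor
    · rintro ⟨y, ⟨s, h1, -⟩, h2, -⟩
      have h1 : y' = y + s • w := h1
      have e : (y', z) = (y, z) + s • ((w, 0) : Y × Z) := by simp [h1]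
      rw [e]
      exact g.add_mem h2 (g.smul_mem s hw)
    · intro h
      obtain ⟨a, c, ha, e⟩ := exists_smul_add_eq hψ (y', z)
      have e1 : a.1 + c • w = y' := congrArg Prod.fst e
      have e2 : a.2 + c • (0 : Z) = z := congrArg Prod.snd e
      rw [smul_zero, add_zero] at e2
      refine ⟨a.1, ⟨c, e1.symm, trivial⟩, ?_⟩
      rw [← e2]
      refine ⟨?_, ha⟩
      rw [← e, Submodule.add_mem_iff_left _ (g.smul_mem c hw)] at h
      exact h

/-- The two preceding modifications at once: the step restricts to ker l and adds multiples of w.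
They do not interfere because ψ p = 0 keeps the modified relation inside ker ψ, and l w = 0. -/
theorem stepRel_axis_comp {g : Submodule K (Y × Z)} {w : Y} {l : Module.Dual K Y}
    (hw : (w, 0) ∈ g) (hl : ∀ y z, (y, z) ∈ g → l y = 0)
    {ψ : Module.Dual K (Y × Z)} (hψ : ψ (w, 0) ≠ 0) {p : Y × Z} (hp : l p.1 ≠ 0)
    (hψp : ψ p = 0) :
    StronglyTransversal (stepRel (axis K) w l) (g ⊓ LinearMap.ker ψ ⊔ Submodule.span K {p}) ∧
      compRel (stepRel (axis K) w l) (g ⊓ LinearMap.ker ψ ⊔ Submodule.span K {p}) = g := by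
  have hlw : l w = 0 := hl _ _ hw
  have hker : g ⊓ LinearMap.ker ψ ⊔ Submodule.span K {p} ≤ LinearMap.ker ψ :=
    sup_le inf_le_right ((Submodule.span_singleton_le_iff_mem _ _).2 hψp)
  constructor
  · refine stronglyTransversal_of_forall ?_ fun y => ?_
    · rintro y ⟨s, h1, -⟩ h2
      have h1 : 0 = y + s • w := h1
      have e : y = (-s) • w := by rw [neg_smul]; exact eq_neg_of_add_eq_zero_left h1.symm
      have h2 : ψ (y, 0) = 0 := hker h2
      have e' : ((y, 0) : Y × Z) = (-s) • (w, 0) := by rw [e]; simp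
      rw [e', map_smul, smul_eq_mul] at h2
      rw [e, (mul_eq_zero.1 h2).resolve_right hψ, zero_smul]
    · obtain ⟨a, c, ha, rfl⟩ := exists_smul_add_eq hp y
      refine ⟨a, c • p.1, a, c • p.2, ⟨0, by simp, by simp [ha]⟩, ?_, rfl⟩
      exact Submodule.mem_sup_right (Submodule.smul_mem _ c (Submodule.mem_span_singleton_self p))
  · ext ⟨y', z⟩
    constructor
    · rintro ⟨y, ⟨s, h1, h2⟩, h3⟩
      have h1 : y' = y + s • w := h1
      have h2 : -l y = 0 := h2
      obtain ⟨q, hq, r, hr, e⟩ := Submodule.mem_sup.1 h3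
      obtain ⟨c, rfl⟩ := Submodule.mem_span_singleton.1 hr
      have e1 : q.1 + c • p.1 = y := congrArg Prod.fst e
      have hc : c * l p.1 = 0 := by
        rw [← e1, map_add, hl q.1 q.2 hq.1, zero_add, map_smul, neg_eq_zero] at h2
        exact h2
      rw [(mul_eq_zero.1 hc).resolve_right hp, zero_smul, add_zero] at e
      have e' : (y', z) = q + s • ((w, 0) : Y × Z) := by rw [e]; simp [h1]
      rw [e']
      exact g.add_mem hq.1 (g.smul_mem s hw)
    · intro h
      obtain ⟨a, c, ha, e⟩ := exists_smul_add_eq hψ (y', z)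
      have e1 : a.1 + c • w = y' := congrArg Prod.fst e
      have e2 : a.2 + c • (0 : Z) = z := congrArg Prod.snd e
      rw [smul_zero, add_zero] at e2
      have hla : l a.1 = 0 := by
        have h' := hl _ _ h
        rwa [← e1, map_add, map_smul, hlw, smul_zero, add_zero] at h'
      refine ⟨a.1, ⟨c, e1.symm, by simp [mem_axis, hla]⟩, Submodule.mem_sup_left ?_⟩
      rw [← e2]
      refine ⟨?_, ha⟩
      rw [← e, Submodule.add_mem_iff_left _ (g.smul_mem c hw)] at h
      exact h

end Steps

/-! ### Stabilization of a category of relations -/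

section Stabilization

variable {K : Type u} [Field K] {C : Type (u + 1)} [Category.{u} C] [RelCategory K C]

/-- A relation that underlies an arrow of `C`. -/
def IsHomRel {Y X : C} (f : Submodule K (Carrier X × Carrier Y)) : Prop :=
  ∃ φ : Y ⟶ X, homRel φ = f

/-- The relations of `C` that are needed for the stabilization by a plane and its subspace `S`. -/
structure Stabilization (C : Type (u + 1)) [Category.{u} C] [RelCategory K C]
    (S : Submodule K (K × K)) where
  homRel_injective : ∀ {Y X : C}, Function.Injective (homRel (Y := Y) (X := X))
  neg_mem : ∀ s t, (s, t) ∈ S → (s, -t) ∈ S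
  ext : C → C
  equiv : ∀ X : C, Carrier (ext X) ≃ₗ[K] Carrier X × (K × K)
  incl_axis : ∀ X, IsHomRel (inclRel (equiv X) (axis K))
  incl : ∀ X, IsHomRel (inclRel (equiv X) S)
  proj_axis : ∀ X, IsHomRel (projRel (equiv X) (axis K))
  proj : ∀ X, IsHomRel (projRel (equiv X) S)
  swap : ∀ X, IsHomRel (swapRel (equiv X) S)
  extend : ∀ {Y X : C} (f : Y ⟶ X), IsHomRel (extRel (equiv X) (equiv Y) (homRel f))

namespace Stabilization

variable {S : Submodule K (K × K)}

/-- An arrow is determined by its relation, so every identity of strongly transversal compositions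
of relations becomes one in `WW C`. -/
theorem single_comp_single (σ : Stabilization C S) {X Y Z : C} {g : Z ⟶ Y} {f : Y ⟶ X} {h : Z ⟶ X}
    (hst : StronglyTransversal (homRel f) (homRel g))
    (he : compRel (homRel f) (homRel g) = homRel h) :
    WW.single g ≫ WW.single f = WW.single h := by
  rw [WW.single_comp g f hst]
  exact congrArg WW.single (σ.homRel_injective ((homRel_comp g f).trans he))

/-- The change of the index by a stabilization. -/
noncomputable def stabilizationIndex (S : Submodule K (K × K)) : ℕ × ℕ :=
  (Module.finrank K ((K × K) ⧸ (S ⊔ axis K)), Module.finrank K (S ⊓ axis K : Submodule K (K × K)))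

variable (σ : Stabilization C S)

/-- The arrow `X ⟶ ext X` that adds the axis. -/
noncomputable def inclAxis (X : C) : X ⟶ σ.ext X := (σ.incl_axis X).choose

theorem homRel_inclAxis (X : C) : homRel (σ.inclAxis X) = inclRel (σ.equiv X) (axis K) :=
  (σ.incl_axis X).choose_spec

/-- The arrow `ext X ⟶ X` that removes `S`. -/
noncomputable def projHom (X : C) : σ.ext X ⟶ X := (σ.proj X).choose

theorem homRel_projHom (X : C) : homRel (σ.projHom X) = projRel (σ.equiv X) S :=
  (σ.proj X).choose_spec

theorem single_projHom_comp {X Y : C} (f : Y ⟶ X) :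
    WW.single (σ.projHom Y) ≫ WW.single f = WW.single (σ.projHom Y ≫ f) := by
  refine σ.single_comp_single ?_ (homRel_comp _ _).symm
  rw [homRel_projHom]
  exact stronglyTransversal_projRel _ _ _

theorem single_comp_inclAxis {X Y : C} (f : Y ⟶ X) :
    WW.single f ≫ WW.single (σ.inclAxis X) = WW.single (f ≫ σ.inclAxis X) := by
  refine σ.single_comp_single ?_ (homRel_comp _ _).symm
  rw [homRel_inclAxis]
  exact stronglyTransversal_inclRel _ _ _

/-- The shift `X ⟵ X × S ⟵ X × K² ⟵ X × axis ⟵ X`. -/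
noncomputable def shift : WW.Shift C (stabilizationIndex S) where
  app X := WW.single (σ.inclAxis X) ≫ WW.single (σ.projHom X)
  naturality_single {Y X} f := by
    -- The arrow k = f × Δ carries f across the plane: it exchanges with the projection by h1 and
    -- with the inclusion by h2.
    obtain ⟨k, hk⟩ := σ.extend f
    have h1 : WW.single k ≫ WW.single (σ.projHom X) = WW.single (σ.projHom Y ≫ f) := by
      refine σ.single_comp_single ?_ ?_
      · rw [homRel_projHom, hk]
        exact stronglyTransversal_projRel_extRel _ _ _ _
      · rw [homRel_projHom, hk, homRel_comp, homRel_projHom]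
        exact compRel_projRel_extRel _ _ _ _
    have h2 : WW.single (σ.inclAxis Y) ≫ WW.single k = WW.single (f ≫ σ.inclAxis X) := by
      refine σ.single_comp_single ?_ ?_
      · rw [homRel_inclAxis, hk]
        exact stronglyTransversal_extRel_inclRel _ _ _ _
      · rw [homRel_inclAxis, hk, homRel_comp, homRel_inclAxis]
        exact compRel_extRel_inclRel _ _ _ _
    rw [Category.assoc, single_projHom_comp, ← h1, ← Category.assoc, h2, ← single_comp_inclAxis,
      Category.assoc]
  shadow X := by
    rw [WW.sh_comp, WW.sh_single, WW.sh_single]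
    refine σ.homRel_injective ?_
    rw [homRel_comp, homRel_id, homRel_inclAxis, homRel_projHom]
    exact compRel_projRel_inclRel _ _ _
  index X := by
    rw [WW.index_comp, WW.index_single, WW.index_single, WW.sh_single, WW.sh_single, add_zero,
      zero_add, homRel_inclAxis, homRel_projHom, pairIndex_projRel_inclRel]
    rfl

/-- Adding S and removing the axis is the same as adding the axis and removing S: both are adding
the axis, swapping and removing the axis. This makes the shift available to transposed arguments, in
which the two subspaces trade places. -/
theorem shift_app_eq {X : C} {i : X ⟶ σ.ext X} {q : σ.ext X ⟶ X}
    (hi : homRel i = inclRel (σ.equiv X) S) (hq : homRel q = projRel (σ.equiv X) (axis K)) :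
    WW.single i ≫ WW.single q = σ.shift.app X := by
  obtain ⟨r, hr⟩ := σ.swap X
  have h1 : WW.single (σ.inclAxis X) ≫ WW.single r = WW.single i := by
    refine σ.single_comp_single ?_ ?_
    · rw [hr, homRel_inclAxis]
      exact stronglyTransversal_swapRel_inclRel _ σ.neg_mem
    · rw [hr, homRel_inclAxis, hi]
      exact compRel_swapRel_inclRel _ σ.neg_mem
  have h2 : WW.single r ≫ WW.single q = WW.single (σ.projHom X) := by
    refine σ.single_comp_single ?_ ?_
    · rw [hr, hq]
      exact stronglyTransversal_projRel_swapRel _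
    · rw [hr, hq, homRel_projHom]
      exact compRel_projRel_swapRel _ σ.neg_mem
  rw [← h1, Category.assoc, h2]
  rfl

variable {X Y Z : C} {w : Carrier Y} {l : Module.Dual K (Carrier Y)}

/-- The step N is the shear after the inclusion of the axis. As f cannot tell the shear from the
projection that removes S, [f][N] equals [f] with the shift in front, and naturality moves the shift
behind f. -/
theorem exists_step_left (hshear : IsHomRel (shearRel (σ.equiv Y) S w l))
    (hT : ∀ t, ∃ y s, (s, t - l y) ∈ S) (hM : ∀ s : K, s • w = 0 → (s, (0 : K)) ∈ S → s = 0)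
    {f : Y ⟶ X} (hf : ShearInvariant S w l (homRel f)) :
    ∃ N : Y ⟶ Y, homRel N = stepRel S w l ∧
      WW.single N ≫ WW.single f = WW.single f ≫ σ.shift.app X := by
  obtain ⟨h, hh⟩ := hshear
  have hN : homRel (σ.inclAxis Y ≫ h) = stepRel S w l := by
    rw [homRel_comp, homRel_inclAxis, hh]
    exact compRel_shearRel_inclRel _
  refine ⟨σ.inclAxis Y ≫ h, hN, ?_⟩
  have h1 : WW.single (σ.inclAxis Y) ≫ WW.single h = WW.single (σ.inclAxis Y ≫ h) := by
    refine σ.single_comp_single ?_ (homRel_comp _ _).symm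
    rw [hh, homRel_inclAxis]
    exact stronglyTransversal_shearRel_inclRel _ hT hM
  have h2 : WW.single h ≫ WW.single f = WW.single (σ.projHom Y ≫ f) := by
    refine σ.single_comp_single ?_ ?_
    · rw [hh]
      exact stronglyTransversal_shearRel _ _
    · rw [hh, homRel_comp, homRel_projHom]
      exact hf.compRel_shearRel _
  rw [← h1, Category.assoc, h2, ← single_projHom_comp, ← σ.shift.naturality_single,
    ← Category.assoc]
  rfl

/-- The transposed argument produces the path that adds S and removes the axis; by `shift_app_eq`
this is the same shift. -/
theorem exists_step_right (hshear : IsHomRel (transposeRel (shearRel (σ.equiv Y) S w l)))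
    (hT : ∀ t, ∃ y s, (s, t - l y) ∈ S) (hM : ∀ s : K, s • w = 0 → (s, (0 : K)) ∈ S → s = 0)
    {g : Z ⟶ Y} (hg : ShearInvariant S w l (transposeRel (homRel g))) :
    ∃ N : Y ⟶ Y, homRel N = transposeRel (stepRel S w l) ∧
      WW.single g ≫ WW.single N = WW.single g ≫ σ.shift.app Y := by
  obtain ⟨h, hh⟩ := hshear
  obtain ⟨i, hi⟩ := σ.incl Y
  obtain ⟨q, hq⟩ := σ.proj_axis Y
  have hst := (stronglyTransversal_shearRel_inclRel (σ.equiv Y) hT hM).transpose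
  have hN : homRel (h ≫ q) = transposeRel (stepRel S w l) := by
    rw [homRel_comp, hq, hh, ← compRel_shearRel_inclRel (σ.equiv Y), transposeRel_compRel]
    rfl
  refine ⟨h ≫ q, hN, ?_⟩
  have h1 : WW.single h ≫ WW.single q = WW.single (h ≫ q) := by
    refine σ.single_comp_single ?_ (homRel_comp _ _).symm
    rw [hh, hq]
    exact hst
  have h2 : WW.single g ≫ WW.single h = WW.single (g ≫ i) := by
    refine σ.single_comp_single ?_ ?_
    · rw [hh]
      exact (stronglyTransversal_shearRel (σ.equiv Y) (transposeRel (homRel g))).transpose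
    · rw [hh, homRel_comp, hi]
      have e := congrArg transposeRel (hg.compRel_shearRel (σ.equiv Y))
      rw [transposeRel_compRel, transposeRel_compRel] at e
      exact e
  have h3 : WW.single g ≫ WW.single i = WW.single (g ≫ i) := by
    refine σ.single_comp_single ?_ (homRel_comp _ _).symm
    rw [hi]
    exact stronglyTransversal_inclRel _ _ _
  rw [← h1, ← Category.assoc, h2, ← h3, Category.assoc, shift_app_eq σ hi hq]

/-- Since g = N g' is strongly transversal, [f][g] = [f][N][g'], and [f][N] is [f] with the shift.
-/
theorem reduce_left (hshear : IsHomRel (shearRel (σ.equiv Y) S w l))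
    (hT : ∀ t, ∃ y s, (s, t - l y) ∈ S) (hM : ∀ s : K, s • w = 0 → (s, (0 : K)) ∈ S → s = 0)
    {f : Y ⟶ X} {g : Z ⟶ Y} (hf : ShearInvariant S w l (homRel f))
    {g' : Submodule K (Carrier Y × Carrier Z)} (hg' : IsHomRel g')
    (h : StronglyTransversal (stepRel S w l) g' ∧ compRel (stepRel S w l) g' = homRel g) :
    ∃ (f' : Y ⟶ X) (g' : Z ⟶ Y),
      WW.single g ≫ WW.single f = (WW.single g' ≫ WW.single f') ≫ σ.shift.app X := by
  obtain ⟨N, hN, hNf⟩ := σ.exists_step_left hshear hT hM hf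
  obtain ⟨γ, rfl⟩ := hg'
  refine ⟨f, γ, ?_⟩
  rw [Category.assoc, ← hNf, ← Category.assoc]
  congr 1
  rw [← hN] at h
  exact (σ.single_comp_single h.1 h.2).symm

theorem reduce_right (hshear : IsHomRel (transposeRel (shearRel (σ.equiv Y) S w l)))
    (hT : ∀ t, ∃ y s, (s, t - l y) ∈ S) (hM : ∀ s : K, s • w = 0 → (s, (0 : K)) ∈ S → s = 0)
    {f : Y ⟶ X} {g : Z ⟶ Y} (hg : ShearInvariant S w l (transposeRel (homRel g)))
    {f' : Submodule K (Carrier Y × Carrier X)} (hf' : IsHomRel (transposeRel f'))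
    (h : StronglyTransversal (stepRel S w l) f' ∧
      compRel (stepRel S w l) f' = transposeRel (homRel f)) :
    ∃ (f' : Y ⟶ X) (g' : Z ⟶ Y),
      WW.single g ≫ WW.single f = (WW.single g' ≫ WW.single f') ≫ σ.shift.app X := by
  obtain ⟨N, hN, hNg⟩ := σ.exists_step_right hshear hT hM hg
  obtain ⟨γ, hγ⟩ := hf'
  refine ⟨γ, g, ?_⟩
  have h1 : WW.single N ≫ WW.single γ = WW.single f := by
    refine σ.single_comp_single ?_ ?_
    · rw [hN, hγ]
      exact h.1.transpose
    · have e := congrArg transposeRel h.2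
      rw [transposeRel_compRel] at e
      rw [hN, hγ]
      exact e
  rw [← h1, ← Category.assoc, hNg, Category.assoc, Category.assoc, σ.shift.naturality_single]

end Stabilization

end Stabilization

/-! ### The three stabilizations -/

section Values

variable {K : Type u} [Field K]

theorem finrank_axis : Module.finrank K (axis K) = 1 := by
  have h : axis K = LinearMap.range (LinearMap.inl K K K) := (LinearMap.range_inl K K K).symm
  rw [h, LinearMap.finrank_range_of_inj LinearMap.inl_injective, Module.finrank_self]

theorem finrank_quotient_axis : Module.finrank K ((K × K) ⧸ axis K) = 1 := by
  rw [axis, (LinearMap.quotKerEquivOfSurjective _ LinearMap.snd_surjective).finrank_eq,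
    Module.finrank_self]

/-- The three values are the generators of A: (1,0) and (0,1) for LREL, (1,0) and (1,1) for ILREL,
(0,1) and (1,1) for CLREL. -/
theorem stabilizationIndex_bot :
    Stabilization.stabilizationIndex (⊥ : Submodule K (K × K)) = (1, 0) := by
  rw [Stabilization.stabilizationIndex, bot_sup_eq, bot_inf_eq, finrank_quotient_axis, finrank_bot]

theorem stabilizationIndex_axis : Stabilization.stabilizationIndex (axis K) = (1, 1) := by
  rw [Stabilization.stabilizationIndex, sup_idem, inf_idem, finrank_quotient_axis, finrank_axis]

theorem stabilizationIndex_top :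
    Stabilization.stabilizationIndex (⊤ : Submodule K (K × K)) = (0, 1) := by
  rw [Stabilization.stabilizationIndex, top_sup_eq, top_inf_eq, finrank_axis,
    Module.finrank_zero_iff.2 (Submodule.Quotient.subsingleton_iff.2 rfl)]

theorem neg_mem_axis (s t : K) (h : (s, t) ∈ axis K) : (s, -t) ∈ axis K := by
  rw [mem_axis] at *
  rw [h, neg_zero]

theorem neg_mem_bot (s t : K) (h : (s, t) ∈ (⊥ : Submodule K (K × K))) :
    (s, -t) ∈ (⊥ : Submodule K (K × K)) := by
  simpa using h

variable {Y : Type u} [AddCommGroup Y] [Module K Y]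

theorem exists_sub_mem {S : Submodule K (K × K)} {l : Module.Dual K Y} (hl : l ≠ 0) (t : K) :
    ∃ (y : Y) (s : K), (s, t - l y) ∈ S := by
  obtain ⟨y, rfl⟩ := LinearMap.surjective_of_ne_zero hl t
  exact ⟨y, 0, by simp⟩

theorem eq_zero_of_smul_eq_zero {S : Submodule K (K × K)} {w : Y} (hw : w ≠ 0) (s : K)
    (h : s • w = 0) (_ : (s, (0 : K)) ∈ S) : s = 0 :=
  (smul_eq_zero.1 h).resolve_right hw

theorem eq_zero_of_mem_bot {w : Y} (s : K) (_ : s • w = 0)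
    (h : (s, (0 : K)) ∈ (⊥ : Submodule K (K × K))) : s = 0 :=
  (Prod.mk_eq_zero.1 h).1

variable {X Z : Type u} [AddCommGroup X] [Module K X] [AddCommGroup Z] [Module K Z]

theorem exists_of_not_disjoint {f : Submodule K (X × Y)} {g : Submodule K (Y × Z)}
    (h : kerRel f ⊓ indetRel g ≠ ⊥) : ∃ w : Y, w ≠ 0 ∧ (0, w) ∈ f ∧ (w, 0) ∈ g := by
  obtain ⟨w, h1, h2⟩ := Submodule.exists_mem_ne_zero_of_ne_bot h
  exact ⟨w, h2, h1⟩

theorem exists_of_not_codisjoint {f : Submodule K (X × Y)} {g : Submodule K (Y × Z)}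
    (h : domRel f ⊔ codRel g ≠ ⊤) : ∃ l : Module.Dual K Y, l ≠ 0 ∧
      (∀ x y, (x, y) ∈ f → l y = 0) ∧ ∀ y z, (y, z) ∈ g → l y = 0 := by
  obtain ⟨l, h1, h2⟩ := Submodule.exists_le_ker_of_lt_top _ (lt_top_iff_ne_top.2 h)
  exact ⟨l, h1, fun x y hy => h2 (Submodule.mem_sup_left (mem_domRel.2 ⟨x, hy⟩)),
    fun y z hy => h2 (Submodule.mem_sup_right (mem_codRel.2 ⟨z, hy⟩))⟩

theorem ne_bot_or_ne_top_of_pairIndex_ne_zero [FiniteDimensional K Y] {f : Submodule K (X × Y)}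
    {g : Submodule K (Y × Z)} (h : pairIndex f g ≠ 0) :
    kerRel f ⊓ indetRel g ≠ ⊥ ∨ domRel f ⊔ codRel g ≠ ⊤ := by
  by_contra! h'
  exact h ((stronglyTransversal_iff_pairIndex f g).1
    ⟨(monic_iff _ _).2 h'.1, (transversal_iff_sup _ _).2 h'.2⟩)

end Values

/-! ### Linear relations -/

section LREL

variable {K : Type u} [Field K]

theorem LREL.isHomRel {Y X : LREL K} (f : Submodule K (X.carrier × Y.carrier)) :
    IsHomRel (C := LREL K) (Y := Y) (X := X) f := ⟨(⟨f⟩ : LinRel X Y), rfl⟩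

/-- The stabilization of `LREL` by a subspace of the plane. -/
def LREL.stabilization (S : Submodule K (K × K)) (hS : ∀ s t, (s, t) ∈ S → (s, -t) ∈ S) :
    Stabilization (LREL K) S where
  homRel_injective h := LinRel.ext h
  neg_mem := hS
  ext X := X.prod ⟨K × K⟩
  equiv _ := LinearEquiv.refl K _
  incl_axis _ := LREL.isHomRel _
  incl _ := LREL.isHomRel _
  proj_axis _ := LREL.isHomRel _
  proj _ := LREL.isHomRel _
  swap _ := LREL.isHomRel _
  extend _ := LREL.isHomRel _

/-- A common vector w of kernel and indeterminacy splits off the shift of index (0,1), without any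
functional. If there is no such vector, the functional l vanishing on dom f + cod g splits off the
one of index (1,0), without any vector. -/
theorem LREL.reducible : WW.Reducible
    (LREL.stabilization (K := K) ⊥ neg_mem_bot).shift
    (LREL.stabilization (K := K) ⊤ fun _ _ _ => trivial).shift := by
  intro X Y Z f g h
  rcases ne_bot_or_ne_top_of_pairIndex_ne_zero h with h | h
  · obtain ⟨w, hw, hf, hg⟩ := exists_of_not_disjoint h
    obtain ⟨ψ, hψ⟩ : ∃ ψ : Module.Dual K (Carrier Y), ψ w ≠ 0 := by
      by_contra! h'
      exact hw ((Module.forall_dual_apply_eq_zero_iff K w).1 h')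
    obtain ⟨f', g', e⟩ := (LREL.stabilization (K := K) ⊤ fun _ _ _ => trivial).reduce_left
      (w := w) (l := 0) (LREL.isHomRel _) (fun _ => ⟨0, 0, trivial⟩)
      (eq_zero_of_smul_eq_zero hw) (shearInvariant_top hf 0) (LREL.isHomRel _)
      (stepRel_top_comp 0 hg (ψ := ψ ∘ₗ LinearMap.fst K _ _) hψ)
    exact ⟨f', g', Or.inr e⟩
  · obtain ⟨l, hl, hf, hg⟩ := exists_of_not_codisjoint h
    obtain ⟨y, hy⟩ : ∃ y, l y ≠ 0 := by
      by_contra! h'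
      exact hl (LinearMap.ext h')
    obtain ⟨f', g', e⟩ := (LREL.stabilization (K := K) ⊥ neg_mem_bot).reduce_left
      (w := 0) (l := l) (LREL.isHomRel _) (exists_sub_mem hl)
      eq_zero_of_mem_bot (shearInvariant_bot 0 hf) (LREL.isHomRel _)
      (stepRel_bot_comp 0 hg (p := (y, 0)) hy)
    exact ⟨f', g', Or.inl e⟩

theorem LREL.isDoublyIndexed : IsDoublyIndexed (LREL K) ⊤ := by
  refine isDoublyIndexed_of_reducible ⊤ _ _ LREL.reducible ?_ ?_ ?_ ?_ ?_
  · rintro ⟨d, e⟩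
    rw [stabilizationIndex_bot, stabilizationIndex_top]
    exact ⟨fun _ => ⟨d, e, by simp⟩, fun _ => trivial⟩
  · intro m n m' n' h
    rw [stabilizationIndex_bot, stabilizationIndex_top] at h
    simpa using h
  · refine ⟨fun f g => LinRel.ext (Submodule.ext fun p => ?_)⟩
    -- The zero space is a unit type, so its elements agree definitionally.
    have h : p = 0 := rfl
    rw [h]
    exact ⟨fun _ => Submodule.zero_mem _, fun _ => Submodule.zero_mem _⟩
  · exact inferInstanceAs (Subsingleton PUnit)
  · intro W X Y Z f g
    exact pairIndex_tensorRel (LREL.rel f) (LREL.rel g)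

end LREL

section Symplectic

variable {K : Type u} [Field K]

/-! ### Isotropic and coisotropic modifications of a subspace -/

section Modification

variable {V : Type u} [AddCommGroup V] [Module K V] {D : LinearMap.BilinForm K V}

theorem le_orthogonal_iff {N : Submodule K V} :
    N ≤ D.orthogonal N ↔ ∀ a ∈ N, ∀ b ∈ N, D a b = 0 :=
  ⟨fun h a ha _ hb => h hb a ha, fun h b hb a ha => h a ha b hb⟩

theorem isotropic_sup_span (hD : D.IsAlt) {N : Submodule K V} (hN : N ≤ D.orthogonal N) {p : V}
    (hp : ∀ a ∈ N, D p a = 0) :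
    N ⊔ Submodule.span K {p} ≤ D.orthogonal (N ⊔ Submodule.span K {p}) := by
  rw [le_orthogonal_iff] at *
  intro a ha b hb
  obtain ⟨a, ha', r, hr, rfl⟩ := Submodule.mem_sup.1 ha
  obtain ⟨b, hb', r', hr', rfl⟩ := Submodule.mem_sup.1 hb
  obtain ⟨c, rfl⟩ := Submodule.mem_span_singleton.1 hr
  obtain ⟨c', rfl⟩ := Submodule.mem_span_singleton.1 hr'
  have h1 : D a p = 0 := by rw [← hD.neg_eq p a, hp a ha', neg_zero]
  simp [hN a ha' b hb', h1, hp b hb', hD p]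

theorem isotropic_inf_ker_sup_span (hD : D.IsAlt) {N : Submodule K V} (hN : N ≤ D.orthogonal N)
    (p : V) : N ⊓ LinearMap.ker (D p) ⊔ Submodule.span K {p} ≤
      D.orthogonal (N ⊓ LinearMap.ker (D p) ⊔ Submodule.span K {p}) := by
  refine isotropic_sup_span hD ?_ fun a ha => ha.2
  rw [le_orthogonal_iff] at *
  exact fun a ha b hb => hN a ha.1 b hb.1

/-- Here N is the sum of N ∩ ker (D p) and the line of v. A suitable q - c p is orthogonal to v, and
q and p are both orthogonal to N ∩ ker (D p); so q - c p is orthogonal to N, hence in N. No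
dimension count is needed. -/
theorem exists_sub_smul_mem (hD : D.IsAlt) {N : Submodule K V} (hN : D.orthogonal N ≤ N) {p v : V}
    (hv : v ∈ N) (hpv : D p v ≠ 0) {q : V} (hq : ∀ a ∈ N ⊓ LinearMap.ker (D p), D a q = 0) :
    ∃ c : K, q - c • p ∈ N := by
  have hvp : D v p ≠ 0 := by rwa [← hD.neg_eq p v, neg_ne_zero]
  refine ⟨D v q / D v p, hN fun a ha => ?_⟩
  have hb : a - (D p a / D p v) • v ∈ N ⊓ LinearMap.ker (D p) := by
    refine ⟨N.sub_mem ha (N.smul_mem _ hv), ?_⟩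
    change D p (a - (D p a / D p v) • v) = 0
    rw [map_sub, map_smul, smul_eq_mul, div_mul_cancel₀ _ hpv, sub_self]
  have h1 := hq _ hb
  have h2 : D (a - (D p a / D p v) • v) p = 0 := by
    rw [← hD.neg_eq p, show D p (a - (D p a / D p v) • v) = 0 from hb.2, neg_zero]
  have h3 : D v (q - (D v q / D v p) • p) = 0 := by
    rw [map_sub, map_smul, smul_eq_mul, div_mul_cancel₀ _ hvp, sub_self]
  have e : a = (a - (D p a / D p v) • v) + (D p a / D p v) • v := (sub_add_cancel _ _).symm
  change D a (q - (D v q / D v p) • p) = 0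
  rw [e, map_add, LinearMap.add_apply, map_smul, LinearMap.smul_apply, h3, smul_zero, add_zero,
    map_sub, map_smul, h1, h2, smul_zero, sub_zero]

theorem coisotropic_inf_ker (hD : D.IsAlt) {N : Submodule K V} (hN : D.orthogonal N ≤ N) {p v : V}
    (hp : p ∈ N) (hv : v ∈ N) (hpv : D p v ≠ 0) :
    D.orthogonal (N ⊓ LinearMap.ker (D p)) ≤ N ⊓ LinearMap.ker (D p) := by
  intro q hq
  have hq : ∀ a ∈ N ⊓ LinearMap.ker (D p), D a q = 0 := hq
  obtain ⟨c, hc⟩ := exists_sub_smul_mem hD hN hv hpv hq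
  refine ⟨?_, hq p ⟨hp, hD p⟩⟩
  simpa using N.add_mem hc (N.smul_mem c hp)

theorem coisotropic_inf_ker_sup_span (hD : D.IsAlt) {N : Submodule K V} (hN : D.orthogonal N ≤ N)
    {p v : V} (hv : v ∈ N) (hpv : D p v ≠ 0) :
    D.orthogonal (N ⊓ LinearMap.ker (D p) ⊔ Submodule.span K {p}) ≤
      N ⊓ LinearMap.ker (D p) ⊔ Submodule.span K {p} := by
  intro q hq
  have hq : ∀ a ∈ N ⊓ LinearMap.ker (D p) ⊔ Submodule.span K {p}, D a q = 0 := hq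
  obtain ⟨c, hc⟩ := exists_sub_smul_mem hD hN hv hpv
    fun a ha => hq a (Submodule.mem_sup_left ha)
  have h1 : D p q = 0 := hq p (Submodule.mem_sup_right (Submodule.mem_span_singleton_self p))
  refine Submodule.mem_sup.2 ⟨q - c • p, ⟨hc, ?_⟩, c • p,
    Submodule.smul_mem _ c (Submodule.mem_span_singleton_self p), sub_add_cancel _ _⟩
  change D p (q - c • p) = 0
  rw [map_sub, map_smul, h1, hD p, smul_zero, sub_zero]

end Modification

theorem diffForm_isAlt (X Y : Symp K) : (diffForm X Y).IsAlt := by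
  rintro ⟨x, y⟩
  rw [diffForm_apply, X.alt, Y.alt, sub_zero]

theorem Symp.exists_form_eq (X : Symp K) (l : Module.Dual K X.carrier) :
    ∃ w, X.form w = l := by
  have h : Function.Surjective X.form := by
    rw [← LinearMap.injective_iff_surjective_of_finrank_eq_finrank
      Subspace.dual_finrank_eq.symm, injective_iff_map_eq_zero]
    intro y hy
    exact X.nondegenerate.1 y fun y' => LinearMap.congr_fun hy y'
  exact h l

theorem exists_diffForm_eq (X Y : Symp K) (χ : Module.Dual K (X.carrier × Y.carrier)) :
    ∃ p, diffForm X Y p = χ := by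
  obtain ⟨a, ha⟩ := X.exists_form_eq (χ ∘ₗ LinearMap.inl K _ _)
  obtain ⟨b, hb⟩ := Y.exists_form_eq (χ ∘ₗ LinearMap.inr K _ _)
  -- The sign compensates for the opposite form on the second factor.
  refine ⟨(a, -b), LinearMap.ext fun ⟨x, y⟩ => ?_⟩
  rw [diffForm_apply, ha, map_neg, hb]
  simp [← map_add]

theorem Symp.exists_form_ne_zero (X : Symp K) {w : X.carrier} (hw : w ≠ 0) :
    ∃ y, X.form w y ≠ 0 := by
  by_contra! h
  exact hw (X.nondegenerate.1 w h)

/-- Isotropy passes to smaller subspaces and coisotropy to larger ones. So the relations of the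
stabilizations have to be checked for the axis only, where they are both; S = 0 and S = K² follow by
inclusion. -/
theorem IsIsotropic.mono {X Y : Symp K} {f f' : Submodule K (X.carrier × Y.carrier)}
    (h : IsIsotropic X Y f') (hf : f ≤ f') : IsIsotropic X Y f :=
  fun _ hp q hq => h (hf hp) q (hf hq)

theorem IsCoisotropic.mono {X Y : Symp K} {f f' : Submodule K (X.carrier × Y.carrier)}
    (h : IsCoisotropic X Y f') (hf : f' ≤ f) : IsCoisotropic X Y f :=
  fun _ hp => hf (h fun q hq => hp q (hf hq))

/-! ### The symplectic plane -/

variable (K) in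
/-- The symplectic plane. -/
def plane : Symp K where
  carrier := K × K
  form := LinearMap.mk₂ K (fun v v' => v.1 * v'.2 - v.2 * v'.1)
    (fun a b c => by simp only [Prod.fst_add, Prod.snd_add]; ring)
    (fun a b c => by simp only [Prod.smul_fst, Prod.smul_snd, smul_eq_mul]; ring)
    (fun a b c => by simp only [Prod.fst_add, Prod.snd_add]; ring)
    (fun a b c => by simp only [Prod.smul_fst, Prod.smul_snd, smul_eq_mul]; ring)
  alt v := by
    change v.1 * v.2 - v.2 * v.1 = 0
    ring
  nondegenerate := by
    constructor
    · rintro ⟨s, t⟩ h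
      have h1 : s * 1 - t * 0 = 0 := h (0, 1)
      have h2 : s * 0 - t * 1 = 0 := h (1, 0)
      exact Prod.ext (by simpa using h1) (by simpa using h2)
    · rintro ⟨s, t⟩ h
      have h1 : 0 * t - 1 * s = 0 := h (0, 1)
      have h2 : 1 * t - 0 * s = 0 := h (1, 0)
      exact Prod.ext (by simpa using h1) (by simpa using h2)

/-- The product with the symplectic plane. -/
def Symp.stabilize (X : Symp K) : Symp K := X.prod (plane K)

/-- The decomposition of the product with the symplectic plane. -/
def Symp.stabilizeEquiv (X : Symp K) : X.stabilize.carrier ≃ₗ[K] X.carrier × (K × K) :=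
  LinearEquiv.refl K _

theorem Symp.stabilize_form (X : Symp K) (x x' : X.carrier) (s t s' t' : K) :
    X.stabilize.form (x, (s, t)) (x', (s', t')) = X.form x x' + (s * t' - t * s') := rfl

variable {E Y : Type u} [AddCommGroup E] [Module K E] [AddCommGroup Y] [Module K Y]

theorem inclRel_mono (τ : E ≃ₗ[K] Y × (K × K)) {S T : Submodule K (K × K)} (h : S ≤ T) :
    inclRel τ S ≤ inclRel τ T := fun _ hp => ⟨hp.1, h hp.2⟩

theorem shearRel_mono (τ : E ≃ₗ[K] Y × (K × K)) {S T : Submodule K (K × K)} (h : S ≤ T) (w : Y)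
    (l : Module.Dual K Y) : shearRel τ S w l ≤ shearRel τ T w l := fun _ hp => ⟨hp.1, h hp.2⟩

theorem swapRel_mono (τ : E ≃ₗ[K] Y × (K × K)) {S T : Submodule K (K × K)} (h : S ≤ T) :
    swapRel τ S ≤ swapRel τ T := fun _ hp => ⟨hp.1, hp.2.1, h hp.2.2⟩

theorem swapRel_axis (τ : E ≃ₗ[K] Y × (K × K)) : swapRel τ (axis K) = idRel K E := by
  ext ⟨t, t'⟩
  constructor
  · rintro ⟨h1, h2, h3⟩
    exact τ.injective (Prod.ext h1 (Prod.ext h2 (sub_eq_zero.1 h3)))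
  · intro h
    have h : t = t' := h
    subst h
    exact ⟨rfl, rfl, sub_self _⟩

variable (X : Symp K)

theorem isIsotropic_inclRel_axis :
    IsIsotropic X.stabilize X (inclRel X.stabilizeEquiv (axis K)) := by
  rw [isIsotropic_iff]
  rintro ⟨x, s, t⟩ y ⟨x', s', t'⟩ y' ⟨h1, h2⟩ ⟨h1', h2'⟩
  have h1 : x = y := h1
  have h2 : t = 0 := h2
  have h1' : x' = y' := h1'
  have h2' : t' = 0 := h2'
  subst h1 h2 h1' h2'
  rw [Symp.stabilize_form]
  ring

theorem isCoisotropic_inclRel_axis :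
    IsCoisotropic X.stabilize X (inclRel X.stabilizeEquiv (axis K)) := by
  rw [isCoisotropic_iff]
  rintro ⟨x, s, t⟩ y h
  constructor
  · change x = y
    rw [← sub_eq_zero]
    refine X.nondegenerate.2 _ fun z => ?_
    have h' := h (z, (0, 0)) z ⟨rfl, rfl⟩
    rw [Symp.stabilize_form] at h'
    rw [map_sub, sub_eq_zero, ← h']
    ring
  · change t = 0
    have h' := h (0, (1, 0)) 0 ⟨rfl, rfl⟩
    rw [Symp.stabilize_form] at h'
    simpa using h'

variable {X} in
theorem mem_shearRel_axis {w x y : X.carrier} {l : Module.Dual K X.carrier} {s t : K} :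
    (x, ((y, (s, t)) : X.stabilize.carrier)) ∈ shearRel X.stabilizeEquiv (axis K) w l ↔
      x = y + s • w ∧ t - l y = 0 := Iff.rfl

/-- With l = ω(w, ·), replacing y by y + s w changes ω(y, y') by s ω(w, y') - s' ω(w, y), which is
exactly the plane form s t' - t s'. -/
theorem isIsotropic_shearRel_axis (w : X.carrier) :
    IsIsotropic X X.stabilize (shearRel X.stabilizeEquiv (axis K) w (X.form w)) := by
  rw [isIsotropic_iff]
  rintro x ⟨y, s, t⟩ x' ⟨y', s', t'⟩ ⟨h1, h2⟩ ⟨h1', h2'⟩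
  replace h1 : x = y + s • w := h1
  replace h2 : t = X.form w y := sub_eq_zero.1 h2
  replace h1' : x' = y' + s' • w := h1'
  replace h2' : t' = X.form w y' := sub_eq_zero.1 h2'
  rw [h1, h2, h1', h2']
  rw [Symp.stabilize_form]
  simp only [map_add, LinearMap.add_apply, map_smul, LinearMap.smul_apply, X.alt w, smul_eq_mul]
  rw [← X.alt.neg_eq w y]
  ring

theorem isCoisotropic_shearRel_axis (w : X.carrier) :
    IsCoisotropic X X.stabilize (shearRel X.stabilizeEquiv (axis K) w (X.form w)) := by
  rw [isCoisotropic_iff]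
  rintro x ⟨y, s, t⟩ h
  have h1 : x = y + s • w := by
    rw [← sub_eq_zero]
    refine X.nondegenerate.2 _ fun z => ?_
    -- Testing against the elements with s = 0 determines x.
    have h' := h z (z, (0, X.form w z)) (mem_shearRel_axis.2 ⟨by simp, sub_self _⟩)
    rw [Symp.stabilize_form] at h'
    rw [map_sub, map_add, map_smul, h', ← X.alt.neg_eq w z, smul_eq_mul]
    ring
  refine ⟨h1, ?_⟩
  change t - X.form w y = 0
  -- Testing against y = 0, s = 1 gives t = ω(w, x), and ω(w, x) = ω(w, y) because ω(w, w) = 0.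
  have h' := h w (0, (1, 0)) (mem_shearRel_axis.2 ⟨by simp, by simp⟩)
  rw [Symp.stabilize_form, h1] at h'
  simp only [map_add, map_smul, X.alt w, smul_zero, add_zero, map_zero, LinearMap.zero_apply,
    one_mul, zero_mul, sub_zero, zero_add] at h'
  rw [h', sub_self]

variable {X} {Z : Symp K}

theorem extRel_stabilizeEquiv (f : Submodule K (X.carrier × Z.carrier)) :
    extRel X.stabilizeEquiv Z.stabilizeEquiv f = tensorRel f (K × K) := by
  ext ⟨t, t'⟩
  exact and_comm

/-! ### Modifications of relations -/

theorem IsIsotropic.form_eq_zero {f : Submodule K (X.carrier × Z.carrier)}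
    (hf : IsIsotropic X Z f) {w : Z.carrier} (hw : (0, w) ∈ f) (x : X.carrier) (z : Z.carrier)
    (h : (x, z) ∈ f) : Z.form w z = 0 := by
  have h' := isIsotropic_iff.1 hf _ _ _ _ hw h
  rw [← h', map_zero, LinearMap.zero_apply]

theorem IsCoisotropic.mem_of_form_eq_zero {f : Submodule K (X.carrier × Z.carrier)}
    (hf : IsCoisotropic X Z f) {w : Z.carrier} (h : ∀ x z, (x, z) ∈ f → Z.form w z = 0) :
    (0, w) ∈ f := by
  refine isCoisotropic_iff.1 hf _ _ fun x z hxz => ?_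
  rw [map_zero, ← Z.alt.neg_eq w z, h x z hxz, neg_zero]

/-- A functional that vanishes on g but not at (w, 0) is pairing with some p. Being orthogonal to g,
p can be added without losing isotropy, and ω(w, ·) does not vanish on its first component. -/
theorem IsIsotropic.exists_stepRel_bot {g : Submodule K (X.carrier × Z.carrier)}
    (hg : IsIsotropic X Z g) {w : X.carrier} (hw : (w, 0) ∉ g)
    (hl : ∀ x z, (x, z) ∈ g → X.form w x = 0) :
    ∃ g', IsIsotropic X Z g' ∧ StronglyTransversal (stepRel ⊥ w (X.form w)) g' ∧
      compRel (stepRel ⊥ w (X.form w)) g' = g := by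
  obtain ⟨χ, hχ, hgχ⟩ := Submodule.exists_le_ker_of_notMem hw
  obtain ⟨p, rfl⟩ := exists_diffForm_eq X Z χ
  refine ⟨_, isotropic_sup_span (diffForm_isAlt X Z) hg (p := p) fun a ha => hgχ ha,
    stepRel_bot_comp w hl ?_⟩
  rw [diffForm_apply, map_zero, sub_zero, ← X.alt.neg_eq, neg_ne_zero] at hχ
  exact hχ

theorem diffForm_left (x x' : X.carrier) :
    diffForm X Z (x, 0) (x', 0) = X.form x x' := by
  rw [diffForm_apply, map_zero]
  exact sub_zero _

/-- One vector p = (y, 0) with ω(w, y) ≠ 0 plays both roles: it is added to g, and pairing with it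
is the functional ψ that cuts g down. Then ψ p = 0 because the form is alternating. -/
theorem IsIsotropic.exists_stepRel_axis {g : Submodule K (X.carrier × Z.carrier)}
    (hg : IsIsotropic X Z g) {w : X.carrier} (hw0 : w ≠ 0) (hw : (w, 0) ∈ g)
    (hl : ∀ x z, (x, z) ∈ g → X.form w x = 0) :
    ∃ g', IsIsotropic X Z g' ∧ StronglyTransversal (stepRel (axis K) w (X.form w)) g' ∧
      compRel (stepRel (axis K) w (X.form w)) g' = g := by
  obtain ⟨y, hy⟩ := X.exists_form_ne_zero hw0
  refine ⟨_, isotropic_inf_ker_sup_span (diffForm_isAlt X Z) hg (y, 0),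
    stepRel_axis_comp hw hl ?_ hy (diffForm_isAlt X Z _)⟩
  rwa [diffForm_left, ← X.alt.neg_eq, neg_ne_zero]

theorem IsCoisotropic.exists_stepRel_axis {g : Submodule K (X.carrier × Z.carrier)}
    (hg : IsCoisotropic X Z g) {w : X.carrier} (hw0 : w ≠ 0) (hw : (w, 0) ∈ g)
    (hl : ∀ x z, (x, z) ∈ g → X.form w x = 0) :
    ∃ g', IsCoisotropic X Z g' ∧ StronglyTransversal (stepRel (axis K) w (X.form w)) g' ∧
      compRel (stepRel (axis K) w (X.form w)) g' = g := by
  obtain ⟨y, hy⟩ := X.exists_form_ne_zero hw0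
  have hψ : diffForm X Z (y, 0) (w, 0) ≠ 0 := by
    rwa [diffForm_left, ← X.alt.neg_eq, neg_ne_zero]
  exact ⟨_, coisotropic_inf_ker_sup_span (diffForm_isAlt X Z) hg hw hψ,
    stepRel_axis_comp hw hl hψ hy (diffForm_isAlt X Z _)⟩

/-- The hyperplane of g orthogonal to p stays coisotropic because p itself belongs to g. -/
theorem IsCoisotropic.exists_stepRel_top {g : Submodule K (X.carrier × Z.carrier)}
    (hg : IsCoisotropic X Z g) {w : X.carrier} (hw : (w, 0) ∈ g) {p : X.carrier × Z.carrier}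
    (hp : p ∈ g) (hpw : X.form w p.1 ≠ 0) :
    ∃ g', IsCoisotropic X Z g' ∧ StronglyTransversal (stepRel ⊤ w (X.form w)) g' ∧
      compRel (stepRel ⊤ w (X.form w)) g' = g := by
  have hψ : diffForm X Z p (w, 0) ≠ 0 := by
    rwa [diffForm_apply, map_zero, sub_zero, ← X.alt.neg_eq, neg_ne_zero]
  exact ⟨_, coisotropic_inf_ker (diffForm_isAlt X Z) hg hp hw hψ, stepRel_top_comp _ hw hψ⟩

end Symplectic

/-! ### Isotropic relations -/

section ILREL

variable {K : Type u} [Field K]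

theorem ILREL.isHomRel {Y X : ILREL K} {f : Submodule K (X.space.carrier × Y.space.carrier)}
    (hf : IsIsotropic X.space Y.space f) : IsHomRel (C := ILREL K) (Y := Y) (X := X) f :=
  ⟨(⟨f, hf⟩ : IsoRel X.space Y.space), rfl⟩

theorem ILREL.isIsotropic {Y X : ILREL K} (f : Y ⟶ X) :
    IsIsotropic X.space Y.space (homRel f) := IsoRel.isotropic f

/-- The stabilization of `ILREL` by an isotropic subspace of the plane. -/
def ILREL.stabilization (S : Submodule K (K × K)) (hS : ∀ s t, (s, t) ∈ S → (s, -t) ∈ S)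
    (h : S ≤ axis K) : Stabilization (ILREL K) S where
  homRel_injective h := IsoRel.ext h
  neg_mem := hS
  ext X := ⟨X.space.stabilize⟩
  equiv X := X.space.stabilizeEquiv
  incl_axis X := ILREL.isHomRel (isIsotropic_inclRel_axis X.space)
  incl X := ILREL.isHomRel ((isIsotropic_inclRel_axis X.space).mono (inclRel_mono _ h))
  proj_axis X := ILREL.isHomRel (isIsotropic_transpose (isIsotropic_inclRel_axis X.space))
  proj X := ILREL.isHomRel
    (isIsotropic_transpose ((isIsotropic_inclRel_axis X.space).mono (inclRel_mono _ h)))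
  swap X := by
    refine ILREL.isHomRel ((isIsotropic_id X.space.stabilize).mono ?_)
    rw [← swapRel_axis X.space.stabilizeEquiv]
    exact swapRel_mono _ h
  extend {Y X} f := by
    refine ILREL.isHomRel (X := ⟨X.space.stabilize⟩) (Y := ⟨Y.space.stabilize⟩) ?_
    rw [extRel_stabilizeEquiv]
    exact isIsotropic_tensor (ILREL.isIsotropic f) (plane K)

theorem ILREL.isHomRel_shearRel {S : Submodule K (K × K)} (h : S ≤ axis K) (Y : ILREL K)
    (w : Y.space.carrier) : IsHomRel (C := ILREL K) (Y := ⟨Y.space.stabilize⟩) (X := Y)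
      (shearRel Y.space.stabilizeEquiv S w (Y.space.form w)) :=
  ILREL.isHomRel ((isIsotropic_shearRel_axis Y.space w).mono (shearRel_mono _ h _ _))

theorem ILREL.isHomRel_transposeRel_shearRel {S : Submodule K (K × K)} (h : S ≤ axis K)
    (Y : ILREL K) (w : Y.space.carrier) :
    IsHomRel (C := ILREL K) (Y := Y) (X := ⟨Y.space.stabilize⟩)
      (transposeRel (shearRel Y.space.stabilizeEquiv S w (Y.space.form w))) :=
  ILREL.isHomRel (isIsotropic_transpose
    ((isIsotropic_shearRel_axis Y.space w).mono (shearRel_mono _ h _ _)))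

/-- If w ≠ 0 is common to kernel and indeterminacy, isotropy makes ω(w, ·) vanish on dom f and cod
g, and the shift of index (1,1) splits off. Otherwise a functional ω(w, ·) vanishes on both while
(0, w) ∉ f or (w, 0) ∉ g; the relation in question can be enlarged isotropically, which splits off
(1,0). -/
theorem ILREL.reducible : WW.Reducible
    (ILREL.stabilization (K := K) ⊥ neg_mem_bot bot_le).shift
    (ILREL.stabilization (K := K) (axis K) neg_mem_axis le_rfl).shift := by
  intro X Y Z f g h
  have hf := ILREL.isIsotropic f
  have hg := ILREL.isIsotropic g
  by_cases hd : kerRel (homRel f) ⊓ indetRel (homRel g) = ⊥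
  · have hc := (ne_bot_or_ne_top_of_pairIndex_ne_zero h).resolve_left (not_not.2 hd)
    obtain ⟨l, hl, hfl, hgl⟩ := exists_of_not_codisjoint hc
    obtain ⟨w, rfl⟩ := Y.space.exists_form_eq l
    have hw : w ≠ 0 := by
      rintro rfl
      exact hl (map_zero _)
    by_cases hgw : (w, 0) ∈ homRel g
    · have hfw : (w, 0) ∉ transposeRel (homRel f) :=
        fun hfw => hw ((Submodule.eq_bot_iff _).1 hd w ⟨hfw, hgw⟩)
      obtain ⟨f₁, h1, h2⟩ := (isIsotropic_transpose hf).exists_stepRel_bot hfw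
        fun y x hyx => hfl x y hyx
      obtain ⟨f', g', e⟩ := (ILREL.stabilization (K := K) ⊥ neg_mem_bot bot_le).reduce_right
        (g := g) (ILREL.isHomRel_transposeRel_shearRel bot_le Y w) (exists_sub_mem hl)
        eq_zero_of_mem_bot (shearInvariant_bot w fun z y hzy => hgl y z hzy)
        (ILREL.isHomRel (isIsotropic_transpose h1)) h2
      exact ⟨f', g', Or.inl e⟩
    · obtain ⟨g₁, h1, h2⟩ := hg.exists_stepRel_bot hgw hgl
      obtain ⟨f', g', e⟩ := (ILREL.stabilization (K := K) ⊥ neg_mem_bot bot_le).reduce_left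
        (ILREL.isHomRel_shearRel bot_le Y w) (exists_sub_mem hl)
        eq_zero_of_mem_bot (shearInvariant_bot w hfl) (ILREL.isHomRel h1) h2
      exact ⟨f', g', Or.inl e⟩
  · obtain ⟨w, hw, hfw, hgw⟩ := exists_of_not_disjoint hd
    have hl : Y.space.form w ≠ 0 := by
      obtain ⟨y, hy⟩ := Y.space.exists_form_ne_zero hw
      exact fun e => hy (LinearMap.congr_fun e y)
    obtain ⟨g₁, h1, h2⟩ := hg.exists_stepRel_axis hw hgw
      fun y z hyz =>
        (isIsotropic_transpose hg).form_eq_zero (f := transposeRel (homRel g)) hgw z y hyz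
    obtain ⟨f', g', e⟩ :=
      (ILREL.stabilization (K := K) (axis K) neg_mem_axis le_rfl).reduce_left
        (ILREL.isHomRel_shearRel le_rfl Y w) (exists_sub_mem hl) (eq_zero_of_smul_eq_zero hw)
        (shearInvariant_axis hfw (hf.form_eq_zero hfw)) (ILREL.isHomRel h1) h2
    exact ⟨f', g', Or.inr e⟩

theorem ILREL.isDoublyIndexed : IsDoublyIndexed (ILREL K) excessLeDefect := by
  refine isDoublyIndexed_of_reducible excessLeDefect _ _ ILREL.reducible ?_ ?_ ?_ ?_ ?_
  · rintro ⟨d, e⟩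
    rw [stabilizationIndex_bot, stabilizationIndex_axis]
    constructor
    · intro h
      have h : e ≤ d := h
      -- (d, e) = (d - e)(1,0) + e(1,1).
      exact ⟨d - e, e, by simp [h]⟩
    · rintro ⟨m, n, h⟩
      obtain ⟨h1, h2⟩ : m + n = d ∧ n = e := by simpa using h
      change e ≤ d
      omega
  · intro m n m' n' h
    rw [stabilizationIndex_bot, stabilizationIndex_axis] at h
    obtain ⟨h1, h2⟩ : m + n = m' + n' ∧ n = n' := by simpa using h
    omega
  · refine ⟨fun f g => IsoRel.ext (Submodule.ext fun p => ?_)⟩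
    have h : p = 0 := rfl
    rw [h]
    exact ⟨fun _ => Submodule.zero_mem _, fun _ => Submodule.zero_mem _⟩
  · exact inferInstanceAs (Subsingleton PUnit)
  · intro W X Y Z f g
    exact pairIndex_tensorRel (IsoRel.rel f) (IsoRel.rel g)

end ILREL

/-! ### Coisotropic relations -/

section CLREL

variable {K : Type u} [Field K]

theorem CLREL.isHomRel {Y X : CLREL K} {f : Submodule K (X.space.carrier × Y.space.carrier)}
    (hf : IsCoisotropic X.space Y.space f) : IsHomRel (C := CLREL K) (Y := Y) (X := X) f :=
  ⟨(⟨f, hf⟩ : CoisoRel X.space Y.space), rfl⟩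

theorem CLREL.isCoisotropic {Y X : CLREL K} (f : Y ⟶ X) :
    IsCoisotropic X.space Y.space (homRel f) := CoisoRel.coisotropic f

/-- The stabilization of `CLREL` by a coisotropic subspace of the plane. -/
def CLREL.stabilization (S : Submodule K (K × K)) (hS : ∀ s t, (s, t) ∈ S → (s, -t) ∈ S)
    (h : axis K ≤ S) : Stabilization (CLREL K) S where
  homRel_injective h := CoisoRel.ext h
  neg_mem := hS
  ext X := ⟨X.space.stabilize⟩
  equiv X := X.space.stabilizeEquiv
  incl_axis X := CLREL.isHomRel (isCoisotropic_inclRel_axis X.space)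
  incl X := CLREL.isHomRel ((isCoisotropic_inclRel_axis X.space).mono (inclRel_mono _ h))
  proj_axis X := CLREL.isHomRel (isCoisotropic_transpose (isCoisotropic_inclRel_axis X.space))
  proj X := CLREL.isHomRel
    (isCoisotropic_transpose ((isCoisotropic_inclRel_axis X.space).mono (inclRel_mono _ h)))
  swap X := by
    refine CLREL.isHomRel ((isCoisotropic_id X.space.stabilize).mono ?_)
    rw [← swapRel_axis X.space.stabilizeEquiv]
    exact swapRel_mono _ h
  extend {Y X} f := by
    refine CLREL.isHomRel (X := ⟨X.space.stabilize⟩) (Y := ⟨Y.space.stabilize⟩) ?_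
    rw [extRel_stabilizeEquiv]
    exact isCoisotropic_tensor (CLREL.isCoisotropic f) (plane K)

theorem CLREL.isHomRel_shearRel {S : Submodule K (K × K)} (h : axis K ≤ S) (Y : CLREL K)
    (w : Y.space.carrier) : IsHomRel (C := CLREL K) (Y := ⟨Y.space.stabilize⟩) (X := Y)
      (shearRel Y.space.stabilizeEquiv S w (Y.space.form w)) :=
  CLREL.isHomRel ((isCoisotropic_shearRel_axis Y.space w).mono (shearRel_mono _ h _ _))

theorem CLREL.isHomRel_transposeRel_shearRel {S : Submodule K (K × K)} (h : axis K ≤ S)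
    (Y : CLREL K) (w : Y.space.carrier) :
    IsHomRel (C := CLREL K) (Y := Y) (X := ⟨Y.space.stabilize⟩)
      (transposeRel (shearRel Y.space.stabilizeEquiv S w (Y.space.form w))) :=
  CLREL.isHomRel (isCoisotropic_transpose
    ((isCoisotropic_shearRel_axis Y.space w).mono (shearRel_mono _ h _ _)))

/-- Dual to the isotropic case. If ω(w, ·) vanishes on dom f + cod g, coisotropy puts w into kernel
and indeterminacy, and the shift of index (1,1) splits off. If dom f + cod g = Y, then for a common
w ≠ 0 the functional ω(w, ·) cannot vanish on both summands; the relation on which it does not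
vanish can be cut down coisotropically, which splits off (0,1). -/
theorem CLREL.reducible : WW.Reducible
    (CLREL.stabilization (K := K) ⊤ (fun _ _ _ => trivial) le_top).shift
    (CLREL.stabilization (K := K) (axis K) neg_mem_axis le_rfl).shift := by
  intro X Y Z f g h
  have hf := CLREL.isCoisotropic f
  have hg := CLREL.isCoisotropic g
  by_cases hc : domRel (homRel f) ⊔ codRel (homRel g) = ⊤
  · have hd := (ne_bot_or_ne_top_of_pairIndex_ne_zero h).resolve_right (not_not.2 hc)
    obtain ⟨w, hw, hfw, hgw⟩ := exists_of_not_disjoint hd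
    by_cases hgl : ∃ p ∈ homRel g, Y.space.form w p.1 ≠ 0
    · obtain ⟨p, hp, hpw⟩ := hgl
      obtain ⟨g₁, h1, h2⟩ := hg.exists_stepRel_top hgw hp hpw
      obtain ⟨f', g', e⟩ :=
        (CLREL.stabilization (K := K) ⊤ (fun _ _ _ => trivial) le_top).reduce_left
          (CLREL.isHomRel_shearRel le_top Y w) (fun _ => ⟨0, 0, trivial⟩)
          (eq_zero_of_smul_eq_zero hw) (shearInvariant_top hfw _) (CLREL.isHomRel h1) h2
      exact ⟨f', g', Or.inl e⟩
    · push Not at hgl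
      obtain ⟨p, hp, hpw⟩ : ∃ p ∈ transposeRel (homRel f), Y.space.form w p.1 ≠ 0 := by
        by_contra! hfl
        obtain ⟨y, hy⟩ := Y.space.exists_form_ne_zero hw
        obtain ⟨a, ha, b, hb, rfl⟩ := Submodule.mem_sup.1 (hc ▸ Submodule.mem_top (x := y))
        obtain ⟨x, hx⟩ := mem_domRel.1 ha
        obtain ⟨z, hz⟩ := mem_codRel.1 hb
        refine hy ?_
        rw [map_add, show Y.space.form w a = 0 from hfl (a, x) hx,
          show Y.space.form w b = 0 from hgl (b, z) hz, add_zero]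
      obtain ⟨f₁, h1, h2⟩ := (isCoisotropic_transpose hf).exists_stepRel_top hfw hp hpw
      obtain ⟨f', g', e⟩ :=
        (CLREL.stabilization (K := K) ⊤ (fun _ _ _ => trivial) le_top).reduce_right
          (g := g) (CLREL.isHomRel_transposeRel_shearRel le_top Y w) (fun _ => ⟨0, 0, trivial⟩)
          (eq_zero_of_smul_eq_zero hw) (shearInvariant_top (f := transposeRel (homRel g)) hgw _)
          (CLREL.isHomRel (isCoisotropic_transpose h1)) h2
      exact ⟨f', g', Or.inl e⟩
  · obtain ⟨l, hl, hfl, hgl⟩ := exists_of_not_codisjoint hc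
    obtain ⟨w, rfl⟩ := Y.space.exists_form_eq l
    have hw : w ≠ 0 := by
      rintro rfl
      exact hl (map_zero _)
    have hfw := hf.mem_of_form_eq_zero hfl
    have hgw : (w, 0) ∈ homRel g := (isCoisotropic_transpose hg).mem_of_form_eq_zero
      fun z y hzy => hgl y z hzy
    obtain ⟨g₁, h1, h2⟩ := hg.exists_stepRel_axis hw hgw hgl
    obtain ⟨f', g', e⟩ :=
      (CLREL.stabilization (K := K) (axis K) neg_mem_axis le_rfl).reduce_left
        (CLREL.isHomRel_shearRel le_rfl Y w) (exists_sub_mem hl) (eq_zero_of_smul_eq_zero hw)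
        (shearInvariant_axis hfw hfl) (CLREL.isHomRel h1) h2
    exact ⟨f', g', Or.inr e⟩

theorem CLREL.isDoublyIndexed : IsDoublyIndexed (CLREL K) defectLeExcess := by
  refine isDoublyIndexed_of_reducible defectLeExcess _ _ CLREL.reducible ?_ ?_ ?_ ?_ ?_
  · rintro ⟨d, e⟩
    rw [stabilizationIndex_top, stabilizationIndex_axis]
    constructor
    · intro h
      have h : d ≤ e := h
      -- (d, e) = (e - d)(0,1) + d(1,1).
      exact ⟨e - d, d, by simp [h]⟩
    · rintro ⟨m, n, h⟩
      obtain ⟨h1, h2⟩ : n = d ∧ m + n = e := by simpa using h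
      change d ≤ e
      omega
  · intro m n m' n' h
    rw [stabilizationIndex_top, stabilizationIndex_axis] at h
    obtain ⟨h1, h2⟩ : n = n' ∧ m + n = m' + n' := by simpa using h
    omega
  · refine ⟨fun f g => CoisoRel.ext (Submodule.ext fun p => ?_)⟩
    have h : p = 0 := rfl
    rw [h]
    exact ⟨fun _ => Submodule.zero_mem _, fun _ => Submodule.zero_mem _⟩
  · exact inferInstanceAs (Subsingleton PUnit)
  · intro W X Y Z f g
    exact pairIndex_tensorRel (CoisoRel.rel f) (CoisoRel.rel g)

end CLREL

end WWRel

theorem mainTheorem1 (K : Type u) [Field K] :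
    WWRel.IsDoublyIndexed (WWRel.LREL K) ⊤ ∧
    WWRel.IsDoublyIndexed (WWRel.ILREL K) WWRel.excessLeDefect ∧
    WWRel.IsDoublyIndexed (WWRel.CLREL K) WWRel.defectLeExcess :=
  ⟨WWRel.LREL.isDoublyIndexed, WWRel.ILREL.isDoublyIndexed, WWRel.CLREL.isDoublyIndexed⟩
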